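/- Let $B$ be a connected smooth surface (Hausdorff, second countable, without boundary) and let $\mathcal X$ be a smooth four-dimensional Riemannian groupoid with trivial isotropy, orbit space $B$ and local $\mathbb R^2$-symmetry. Explicitly, $\mathcal X$ is given by a cover of $B$ by contractible open sets $U_a$; smooth maps $f_{ab}:U_a\cap U_b\to\mathbb R^2$ (relevant only up to locally constant maps) and locally constant maps $\gamma_{ab}:U_a\cap U_b\to \mathrm{GL}(2,\mathbb R)$ with $\det\gamma_{ab}=\pm1$, such that on triple overlaps $\gamma_{bc}\gamma_{ab}=\gamma_{ac}$ and $f_{ac}-f_{ab}-\gamma_{ab}^{-1}f_{bc}$ is locally constant; a Riemannian metric $g_B$ on $B$; and, on each $U_a$, a smooth map $G_a$ to the positive-definite symmetric $2\times2$ matrices and a smooth $\mathbb R^2$-valued $1$-form $A_a$, such that on $U_a\cap U_b$ $$G_a=\gamma_{ab}^{T}G_b\gamma_{ab},\qquad A_b=\gamma_{ab}(A_a+df_{ab}).$$ The unit space of $\mathcal X$ is $M=\bigsqcup_a U_a\times\mathbb R^2$, with the metric $$g_{\mathcal X}=\sum_{I,J}G_{IJ}(dx^I+A^I)(dx^J+A^J)+g_B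 ,$$ and the transition maps are $(b,x)\mapsto(b,\gamma_{ab}(x-f_{ab}(b)))$. Since $\det\gamma_{ab}=\pm1$, the functions $\det G_a$ define a function $\det G$ on $B$. Put $F=dA$. (The limits of collapsing sequences of almost Ricci-flat $4$-manifolds, with two-dimensional orbit space, trivial isotropy and $T^2$-fibers, are of this form.) Call $B$ parabolic if every nonnegative $C^2$-function $\phi$ on $B$ that is bounded above and satisfies $\triangle\phi\ge0$ is constant. Assume that $g_{\mathcal X}$ is Ricci-flat, that $\det G$ is bounded above and that $B$ is parabolic. Then: 1. $\det G$ is constant. 2. $F=0$. 3. Let $p:\widetilde B\to B$ be a universal cover. The pullback to $\widetilde B$ of the flat $\mathbb R^2$-bundle defined by $\{\gamma_{ab}\}$ has a global flat frame. Fix one, and let $\widetilde G$ be the matrix function on $\widetilde B$ giving the fiber inner products in this frame. There is a homomorphism $\rho$ (the monodromy in this frame) from the deck group of $p$ to the matrices of determinant $\pm1$ with $\widetilde G(\sigma x)=\rho(\sigma)^{-T}\widetilde G(x)\rho(\sigma)^{-1}$. Identify inner products on $\mathbb R^2$ up to scale with points $\tau$ of the upper half-plane $H^2$ by $$\widetilde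 G=\frac{\sqrt{\det\widetilde G}}{\operatorname{Im}\tau}\begin{pmatrix}1&\operatorname{Re}\tau\\ \operatorname{Re}\tau&|\tau|^2\end{pmatrix}.$$ Then there is an orientation of $\widetilde B$ such that the resulting map $\widetilde G:\widetilde B\to H^2$ is holomorphic, $\widetilde B$ having the complex structure given by $p^*g_B$ and the orientation. 4. The metric $g_{\mathcal X}$ on each component $U_a\times\mathbb R^2$ of $M$ is semiflat Kähler: there are an orientation of $U_a$, with associated complex structure $j$, and an $\mathbb R^2$-invariant smooth complex structure $J$ on $U_a\times\mathbb R^2$ such that $g_{\mathcal X}$ is Kähler with respect to $J$, the projection to $(U_a,j)$ is holomorphic, and $g_{\mathcal X}$ restricts to a flat metric on each fiber. Moreover, the pullback of $\mathcal X$ to $\widetilde B$ is semiflat Kähler in the same sense, with the orientation of 3 and with complex structures on the sets $p^{-1}(U_a)\times\mathbb R^2$ that are preserved by the transition maps. -/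

import Mathlib

open scoped Manifold ContDiff Topology UpperHalfPlane Matrix
open Set

universe u v w

/-- The Euclidean plane, the model space of surfaces. -/
abbrev E2 : Type := EuclideanSpace ℝ (Fin 2)

noncomputable section

/-! ### Riemannian geometry in coordinates

A (pseudo)metric on an open subset of a real normed space `V` is given by its component matrix
`g : V → Matrix k k ℝ` with respect to a coordinate basis `e : k → V`. -/

namespace CoordGeom

variable {k : Type*} [Fintype k] [DecidableEq k] {V : Type*} [NormedAddCommGroup V]
  [NormedSpace ℝ V]

/-- The partial derivative `∂ᵢ f` at `q`. -/
def pd (e : k → V) (i : k) (f : V → ℝ) (q : V) : ℝ := fderiv ℝ f q (e i)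

/-- The Christoffel symbol `Γˡᵢⱼ = ½ gˡᵐ (∂ᵢ gₘⱼ + ∂ⱼ gᵢₘ - ∂ₘ gᵢⱼ)`. -/
def christoffel (e : k → V) (g : V → Matrix k k ℝ) (l i j : k) (q : V) : ℝ :=
  (1 / 2) * ∑ m, (g q)⁻¹ l m *
    (pd e i (fun r => g r m j) q + pd e j (fun r => g r i m) q - pd e m (fun r => g r i j) q)

/-- The curvature tensor `Rˡₛᵢⱼ = ∂ᵢ Γˡⱼₛ - ∂ⱼ Γˡᵢₛ + Γˡᵢₘ Γᵐⱼₛ - Γˡⱼₘ Γᵐᵢₛ`. -/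
def riemann (e : k → V) (g : V → Matrix k k ℝ) (l s i j : k) (q : V) : ℝ :=
  pd e i (christoffel e g l j s) q - pd e j (christoffel e g l i s) q
    + ∑ m, (christoffel e g l i m q * christoffel e g m j s q
      - christoffel e g l j m q * christoffel e g m i s q)

/-- The Ricci tensor `Rₛⱼ = Rⁱₛᵢⱼ`. -/
def ricci (e : k → V) (g : V → Matrix k k ℝ) (s j : k) (q : V) : ℝ :=
  ∑ i, riemann e g i s i j q

/-- The Laplace-Beltrami operator `Δf = gⁱʲ (∂ᵢ∂ⱼ f - Γˡᵢⱼ ∂ₗ f)`. -/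
def laplacian (e : k → V) (g : V → Matrix k k ℝ) (f : V → ℝ) (q : V) : ℝ :=
  ∑ i, ∑ j, (g q)⁻¹ i j * (pd e i (pd e j f) q - ∑ l, christoffel e g l i j q * pd e l f q)

/-- The Nijenhuis tensor of the endomorphism field with components `J i j = Jⁱⱼ`:
`Nˡᵢⱼ = Jᵐᵢ ∂ₘ Jˡⱼ - Jᵐⱼ ∂ₘ Jˡᵢ - Jˡₘ (∂ᵢ Jᵐⱼ - ∂ⱼ Jᵐᵢ)`. -/
def nijenhuis (e : k → V) (J : V → Matrix k k ℝ) (l i j : k) (q : V) : ℝ :=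
  ∑ m, (J q m i * pd e m (fun r => J r l j) q - J q m j * pd e m (fun r => J r l i) q
    - J q l m * (pd e i (fun r => J r m j) q - pd e j (fun r => J r m i) q))

/-- The component `(dω)ᵢⱼₗ` of the exterior derivative of the 2-form with components `β i j`. -/
def extDeriv2 (e : k → V) (β : V → Matrix k k ℝ) (i j l : k) (q : V) : ℝ :=
  pd e i (fun r => β r j l) q + pd e j (fun r => β r l i) q + pd e l (fun r => β r i j) q

end CoordGeom

open CoordGeom

/-- The standard coordinate basis of the plane. -/
def baseBasis : Fin 2 → E2 := fun α => EuclideanSpace.single α 1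

/-- The coordinate basis of `ℝ² × ℝ²`: base coordinates `inl α`, fibre coordinates `inr I`. -/
def totalBasis : Fin 2 ⊕ Fin 2 → E2 × (Fin 2 → ℝ) :=
  Sum.elim (fun α => (baseBasis α, 0)) (fun I => (0, Pi.single I 1))

section Surface

variable {S : Type*} [TopologicalSpace S] [ChartedSpace E2 S]

/-- The coordinate vector `∂_α` of the chart `φ` at the point with coordinates `y`. -/
def coordVec (φ : OpenPartialHomeomorph S E2) (y : E2) (α : Fin 2) :
    TangentSpace 𝓘(ℝ, E2) (φ.symm y) :=
  mfderiv 𝓘(ℝ, E2) 𝓘(ℝ, E2) φ.symm y (baseBasis α)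

/-- The components of a tangent vector at `b` in the chart `φ`. -/
def vecComp (φ : OpenPartialHomeomorph S E2) (b : S) (v : TangentSpace 𝓘(ℝ, E2) b) : Fin 2 → ℝ :=
  fun α => (show E2 from mfderiv 𝓘(ℝ, E2) 𝓘(ℝ, E2) φ b v) α

/-- Fields of bilinear forms on the tangent spaces of a surface. -/
abbrev TangentForm (S : Type*) [TopologicalSpace S] [ChartedSpace E2 S] :=
  ∀ b : S, TangentSpace 𝓘(ℝ, E2) b →L[ℝ] TangentSpace 𝓘(ℝ, E2) b →L[ℝ] ℝ

/-- Fields of endomorphisms of the tangent spaces of a surface. -/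
abbrev TangentEndo (S : Type*) [TopologicalSpace S] [ChartedSpace E2 S] :=
  ∀ b : S, TangentSpace 𝓘(ℝ, E2) b →L[ℝ] TangentSpace 𝓘(ℝ, E2) b

/-- `g` is a smooth Riemannian metric. -/
def IsRiemannianMetric [IsManifold 𝓘(ℝ, E2) ∞ S] (g : TangentForm S) : Prop :=
  ∃ m : Bundle.ContMDiffRiemannianMetric 𝓘(ℝ, E2) ∞ E2
    (fun b : S => TangentSpace 𝓘(ℝ, E2) b), ∀ b, m.inner b = g b

/-- The components `g_{αβ}` in the chart `φ`. -/
def metricComp (g : TangentForm S) (φ : OpenPartialHomeomorph S E2) (y : E2) :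
    Matrix (Fin 2) (Fin 2) ℝ :=
  Matrix.of fun α β => g (φ.symm y) (coordVec φ y α) (coordVec φ y β)

/-- The components `J^α_β` in the chart `φ`. -/
def endoComp (J : TangentEndo S) (φ : OpenPartialHomeomorph S E2) (y : E2) :
    Matrix (Fin 2) (Fin 2) ℝ :=
  Matrix.of fun α β => vecComp φ (φ.symm y) (J (φ.symm y) (coordVec φ y β)) α

/-- `f` is subharmonic: `Δf ≥ 0`, computed in every chart of the atlas. -/
def IsSubharmonic (g : TangentForm S) (f : S → ℝ) : Prop :=
  ∀ φ ∈ atlas E2 S, ∀ y ∈ φ.target,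
    0 ≤ laplacian baseBasis (metricComp g φ) (fun z => f (φ.symm z)) y

/-- A Riemannian surface (without boundary, possibly incomplete) is parabolic if every nonnegative
`C²` subharmonic function that is bounded above is constant. -/
def IsParabolic (g : TangentForm S) : Prop :=
  ∀ f : S → ℝ, ContMDiff 𝓘(ℝ, E2) 𝓘(ℝ, ℝ) 2 f → (∀ b, 0 ≤ f b) → BddAbove (range f) →
    IsSubharmonic g f → ∃ c, ∀ b, f b = c

/-- `J` is, on the open set `U`, the field of rotations by a right angle determined by the metric
`g` and an orientation of `U`. On a Riemannian surface the choice of an orientation is the same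
as the choice of such a `J`, and `J` is the associated complex structure. -/
structure IsRotationField (g : TangentForm S) (U : Set S) (J : TangentEndo S) : Prop where
  sq : ∀ b ∈ U, ∀ v, J b (J b v) = -v
  orth : ∀ b ∈ U, ∀ v v', g b (J b v) (J b v') = g b v v'
  smooth : ∀ φ ∈ atlas E2 S, ∀ α β,
    ContDiffOn ℝ ∞ (fun y => endoComp J φ y α β) (φ.target ∩ φ.symm ⁻¹' U)

/-- The map `τ` from a surface to the upper half-plane is holomorphic for the complex structure
`J` on the surface: it is differentiable and `dτ ∘ J = i dτ`. -/
def IsHolomorphicToH (J : TangentEndo S) (τ : S → ℍ) : Prop :=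
  MDifferentiable 𝓘(ℝ, E2) 𝓘(ℝ, ℂ) (fun b => (τ b : ℂ)) ∧
  ∀ b (v : TangentSpace 𝓘(ℝ, E2) b),
    (show ℂ from mfderiv 𝓘(ℝ, E2) 𝓘(ℝ, ℂ) (fun b => (τ b : ℂ)) b (J b v)) =
      Complex.I * (show ℂ from mfderiv 𝓘(ℝ, E2) 𝓘(ℝ, ℂ) (fun b => (τ b : ℂ)) b v)

end Surface

/-- The identification of inner products on `ℝ²`, up to scale, with the hyperbolic plane: `S` is
`√(det S) / Im τ` times the matrix with rows `(1, Re τ)` and `(Re τ, |τ|²)`. -/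
def toHyperbolic (S : Matrix (Fin 2) (Fin 2) ℝ) (hS : S.PosDef) : ℍ :=
  ⟨⟨S 0 1 / S 0 0, √S.det / S 0 0⟩, div_pos (Real.sqrt_pos.2 hS.det_pos) hS.diag_pos⟩

/-! ### Riemannian groupoids with local `ℝ²`-symmetry -/

/-- The data of a Riemannian groupoid with trivial isotropy, orbit space the surface `B`, and an
action of `ℝ²` by local isometries: an open cover `U a` of `B`, transition maps represented by
pairs `(f, γ)` (where `f` matters up to locally constant functions), fibre metrics `G a`, `ℝ²`-valued
1-forms `A a` and a metric `g` on `B`. The unit space is the disjoint union of the products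
`U a × ℝ²`, with metric `G_{IJ} (dx^I + A^I) (dx^J + A^J) + g`; the transition from `U a × ℝ²` to
`U c × ℝ²` is `(b, x) ↦ (b, γ (x - f))`, for the representatives `f` of the class of `f a c`.
The functions are only relevant on `U a`, respectively on `U a ∩ U c`. -/
structure TorusGroupoid (ι : Type*) (B : Type*) [TopologicalSpace B] [ChartedSpace E2 B] where
  U : ι → Set B
  cover : ∀ b, ∃ a, b ∈ U a
  γ : ι → ι → B → GL (Fin 2) ℝ
  f : ι → ι → B → (Fin 2 → ℝ)
  G : ι → B → Matrix (Fin 2) (Fin 2) ℝ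
  posDef : ∀ a, ∀ b ∈ U a, (G a b).PosDef
  A : ι → ∀ b : B, TangentSpace 𝓘(ℝ, E2) b →L[ℝ] (Fin 2 → ℝ)
  g : TangentForm B

namespace TorusGroupoid

variable {ι : Type*} {B : Type*} [TopologicalSpace B] [ChartedSpace E2 B]

/-- The part of the range of the chart `φ` that parametrizes a part of `U a`. -/
def baseDom (X : TorusGroupoid ι B) (a : ι) (φ : OpenPartialHomeomorph B E2) : Set E2 :=
  φ.target ∩ φ.symm ⁻¹' X.U a

/-- The differential of `f a c`. -/
def df (X : TorusGroupoid ι B) (a c : ι) (b : B) (v : TangentSpace 𝓘(ℝ, E2) b) : Fin 2 → ℝ :=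
  mfderiv 𝓘(ℝ, E2) 𝓘(ℝ, Fin 2 → ℝ) (X.f a c) b v

/-- The component `A^I_α` in the chart `φ`. -/
def AComp (X : TorusGroupoid ι B) (a : ι) (φ : OpenPartialHomeomorph B E2) (I α : Fin 2)
    (y : E2) : ℝ :=
  X.A a (φ.symm y) (coordVec φ y α) I

/-- The component `F^I_{αβ} = ∂_α A^I_β - ∂_β A^I_α` of the curvature in the chart `φ`. -/
def FComp (X : TorusGroupoid ι B) (a : ι) (φ : OpenPartialHomeomorph B E2) (I α β : Fin 2)
    (y : E2) : ℝ :=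
  pd baseBasis α (X.AComp a φ I β) y - pd baseBasis β (X.AComp a φ I α) y

/-- The conditions making the data a smooth Riemannian groupoid whose flat `ℝ²`-bundle has
structure group reduced to the matrices of determinant `±1`. -/
structure IsRiemannian [IsManifold 𝓘(ℝ, E2) ∞ B] (X : TorusGroupoid ι B) : Prop where
  isOpen : ∀ a, IsOpen (X.U a)
  contractible : ∀ a, ContractibleSpace (X.U a)
  γ_locConst : ∀ a c, ∀ b ∈ X.U a ∩ X.U c, ∀ᶠ b' in 𝓝 b, X.γ a c b' = X.γ a c b
  γ_det : ∀ a c, ∀ b ∈ X.U a ∩ X.U c, |(X.γ a c b : Matrix (Fin 2) (Fin 2) ℝ).det| = 1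
  f_smooth : ∀ a c, ContMDiffOn 𝓘(ℝ, E2) 𝓘(ℝ, Fin 2 → ℝ) ∞ (X.f a c) (X.U a ∩ X.U c)
  γ_cocycle : ∀ a c d, ∀ b ∈ X.U a ∩ X.U c ∩ X.U d, X.γ c d b * X.γ a c b = X.γ a d b
  /-- The cocycle condition for `f`, up to locally constant functions. -/
  f_cocycle : ∀ a c d, ∀ b ∈ X.U a ∩ X.U c ∩ X.U d, ∀ᶠ b' in 𝓝 b,
    X.f a d b' - X.f a c b' - (X.γ a c b')⁻¹.1 *ᵥ X.f c d b' =
      X.f a d b - X.f a c b - (X.γ a c b)⁻¹.1 *ᵥ X.f c d b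
  g_riemannian : IsRiemannianMetric X.g
  G_smooth : ∀ a I J, ContMDiffOn 𝓘(ℝ, E2) 𝓘(ℝ, ℝ) ∞ (fun b => X.G a b I J) (X.U a)
  A_smooth : ∀ a, ∀ φ ∈ atlas E2 B, ∀ I α, ContDiffOn ℝ ∞ (X.AComp a φ I α) (X.baseDom a φ)
  /-- Invariance of the fibre metrics under the transition maps. -/
  G_compat : ∀ a c, ∀ b ∈ X.U a ∩ X.U c,
    X.G a b = (X.γ a c b).1ᵀ * X.G c b * (X.γ a c b).1
  /-- Invariance of the connection under the transition maps. -/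
  A_compat : ∀ a c, ∀ b ∈ X.U a ∩ X.U c, ∀ v,
    X.A c b v = (X.γ a c b).1 *ᵥ (X.A a b v + X.df a c b v)

/-- The tangent space `T_b B × ℝ²` of `U a × ℝ²` at a point over `b`. -/
abbrev TotalTangent (B : Type*) [TopologicalSpace B] [ChartedSpace E2 B] (b : B) :=
  TangentSpace 𝓘(ℝ, E2) b × (Fin 2 → ℝ)

/-- The metric `G_{IJ} (dx^I + A^I) (dx^J + A^J) + g` on `U a × ℝ²`; it does not depend on the
fibre coordinates. -/
def totalForm (X : TorusGroupoid ι B) (a : ι) (b : B) (u u' : TotalTangent B b) : ℝ :=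
  X.g b u.1 u'.1 + (u.2 + X.A a b u.1) ⬝ᵥ (X.G a b *ᵥ (u'.2 + X.A a b u'.1))

/-- The coordinate vectors on `B × ℝ²` of the chart `φ` and the linear fibre coordinates. -/
def totalVec (φ : OpenPartialHomeomorph B E2) (y : E2) :
    Fin 2 ⊕ Fin 2 → TotalTangent B (φ.symm y)
  | Sum.inl α => (coordVec φ y α, 0)
  | Sum.inr I => (0, Pi.single I 1)

/-- The coordinates `(y, x)` of points of `U a × ℝ²`, using the chart `φ`. -/
def totalDom (X : TorusGroupoid ι B) (a : ι) (φ : OpenPartialHomeomorph B E2) :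
    Set (E2 × (Fin 2 → ℝ)) :=
  {q | q.1 ∈ X.baseDom a φ}

/-- The components of the metric of the unit space, in the coordinates `(y, x)`. -/
def totalMetric (X : TorusGroupoid ι B) (a : ι) (φ : OpenPartialHomeomorph B E2)
    (q : E2 × (Fin 2 → ℝ)) : Matrix (Fin 2 ⊕ Fin 2) (Fin 2 ⊕ Fin 2) ℝ :=
  Matrix.of fun i j => X.totalForm a (φ.symm q.1) (totalVec φ q.1 i) (totalVec φ q.1 j)

/-- The four dimensional metric on the unit space is Ricci-flat. -/
def IsRicciFlat (X : TorusGroupoid ι B) : Prop :=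
  ∀ a, ∀ φ ∈ atlas E2 B, ∀ q ∈ X.totalDom a φ, ∀ i j,
    ricci totalBasis (X.totalMetric a φ) i j q = 0

/-- Fields of endomorphisms of the tangent spaces of `B × ℝ²` that are invariant under the
translations of `ℝ²`. -/
abbrev TotalEndo (B : Type*) [TopologicalSpace B] [ChartedSpace E2 B] :=
  ∀ b : B, TotalTangent B b →L[ℝ] TotalTangent B b

/-- The components of an endomorphism field in the coordinates `(y, x)`. -/
def totalEndoComp (J : TotalEndo B) (φ : OpenPartialHomeomorph B E2)
    (q : E2 × (Fin 2 → ℝ)) : Matrix (Fin 2 ⊕ Fin 2) (Fin 2 ⊕ Fin 2) ℝ :=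
  Matrix.of fun i j =>
    let u := J (φ.symm q.1) (totalVec φ q.1 j)
    Sum.elim (vecComp φ (φ.symm q.1) u.1) u.2 i

/-- The components `ω(∂ᵢ, ∂ⱼ)` of the fundamental form `ω(u, u') = ⟨J u, u'⟩`. -/
def kahlerForm (X : TorusGroupoid ι B) (a : ι) (J : TotalEndo B)
    (φ : OpenPartialHomeomorph B E2) (q : E2 × (Fin 2 → ℝ)) :
    Matrix (Fin 2 ⊕ Fin 2) (Fin 2 ⊕ Fin 2) ℝ :=
  Matrix.of fun i j =>
    X.totalForm a (φ.symm q.1) (J (φ.symm q.1) (totalVec φ q.1 i)) (totalVec φ q.1 j)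

/-- The metric of the unit space, on `U a × ℝ²`, is semiflat Kähler, with complex structure `J`
upstairs and complex structure `j` on the base: `J` is an integrable orthogonal complex structure
with closed fundamental form, the projection to the base is holomorphic (so that the fibres are
complex curves), and the metrics induced on the fibres are flat. (The structure `J` is moreover
invariant under the translations of `ℝ²`, by its type.) -/
structure IsSemiflatKahler (X : TorusGroupoid ι B) (a : ι) (j : TangentEndo B)
    (J : TotalEndo B) : Prop where
  base : IsRotationField X.g (X.U a) j
  smooth : ∀ φ ∈ atlas E2 B, ∀ k l,
    ContDiffOn ℝ ∞ (fun q => totalEndoComp J φ q k l) (X.totalDom a φ)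
  sq : ∀ b ∈ X.U a, ∀ u, J b (J b u) = -u
  orth : ∀ b ∈ X.U a, ∀ u u', X.totalForm a b (J b u) (J b u') = X.totalForm a b u u'
  integrable : ∀ φ ∈ atlas E2 B, ∀ q ∈ X.totalDom a φ, ∀ l k m,
    nijenhuis totalBasis (totalEndoComp J φ) l k m q = 0
  closed : ∀ φ ∈ atlas E2 B, ∀ q ∈ X.totalDom a φ, ∀ k l m,
    extDeriv2 totalBasis (X.kahlerForm a J φ) k l m q = 0
  proj : ∀ b ∈ X.U a, ∀ u, (J b u).1 = j b u.1
  fibre_flat : ∀ b ∈ X.U a, ∀ x k l m n,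
    riemann (fun I : Fin 2 => (Pi.single I 1 : Fin 2 → ℝ))
      (fun _ => Matrix.of fun I K => X.totalForm a b (0, Pi.single I 1) (0, Pi.single K 1))
      k l m n x = 0

/-- The differential `(v, ξ) ↦ (v, γ (ξ - df v))` of the transition map from `U a × ℝ²` to
`U c × ℝ²`. -/
def transition (X : TorusGroupoid ι B) (a c : ι) (b : B) (u : TotalTangent B b) :
    TotalTangent B b :=
  (u.1, (X.γ a c b).1 *ᵥ (u.2 - X.df a c b u.1))

/-- The endomorphism fields `J a` on the pieces `U a × ℝ²` are invariant under the transition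
maps. -/
def IsInvariant (X : TorusGroupoid ι B) (J : ι → TotalEndo B) : Prop :=
  ∀ a c, ∀ b ∈ X.U a ∩ X.U c, ∀ u,
    J c b (X.transition a c b u) = X.transition a c b (J a b u)

/-! ### The universal cover -/

variable {C : Type*} [TopologicalSpace C] [ChartedSpace E2 C]

/-- The pullback of the groupoid along a local diffeomorphism `p`. -/
def pullback (X : TorusGroupoid ι B) (p : C → B) : TorusGroupoid ι C where
  U a := p ⁻¹' X.U a
  cover x := X.cover (p x)
  γ a c x := X.γ a c (p x)
  f a c x := X.f a c (p x)
  G a x := X.G a (p x)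
  posDef a x hx := X.posDef a (p x) hx
  A a x := (X.A a (p x)).comp (mfderiv 𝓘(ℝ, E2) 𝓘(ℝ, E2) p x)
  g x := (show E2 →L[ℝ] E2 →L[ℝ] ℝ from X.g (p x)).bilinearComp
    (show E2 →L[ℝ] E2 from mfderiv 𝓘(ℝ, E2) 𝓘(ℝ, E2) p x)
    (show E2 →L[ℝ] E2 from mfderiv 𝓘(ℝ, E2) 𝓘(ℝ, E2) p x)

/-- `h` is a global flat frame of the flat `ℝ²`-bundle with transition functions `γ`, expressed
in the local trivializations over the sets `U a`. -/
structure IsFlatFrame (X : TorusGroupoid ι B) (h : ι → B → GL (Fin 2) ℝ) : Prop where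
  locConst : ∀ a, ∀ b ∈ X.U a, ∀ᶠ b' in 𝓝 b, h a b' = h a b
  compat : ∀ a c, ∀ b ∈ X.U a ∩ X.U c, h c b = X.γ a c b * h a b

/-- The matrix of the fibre metric in the frame `h`. (It can be computed in any `U a` that
contains the point.) -/
def frameMetric (X : TorusGroupoid ι B) (h : ι → B → GL (Fin 2) ℝ) (b : B) :
    Matrix (Fin 2) (Fin 2) ℝ :=
  (h (X.cover b).choose b).1ᵀ * X.G (X.cover b).choose b * (h (X.cover b).choose b).1

theorem frameMetric_posDef (X : TorusGroupoid ι B) (h : ι → B → GL (Fin 2) ℝ) (b : B) :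
    (X.frameMetric h b).PosDef := by
  have := (X.posDef _ b (X.cover b).choose_spec).conjTranspose_mul_mul_same
    (B := (h (X.cover b).choose b).1)
    (Matrix.mulVec_injective_of_isUnit (h (X.cover b).choose b).isUnit)
  simpa [frameMetric] using this

/-- The map to the hyperbolic plane given by the fibre metrics in the frame `h`. -/
def frameMap (X : TorusGroupoid ι B) (h : ι → B → GL (Fin 2) ℝ) (b : B) : ℍ :=
  toHyperbolic (X.frameMetric h b) (X.frameMetric_posDef h b)

end TorusGroupoid

/-- The group of deck transformations of `p`. -/
def deckGroup {C B : Type*} [TopologicalSpace C] (p : C → B) : Subgroup (C ≃ₜ C) where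
  carrier := {σ | ∀ x, p (σ x) = p x}
  mul_mem' := fun {σ σ'} hs hs' x => (hs (σ' x)).trans (hs' x)
  one_mem' := fun _ => rfl
  inv_mem' := fun {σ} hs x => by
    have := hs (σ⁻¹ x)
    rw [← this]
    exact congrArg p (σ.apply_symm_apply x)

end

/-! All Ricci components of $G_{IJ}(dx^I+A^I)(dx^J+A^J)+g_B$ are functions on the base. In bases
orthonormal at a point, the trace of the fibre components says $\triangle\sqrt{\det
G}=\frac12\sum_I(F^I_{01})^2$. Hence $\sqrt{\det G}$ is a positive bounded subharmonic function;
parabolicity makes it constant, and the same identity then forces $F=0$ (`laplacian_sqrt_det`,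
`exists_det_eq`, `curvature_eq_zero`).

Put $\tau=x+is$ with $x=G_{01}/G_{00}$ and $s=\sqrt{\det G}/G_{00}$. The Ricci tensor of a surface
is a multiple of $g_B$, so the base components say that the trace-free part of
$\mathrm{tr}(G^{-1}\partial_\alpha G\,G^{-1}\partial_\beta G)$ vanishes: $\tau$ is weakly conformal,
and at each point $ds=\mp dx\circ j$ for one of the signs. The remaining fibre components form the
harmonic map equation into $H^2$. Conformality cancels its quadratic terms, so that $x$ and $s$ are
harmonic functions (`harmonic_conformal`).

The sign could still change at zeros of $d\tau$. The defects $ds\pm dx\circ j$ are closed and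
coclosed 1-forms, so each solves a first order elliptic system with weak unique continuation
(`crDefect_eq_zero_of_eq_zero`). If one defect is nonzero at a point, the other vanishes nearby,
hence on the whole connected surface (`exists_holomorphic_orientation`). The unique continuation is
elementary: the square $L$ of the norm of a suitable pair of components satisfies $T\log L=\kappa$
where $L>0$, for a real elliptic operator $T$; the functions $\log(L+\varepsilon)$ are compared with
a Gaussian barrier on an annulus, which enlarges any disc of zeros (`eq_zero_of_eq_zero_on_ball`).

Orientations and flat frames both come from the triviality of locally constant cocycles on simply
connected spaces (`exists_locally_constant_trivialization`). Finally $J$ is $j$ on horizontal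
vectors and a right-angle rotation on the fibres. Flatness of the connection and holomorphy of
$\tau$ make it integrable; the fundamental form is the area form of the base plus the fibre area
form, which has constant coefficients in $dx+A$ because $\det G$ is constant, and so it is closed
(`IsFlatData.isSemiflatKahler`). -/

namespace CoordGeom

/-! ### Calculus of partial derivatives. -/

section Calculus

variable {k : Type*} {V : Type*} [NormedAddCommGroup V] [NormedSpace ℝ V]
  {e : k → V} {f f' : V → ℝ} {q : V}

theorem pd_congr (i : k) (h : f =ᶠ[𝓝 q] f') : pd e i f q = pd e i f' q := by
  simp only [pd, h.fderiv_eq]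

theorem pd_eventuallyEq (i : k) (h : f =ᶠ[𝓝 q] f') : pd e i f =ᶠ[𝓝 q] pd e i f' :=
  h.eventuallyEq_nhds.mono fun _ hr => pd_congr i hr

@[simp] theorem pd_const (i : k) (c : ℝ) : pd e i (fun _ => c) q = 0 := by simp [pd]

theorem pd_add (i : k) (hf : DifferentiableAt ℝ f q) (hf' : DifferentiableAt ℝ f' q) :
    pd e i (fun r => f r + f' r) q = pd e i f q + pd e i f' q := by
  simp only [pd]
  rw [fderiv_fun_add hf hf']; rfl

theorem pd_sub (i : k) (hf : DifferentiableAt ℝ f q) (hf' : DifferentiableAt ℝ f' q) :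
    pd e i (fun r => f r - f' r) q = pd e i f q - pd e i f' q := by
  simp only [pd]
  rw [fderiv_fun_sub hf hf']; rfl

theorem pd_neg (i : k) : pd e i (fun r => -f r) q = -pd e i f q := by
  simp only [pd]
  rw [fderiv_fun_neg]; rfl

theorem pd_mul (i : k) (hf : DifferentiableAt ℝ f q) (hf' : DifferentiableAt ℝ f' q) :
    pd e i (fun r => f r * f' r) q = pd e i f q * f' q + f q * pd e i f' q := by
  simp only [pd]
  rw [fderiv_fun_mul hf hf']
  simp only [_root_.add_apply, _root_.smul_apply, smul_eq_mul]
  ring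

theorem pd_const_mul (i : k) (c : ℝ) (hf : DifferentiableAt ℝ f q) :
    pd e i (fun r => c * f r) q = c * pd e i f q := by
  simp [pd_mul i (differentiableAt_const c) hf]

theorem pd_sum {κ : Type*} (i : k) (s : Finset κ) {F : κ → V → ℝ}
    (hF : ∀ a ∈ s, DifferentiableAt ℝ (F a) q) :
    pd e i (fun r => ∑ a ∈ s, F a r) q = ∑ a ∈ s, pd e i (F a) q := by
  simp only [pd]
  rw [fderiv_fun_sum hF]; simp

theorem pd_comp (i : k) {h : ℝ → ℝ} (hh : DifferentiableAt ℝ h (f q))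
    (hf : DifferentiableAt ℝ f q) :
    pd e i (fun r => h (f r)) q = deriv h (f q) * pd e i f q := by
  simp only [pd]
  have := (hh.hasDerivAt.comp_hasFDerivAt q hf.hasFDerivAt).fderiv
  simp only [Function.comp_def] at this
  rw [this]; simp

theorem pd_inv (i : k) (hf : DifferentiableAt ℝ f q) (h0 : f q ≠ 0) :
    pd e i (fun r => (f r)⁻¹) q = -pd e i f q / f q ^ 2 := by
  rw [pd_comp (h := fun t => t⁻¹) i (differentiableAt_inv h0) hf, deriv_inv]
  ring

theorem _root_.ContDiffAt.pd (i : k) (hf : ContDiffAt ℝ ∞ f q) : ContDiffAt ℝ ∞ (pd e i f) q := by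
  have := hf.fderiv_right (m := ∞) (by simp)
  exact this.clm_apply contDiffAt_const

theorem _root_.ContDiffAt.dAt (hf : ContDiffAt ℝ ∞ f q) : DifferentiableAt ℝ f q :=
  hf.differentiableAt (by simp)

theorem pd_comm (i j : k) (hf : ContDiffAt ℝ ∞ f q) :
    pd e i (pd e j f) q = pd e j (pd e i f) q := by
  have h1 : DifferentiableAt ℝ (fderiv ℝ f) q :=
    (hf.fderiv_right (m := ∞) (by simp)).differentiableAt (by simp)
  have h2 := (hf.isSymmSndFDerivAt (by rw [minSmoothness_of_isRCLikeNormedField]; exact WithTop.coe_le_coe.2 le_top)).eq (e i) (e j)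
  have key : ∀ a b : k, CoordGeom.pd e a (CoordGeom.pd e b f) q
      = fderiv ℝ (fderiv ℝ f) q (e a) (e b) := by
    intro a b
    have : CoordGeom.pd e b f = fun r => fderiv ℝ f r (e b) := rfl
    rw [this]
    simp only [CoordGeom.pd]
    rw [fderiv_clm_apply h1 (differentiableAt_const _)]
    simp
  rw [key, key, h2]

end Calculus

/-! ### Curvature and Laplacian under a constant change of basis. -/

section Change

variable {k : Type*} [Fintype k] [DecidableEq k] {V : Type*} [NormedAddCommGroup V]
  [NormedSpace ℝ V] {e e' : k → V} {g : V → Matrix k k ℝ} {P : Matrix k k ℝ} {q : V}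

theorem contDiffAt_det (hg : ∀ i j, ContDiffAt ℝ ∞ (fun r => g r i j) q) :
    ContDiffAt ℝ ∞ (fun r => (g r).det) q := by
  simp only [Matrix.det_apply']
  refine ContDiffAt.sum fun σ _ => ?_
  refine contDiffAt_const.mul ?_
  exact contDiffAt_prod fun i _ => hg _ _

theorem contDiffAt_inv (hg : ∀ i j, ContDiffAt ℝ ∞ (fun r => g r i j) q) (h0 : (g q).det ≠ 0)
    (i j : k) : ContDiffAt ℝ ∞ (fun r => (g r)⁻¹ i j) q := by
  simp only [Matrix.inv_def, Ring.inverse_eq_inv', Matrix.smul_apply, smul_eq_mul,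
    Matrix.adjugate_apply]
  refine ((contDiffAt_det hg).inv h0).mul ?_
  refine contDiffAt_det fun a b => ?_
  simp only [Matrix.updateRow_apply]
  split_ifs
  · exact contDiffAt_const
  · exact hg _ _

theorem contDiffAt_christoffel (hg : ∀ i j, ContDiffAt ℝ ∞ (fun r => g r i j) q)
    (h0 : (g q).det ≠ 0) (l i j : k) : ContDiffAt ℝ ∞ (christoffel e g l i j) q := by
  unfold christoffel
  refine contDiffAt_const.mul (ContDiffAt.sum fun m _ => ?_)
  exact (contDiffAt_inv hg h0 _ _).mul ((((hg _ _).pd _).add ((hg _ _).pd _)).sub ((hg _ _).pd _))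

omit [DecidableEq k] in
theorem pd_change (he : ∀ i, e' i = ∑ a, P a i • e a) (i : k) (f : V → ℝ) :
    pd e' i f q = ∑ a, P a i * pd e a f q := by
  simp [pd, he, map_sum]

/-- The matrix `Γˡᵢₘ` of the connection form in the direction `eᵢ`. -/
noncomputable def conn (e : k → V) (g : V → Matrix k k ℝ) (i : k) (q : V) : Matrix k k ℝ :=
  Matrix.of fun l m => christoffel e g l i m q

/-- The matrix `Rˡₛᵢⱼ` of the curvature form in the directions `eᵢ`, `eⱼ`. -/
noncomputable def curv (e : k → V) (g : V → Matrix k k ℝ) (i j : k) (q : V) : Matrix k k ℝ :=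
  Matrix.of fun l s => riemann e g l s i j q

omit [DecidableEq k] in
theorem pd_congruence (he : ∀ i, e' i = ∑ a, P a i • e a)
    (hg : ∀ i j, DifferentiableAt ℝ (fun r => g r i j) q) (i m j : k) :
    pd e' i (fun r => (Pᵀ * g r * P) m j) q =
      ∑ a, ∑ b, ∑ c, P a m * (P b i * P c j * pd e b (fun r => g r a c) q) := by
  have h : (fun r => (Pᵀ * g r * P) m j) = fun r => ∑ a, ∑ c, (P a m * P c j) * g r a c := by
    ext r
    simp only [Matrix.mul_apply, Matrix.transpose_apply, Finset.sum_mul]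
    rw [Finset.sum_comm]
    refine Finset.sum_congr rfl fun a _ => Finset.sum_congr rfl fun c _ => by ring
  rw [h, pd_sum]
  · refine Finset.sum_congr rfl fun a _ => ?_
    rw [pd_sum]
    · rw [Finset.sum_comm]
      refine Finset.sum_congr rfl fun c _ => ?_
      rw [pd_const_mul _ _ (hg a c), pd_change he, Finset.mul_sum]
      exact Finset.sum_congr rfl fun b _ => by ring
    · exact fun c _ => (hg a c).const_mul _
  · exact fun a _ => DifferentiableAt.fun_sum fun c _ => (hg a c).const_mul _

/-- Since `P` is constant there is no inhomogeneous term and the Christoffel symbols transform as a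
tensor. Constant changes suffice, because metrics only have to be normalized at a single point. -/
theorem conn_change (he : ∀ i, e' i = ∑ a, P a i • e a) (hP : IsUnit P.det)
    (hg : ∀ i j, DifferentiableAt ℝ (fun r => g r i j) q) (i : k) :
    conn e' (fun r => Pᵀ * g r * P) i q = ∑ a, P a i • (P⁻¹ * conn e g a q * P) := by
  ext l j
  let low : k → k → k → ℝ := fun a b c =>
    pd e b (fun r => g r a c) q + pd e c (fun r => g r b a) q - pd e a (fun r => g r b c) q
  let w : k → ℝ := fun a => ∑ b, ∑ c, P b i * P c j * low a b c
  -- The lowered symbols are trilinear in `P`; `e2` and `e3` only rename summation indices so that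
  -- the three derivative terms can be read off from one triple sum.
  have h1 : (fun m => pd e' i (fun r => (Pᵀ * g r * P) m j) q
      + pd e' j (fun r => (Pᵀ * g r * P) i m) q - pd e' m (fun r => (Pᵀ * g r * P) i j) q)
      = Pᵀ *ᵥ w := by
    ext m
    rw [pd_congruence he hg, pd_congruence he hg, pd_congruence he hg]
    have e2 : ∑ a, ∑ b, ∑ c, P a i * (P b j * P c m * pd e b (fun r => g r a c) q)
        = ∑ a, ∑ b, ∑ c, P a m * (P b i * P c j * pd e c (fun r => g r b a) q) := by
      calc _ = ∑ a, ∑ c, ∑ b, P a i * (P b j * P c m * pd e b (fun r => g r a c) q) :=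
            Finset.sum_congr rfl fun a _ => Finset.sum_comm
        _ = ∑ c, ∑ a, ∑ b, P a i * (P b j * P c m * pd e b (fun r => g r a c) q) :=
            Finset.sum_comm
        _ = _ := by
          refine Finset.sum_congr rfl fun a _ => Finset.sum_congr rfl fun b _ =>
            Finset.sum_congr rfl fun c _ => by ring
    have e3 : ∑ a, ∑ b, ∑ c, P a i * (P b m * P c j * pd e b (fun r => g r a c) q)
        = ∑ a, ∑ b, ∑ c, P a m * (P b i * P c j * pd e a (fun r => g r b c) q) := by
      rw [Finset.sum_comm]
      refine Finset.sum_congr rfl fun a _ => Finset.sum_congr rfl fun b _ =>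
            Finset.sum_congr rfl fun c _ => by ring
    rw [e2, e3]
    simp only [Matrix.mulVec, dotProduct, Matrix.transpose_apply, w, low, Finset.mul_sum,
      ← Finset.sum_add_distrib, ← Finset.sum_sub_distrib]
    refine Finset.sum_congr rfl fun a _ => Finset.sum_congr rfl fun b _ =>
            Finset.sum_congr rfl fun c _ => by ring
  have h2 : (conn e' (fun r => Pᵀ * g r * P) i q) l j = (1 / 2) * (P⁻¹ *ᵥ ((g q)⁻¹ *ᵥ w)) l := by
    have : (conn e' (fun r => Pᵀ * g r * P) i q) l j
        = (1 / 2) * ((Pᵀ * g q * P)⁻¹ *ᵥ (Pᵀ *ᵥ w)) l := by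
      rw [← h1]; rfl
    rw [this, Matrix.mul_inv_rev, Matrix.mul_inv_rev, Matrix.mulVec_mulVec, Matrix.mulVec_mulVec,
      Matrix.mul_assoc, Matrix.mul_assoc,
      Matrix.nonsing_inv_mul Pᵀ (by rwa [Matrix.det_transpose]), Matrix.mul_one]
  rw [h2]
  have h3 : ∀ n, ((g q)⁻¹ *ᵥ w) n = 2 * ∑ b, ∑ c, P b i * (christoffel e g n b c q * P c j) := by
    intro n
    simp only [Matrix.mulVec, dotProduct, w, christoffel, Finset.mul_sum, Finset.sum_mul]
    rw [Finset.sum_comm]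
    refine Finset.sum_congr rfl fun b _ => ?_
    rw [Finset.sum_comm]
    refine Finset.sum_congr rfl fun c _ => Finset.sum_congr rfl fun a _ => ?_
    simp only [low]; ring
  simp only [Matrix.mulVec, dotProduct] at h3 ⊢
  simp only [h3, Matrix.sum_apply, Matrix.smul_apply, smul_eq_mul, Matrix.mul_assoc]
  simp only [Matrix.mul_apply, conn, Matrix.of_apply, Finset.mul_sum]
  rw [Finset.sum_comm]
  refine Finset.sum_congr rfl fun b _ => Finset.sum_congr rfl fun c _ =>
    Finset.sum_congr rfl fun a _ => by ring

theorem curv_eq (i j : k) (q : V) : curv e g i j q =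
    (Matrix.of fun l s => pd e i (fun r => conn e g j r l s) q)
      - (Matrix.of fun l s => pd e j (fun r => conn e g i r l s) q)
      + conn e g i q * conn e g j q - conn e g j q * conn e g i q := by
  ext l s
  simp only [curv, riemann, Matrix.of_apply, Matrix.add_apply, Matrix.sub_apply, Matrix.mul_apply,
    conn, Finset.sum_sub_distrib]
  ring_nf

theorem pd_conn_change (he : ∀ i, e' i = ∑ a, P a i • e a) (hP : IsUnit P.det)
    (hg : ∀ i j, ContDiffAt ℝ ∞ (fun r => g r i j) q) (h0 : (g q).det ≠ 0) (i j : k) :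
    (Matrix.of fun l s => pd e' i (fun r => conn e' (fun r => Pᵀ * g r * P) j r l s) q) =
      ∑ a, ∑ b, (P a i * P b j) •
        (P⁻¹ * (Matrix.of fun l s => pd e a (fun r => conn e g b r l s) q) * P) := by
  have hev : ∀ᶠ r in 𝓝 q, ∀ i j, DifferentiableAt ℝ (fun r => g r i j) r := by
    simp only [Filter.eventually_all]
    exact fun i j => (((hg i j).of_le (m := 1) (mod_cast le_top)).eventually (by simp)).mono fun r hr =>
      hr.differentiableAt (by simp)
  have hcd : ∀ b x y, DifferentiableAt ℝ (fun r => conn e g b r x y) q := fun b x y =>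
    (contDiffAt_christoffel hg h0 x b y).dAt
  ext l s
  simp only [Matrix.of_apply]
  -- The transformation rule is about to be differentiated, so it is needed near `q` and not only at
  -- `q`.
  have h1 : (fun r => conn e' (fun r => Pᵀ * g r * P) j r l s) =ᶠ[𝓝 q]
      fun r => ∑ b, ∑ x, ∑ y, (P b j * P⁻¹ l x * P y s) * conn e g b r x y := by
    filter_upwards [hev] with r hr
    rw [conn_change he hP hr]
    simp only [Matrix.sum_apply, Matrix.smul_apply, smul_eq_mul, Matrix.mul_assoc]
    simp only [Matrix.mul_apply, Finset.mul_sum]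
    refine Finset.sum_congr rfl fun b _ => Finset.sum_congr rfl fun c _ =>
      Finset.sum_congr rfl fun a _ => by ring
  rw [pd_congr i h1, pd_change he]
  simp only [Matrix.sum_apply, Matrix.smul_apply, smul_eq_mul, Matrix.mul_assoc]
  simp only [Matrix.mul_apply, Finset.mul_sum, Matrix.of_apply]
  refine Finset.sum_congr rfl fun a _ => ?_
  have hd : ∀ b x y, DifferentiableAt ℝ
      (fun r => (P b j * P⁻¹ l x * P y s) * conn e g b r x y) q :=
    fun b x y => (hcd b x y).const_mul _
  rw [pd_sum _ _ fun b _ => DifferentiableAt.fun_sum fun x _ => DifferentiableAt.fun_sum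
    fun y _ => hd b x y, Finset.mul_sum]
  refine Finset.sum_congr rfl fun b _ => ?_
  rw [pd_sum _ _ fun x _ => DifferentiableAt.fun_sum fun y _ => hd b x y, Finset.mul_sum]
  refine Finset.sum_congr rfl fun x _ => ?_
  rw [pd_sum _ _ fun y _ => hd b x y, Finset.mul_sum]
  refine Finset.sum_congr rfl fun y _ => ?_
  rw [pd_const_mul _ _ (hcd b x y)]
  ring

theorem curv_change (he : ∀ i, e' i = ∑ a, P a i • e a) (hP : IsUnit P.det)
    (hg : ∀ i j, ContDiffAt ℝ ∞ (fun r => g r i j) q) (h0 : (g q).det ≠ 0) (i j : k) :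
    curv e' (fun r => Pᵀ * g r * P) i j q =
      ∑ a, ∑ b, (P a i * P b j) • (P⁻¹ * curv e g a b q * P) := by
  have hprod : ∀ i j, conn e' (fun r => Pᵀ * g r * P) i q * conn e' (fun r => Pᵀ * g r * P) j q =
      ∑ a, ∑ b, (P a i * P b j) • (P⁻¹ * (conn e g a q * conn e g b q) * P) := by
    intro i j
    rw [conn_change he hP (fun i j => (hg i j).dAt), conn_change he hP (fun i j => (hg i j).dAt),
      Finset.sum_mul]
    refine Finset.sum_congr rfl fun a _ => ?_
    rw [Finset.mul_sum]
    refine Finset.sum_congr rfl fun b _ => ?_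
    rw [smul_mul_smul_comm]
    congr 1
    simp only [Matrix.mul_assoc]
    rw [← Matrix.mul_assoc P, Matrix.mul_nonsing_inv P hP, Matrix.one_mul]
  rw [curv_eq, pd_conn_change he hP hg h0, pd_conn_change he hP hg h0, hprod, hprod]
  rw [Finset.sum_comm (f := fun a b => (P a j * P b i) •
      (P⁻¹ * (Matrix.of fun l s => pd e a (fun r => conn e g b r l s) q) * P)),
    Finset.sum_comm (f := fun a b => (P a j * P b i) • (P⁻¹ * (conn e g a q * conn e g b q) * P))]
  simp only [← Finset.sum_sub_distrib, ← Finset.sum_add_distrib]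
  refine Finset.sum_congr rfl fun a _ => Finset.sum_congr rfl fun b _ => ?_
  rw [curv_eq, mul_comm (P b j), Matrix.mul_sub, Matrix.mul_add, Matrix.mul_sub, Matrix.sub_mul,
    Matrix.add_mul, Matrix.sub_mul, smul_sub, smul_add, smul_sub]

/-- The upper index carries `P⁻¹` and the lower index contracted with it carries `P`; these cancel
and leave two factors of `P`. -/
theorem ricci_change (he : ∀ i, e' i = ∑ a, P a i • e a) (hP : IsUnit P.det)
    (hg : ∀ i j, ContDiffAt ℝ ∞ (fun r => g r i j) q) (h0 : (g q).det ≠ 0) (s j : k) :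
    ricci e' (fun r => Pᵀ * g r * P) s j q = ∑ b, ∑ c, P b j * P c s * ricci e g c b q := by
  have h1 : ricci e' (fun r => Pᵀ * g r * P) s j q
      = ∑ i, curv e' (fun r => Pᵀ * g r * P) i j q i s := rfl
  have h2 : ∀ c b, ricci e g c b q = ∑ a, curv e g a b q a c := fun _ _ => rfl
  rw [h1]
  simp only [curv_change he hP hg h0, Matrix.sum_apply, Matrix.smul_apply, smul_eq_mul]
  have h3 : ∀ a b, ∑ i, P a i * (P⁻¹ * curv e g a b q * P) i s = (curv e g a b q * P) a s := by
    intro a b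
    rw [← Matrix.mul_apply, Matrix.mul_assoc, ← Matrix.mul_assoc P, Matrix.mul_nonsing_inv P hP,
      Matrix.one_mul]
  calc ∑ i, ∑ a, ∑ b, P a i * P b j * (P⁻¹ * curv e g a b q * P) i s
      = ∑ b, ∑ a, ∑ i, P a i * P b j * (P⁻¹ * curv e g a b q * P) i s := by
        rw [Finset.sum_comm]
        refine (Finset.sum_congr rfl fun a _ => Finset.sum_comm).trans ?_
        exact Finset.sum_comm
    _ = ∑ b, ∑ a, P b j * (curv e g a b q * P) a s := by
        refine Finset.sum_congr rfl fun b _ => Finset.sum_congr rfl fun a _ => ?_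
        rw [← h3, Finset.mul_sum]
        exact Finset.sum_congr rfl fun i _ => by ring
    _ = _ := by
        refine Finset.sum_congr rfl fun b _ => ?_
        simp only [h2, Matrix.mul_apply, Finset.mul_sum]
        rw [Finset.sum_comm]
        exact Finset.sum_congr rfl fun c _ => Finset.sum_congr rfl fun a _ => by ring

/-- The Hessian `H` transforms by the congruence `Pᵀ * H * P`, and its trace against the inverse
metric is unchanged by cyclicity. -/
theorem laplacian_change (he : ∀ i, e' i = ∑ a, P a i • e a) (hP : IsUnit P.det)
    (hg : ∀ i j, DifferentiableAt ℝ (fun r => g r i j) q) {f : V → ℝ}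
    (hf : ContDiffAt ℝ ∞ f q) :
    laplacian e' (fun r => Pᵀ * g r * P) f q = laplacian e g f q := by
  let H : Matrix k k ℝ := Matrix.of fun a b =>
    pd e a (pd e b f) q - ∑ l, christoffel e g l a b q * pd e l f q
  let H' : Matrix k k ℝ := Matrix.of fun a b =>
    pd e' a (pd e' b f) q - ∑ l, christoffel e' (fun r => Pᵀ * g r * P) l a b q * pd e' l f q
  have hH : H' = Pᵀ * H * P := by
    ext i j
    have h1 : pd e' i (pd e' j f) q = ∑ a, ∑ b, P a i * P b j * pd e a (pd e b f) q := by
      have : pd e' j f = fun r => ∑ b, P b j * pd e b f r := by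
        ext r; exact pd_change he j f
      rw [this, pd_change he]
      refine Finset.sum_congr rfl fun a _ => ?_
      rw [pd_sum _ _ fun b _ => ((hf.pd b).dAt).const_mul _, Finset.mul_sum]
      refine Finset.sum_congr rfl fun b _ => ?_
      rw [pd_const_mul _ _ (hf.pd b).dAt]; ring
    have h2 : ∑ l, christoffel e' (fun r => Pᵀ * g r * P) l i j q * pd e' l f q
        = ∑ a, ∑ b, P a i * P b j * ∑ l, christoffel e g l a b q * pd e l f q := by
      have h3 : ∀ l, christoffel e' (fun r => Pᵀ * g r * P) l i j q
          = ∑ a, P a i * (P⁻¹ * (conn e g a q * P)) l j := by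
        intro l
        have := congrFun (congrFun (conn_change he hP hg i) l) j
        simp only [Matrix.sum_apply, Matrix.smul_apply, smul_eq_mul, Matrix.mul_assoc P⁻¹] at this
        exact this
      have h4 : ∀ l, pd e' l f q = (Pᵀ *ᵥ fun a => pd e a f q) l := fun l => pd_change he l f
      simp only [h3, h4, Finset.sum_mul]
      rw [Finset.sum_comm]
      refine Finset.sum_congr rfl fun a _ => ?_
      have h5 : ∑ l, P a i * (P⁻¹ * (conn e g a q * P)) l j * (Pᵀ *ᵥ fun a => pd e a f q) l
          = P a i * ((P⁻¹ * (conn e g a q * P))ᵀ *ᵥ (Pᵀ *ᵥ fun a => pd e a f q)) j := by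
        simp only [Matrix.mulVec, dotProduct, Finset.mul_sum, Matrix.transpose_apply]
        exact Finset.sum_congr rfl fun l _ => Finset.sum_congr rfl fun x _ => by ring
      rw [h5, Matrix.mulVec_mulVec, ← Matrix.transpose_mul, ← Matrix.mul_assoc,
        Matrix.mul_nonsing_inv P hP, Matrix.one_mul]
      simp only [Matrix.mulVec, dotProduct, Matrix.transpose_apply, Matrix.mul_apply, conn,
        Matrix.of_apply, Finset.mul_sum, Finset.sum_mul]
      rw [Finset.sum_comm]
      exact Finset.sum_congr rfl fun b _ => Finset.sum_congr rfl fun l _ => by ring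
    simp only [H', Matrix.of_apply, h1, h2, Matrix.mul_assoc Pᵀ H]
    simp only [Matrix.mul_apply, Matrix.transpose_apply, H, Matrix.of_apply, Finset.mul_sum,
      ← Finset.sum_sub_distrib]
    refine Finset.sum_congr rfl fun a _ => Finset.sum_congr rfl fun b _ => ?_
    rw [← Finset.mul_sum]
    ring
  have htr : ∀ (h T : Matrix k k ℝ), ∑ i, ∑ j, h i j * T i j = (h * Tᵀ).trace := by
    intro h T; simp [Matrix.trace, Matrix.mul_apply]
  change ∑ i, ∑ j, (Pᵀ * g q * P)⁻¹ i j * H' i j = ∑ i, ∑ j, (g q)⁻¹ i j * H i j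
  rw [htr, htr, hH]
  simp only [Matrix.mul_inv_rev, Matrix.transpose_mul, Matrix.transpose_transpose]
  have hPT : (Pᵀ)⁻¹ * Pᵀ = 1 := Matrix.nonsing_inv_mul _ (by rwa [Matrix.det_transpose])
  calc _ = (P⁻¹ * ((g q)⁻¹ * ((Pᵀ)⁻¹ * Pᵀ) * Hᵀ * P)).trace := by simp only [Matrix.mul_assoc]
    _ = _ := by
      rw [hPT, Matrix.mul_one, Matrix.trace_mul_comm, Matrix.mul_assoc, Matrix.mul_nonsing_inv P hP,
        Matrix.mul_one]

end Change

end CoordGeom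

namespace CoordGeom

/-! ### Curvature at a point where the matrix of the metric is the identity. -/

section Normalized

variable {k : Type*} [Fintype k] [DecidableEq k] {V : Type*} [NormedAddCommGroup V]
  [NormedSpace ℝ V] {e : k → V} {g : V → Matrix k k ℝ} {q : V}

omit [Fintype k] [DecidableEq k] in
theorem pd_pd_mul {u v : V → ℝ} (i j : k) (hu : ContDiffAt ℝ ∞ u q) (hv : ContDiffAt ℝ ∞ v q) :
    pd e i (pd e j (fun r => u r * v r)) q =
      pd e i (pd e j u) q * v q + pd e j u q * pd e i v q + pd e i u q * pd e j v q
        + u q * pd e i (pd e j v) q := by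
  have h1 : ∀ {w : V → ℝ}, ContDiffAt ℝ ∞ w q → ∀ᶠ r in 𝓝 q, DifferentiableAt ℝ w r :=
    fun hw => ((hw.of_le (m := 1) (mod_cast le_top)).eventually (by simp)).mono fun r hr =>
      hr.differentiableAt (by simp)
  have h2 : pd e j (fun r => u r * v r) =ᶠ[𝓝 q] fun r => pd e j u r * v r + u r * pd e j v r := by
    filter_upwards [h1 hu, h1 hv] with r hr hr'
    exact pd_mul j hr hr'
  rw [pd_congr i h2, pd_add _ ((hu.pd j).dAt.fun_mul hv.dAt) (hu.dAt.fun_mul (hv.pd j).dAt),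
    pd_mul _ (hu.pd j).dAt hv.dAt, pd_mul _ hu.dAt (hv.pd j).dAt]
  ring

omit [Fintype k] [DecidableEq k] in
theorem pd_pd_sum {κ : Type*} (i j : k) (s : Finset κ) {F : κ → V → ℝ}
    (hF : ∀ a ∈ s, ContDiffAt ℝ ∞ (F a) q) :
    pd e i (pd e j (fun r => ∑ a ∈ s, F a r)) q = ∑ a ∈ s, pd e i (pd e j (F a)) q := by
  have h1 : ∀ {w : V → ℝ}, ContDiffAt ℝ ∞ w q → ∀ᶠ r in 𝓝 q, DifferentiableAt ℝ w r :=
    fun hw => ((hw.of_le (m := 1) (mod_cast le_top)).eventually (by simp)).mono fun r hr =>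
      hr.differentiableAt (by simp)
  have h2 : pd e j (fun r => ∑ a ∈ s, F a r) =ᶠ[𝓝 q] fun r => ∑ a ∈ s, pd e j (F a) r := by
    have : ∀ᶠ r in 𝓝 q, ∀ a ∈ s, DifferentiableAt ℝ (F a) r :=
      (Filter.eventually_all_finset s).2 fun a ha => h1 (hF a ha)
    filter_upwards [this] with r hr
    exact pd_sum j s hr
  rw [pd_congr i h2, pd_sum _ _ fun a ha => ((hF a ha).pd j).dAt]

/-- Twice the Christoffel symbols of the first kind. -/
noncomputable def christoffelLow (e : k → V) (g : V → Matrix k k ℝ) (m i j : k) (q : V) : ℝ :=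
  pd e i (fun r => g r m j) q + pd e j (fun r => g r i m) q - pd e m (fun r => g r i j) q

theorem christoffel_of_eq_one (h1 : g q = 1) (l i j : k) :
    christoffel e g l i j q = (1 / 2) * christoffelLow e g l i j q := by
  simp [christoffel, h1, christoffelLow, Matrix.one_apply]

/-- Differentiate `g * g⁻¹ = 1` at a point where both factors are the identity. -/
theorem pd_inv_of_eq_one (hg : ∀ i j, ContDiffAt ℝ ∞ (fun r => g r i j) q) (h1 : g q = 1)
    (a l m : k) : pd e a (fun r => (g r)⁻¹ l m) q = -pd e a (fun r => g r l m) q := by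
  have h0 : (g q).det ≠ 0 := by simp [h1]
  have hi := contDiffAt_inv hg h0
  have hev : (fun r => ∑ x, g r l x * (g r)⁻¹ x m) =ᶠ[𝓝 q]
      fun _ => (1 : Matrix k k ℝ) l m := by
    have := (contDiffAt_det hg).continuousAt.eventually_ne h0
    filter_upwards [this] with r hr
    rw [← Matrix.mul_apply, Matrix.mul_nonsing_inv _ (isUnit_iff_ne_zero.2 hr)]
  have h2 := pd_congr (e := e) a hev
  rw [pd_const, pd_sum _ _ fun x _ => (hg l x).dAt.fun_mul (hi x m).dAt] at h2
  simp only [fun x => pd_mul (e := e) a (hg l x).dAt (hi x m).dAt, h1, inv_one,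
    Finset.sum_add_distrib, Matrix.one_apply, mul_ite, mul_one, mul_zero, ite_mul, one_mul,
    zero_mul, Finset.sum_ite_eq, Finset.sum_ite_eq', Finset.mem_univ, if_true] at h2
  linarith

/-- The metric is normalized only to order zero. Its first derivatives at `q` survive, and the
derivative of the inverse metric produces the quadratic sum. -/
theorem pd_christoffel_of_eq_one (hg : ∀ i j, ContDiffAt ℝ ∞ (fun r => g r i j) q) (h1 : g q = 1)
    (a l i j : k) : pd e a (christoffel e g l i j) q =
      (1 / 2) * (pd e a (pd e i (fun r => g r l j)) q + pd e a (pd e j (fun r => g r i l)) q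
        - pd e a (pd e l (fun r => g r i j)) q
        - ∑ m, pd e a (fun r => g r l m) q * christoffelLow e g m i j q) := by
  have h0 : (g q).det ≠ 0 := by simp [h1]
  have hi := contDiffAt_inv hg h0
  have hl : ∀ m, ContDiffAt ℝ ∞ (christoffelLow e g m i j) q := fun m =>
    (((hg _ _).pd _).add ((hg _ _).pd _)).sub ((hg _ _).pd _)
  have e1 : christoffel e g l i j =
      fun r => (1 / 2) * ∑ m, (g r)⁻¹ l m * christoffelLow e g m i j r := rfl
  rw [e1, pd_const_mul _ _ (DifferentiableAt.fun_sum fun m _ => (hi l m).dAt.fun_mul (hl m).dAt),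
    pd_sum _ _ fun m _ => (hi l m).dAt.fun_mul (hl m).dAt]
  congr 1
  simp only [fun m => pd_mul (e := e) a (hi l m).dAt (hl m).dAt, pd_inv_of_eq_one hg h1, h1, inv_one,
    Finset.sum_add_distrib, Matrix.one_apply, ite_mul, one_mul,
    zero_mul, Finset.sum_ite_eq, Finset.mem_univ, if_true]
  have e2 : pd e a (christoffelLow e g l i j) q = pd e a (pd e i (fun r => g r l j)) q
      + pd e a (pd e j (fun r => g r i l)) q - pd e a (pd e l (fun r => g r i j)) q := by
    have : christoffelLow e g l i j = fun r => pd e i (fun r => g r l j) r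
      + pd e j (fun r => g r i l) r - pd e l (fun r => g r i j) r := rfl
    rw [this, pd_sub _ (((hg _ _).pd _).dAt.fun_add ((hg _ _).pd _).dAt) ((hg _ _).pd _).dAt,
      pd_add _ ((hg _ _).pd _).dAt ((hg _ _).pd _).dAt]
  rw [e2]
  simp only [neg_mul, Finset.sum_neg_distrib]
  ring

theorem ricci_of_eq_one (hg : ∀ i j, ContDiffAt ℝ ∞ (fun r => g r i j) q) (h1 : g q = 1)
    (s j : k) : ricci e g s j q =
      ∑ i, ((1 / 2) * (pd e i (pd e j (fun r => g r i s)) q + pd e i (pd e s (fun r => g r j i)) q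
        - pd e i (pd e i (fun r => g r j s)) q
        - ∑ m, pd e i (fun r => g r i m) q * christoffelLow e g m j s q)
      - (1 / 2) * (pd e j (pd e i (fun r => g r i s)) q + pd e j (pd e s (fun r => g r i i)) q
        - pd e j (pd e i (fun r => g r i s)) q
        - ∑ m, pd e j (fun r => g r i m) q * christoffelLow e g m i s q)
      + (1 / 4) * ∑ m, (christoffelLow e g i i m q * christoffelLow e g m j s q
        - christoffelLow e g i j m q * christoffelLow e g m i s q)) := by
  simp only [ricci, riemann, pd_christoffel_of_eq_one hg h1, christoffel_of_eq_one h1]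
  refine Finset.sum_congr rfl fun i _ => ?_
  congr 1
  rw [Finset.mul_sum]
  exact Finset.sum_congr rfl fun m _ => by ring

theorem laplacian_of_eq_one (h1 : g q = 1) (f : V → ℝ) : laplacian e g f q =
    ∑ i, (pd e i (pd e i f) q - (1 / 2) * ∑ l, christoffelLow e g l i i q * pd e l f q) := by
  simp only [laplacian, h1, inv_one, Matrix.one_apply, ite_mul, one_mul, zero_mul,
    Finset.sum_ite_eq, Finset.mem_univ, if_true, christoffel_of_eq_one h1, Finset.mul_sum, mul_assoc]

end Normalized

/-! ### The jets and the Ricci curvature of the total space metric. -/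

section Bundle

variable {e : Fin 2 → E2} {eT : Fin 2 ⊕ Fin 2 → E2 × (Fin 2 → ℝ)}
  {g G A : E2 → Matrix (Fin 2) (Fin 2) ℝ} {q : E2 × (Fin 2 → ℝ)}

/-- The components of `G_{IJ} (dx^I + A^I) (dx^J + A^J) + g`. -/
def bundleMetric (g G A : E2 → Matrix (Fin 2) (Fin 2) ℝ) (q : E2 × (Fin 2 → ℝ)) :
    Matrix (Fin 2 ⊕ Fin 2) (Fin 2 ⊕ Fin 2) ℝ :=
  Matrix.fromBlocks (g q.1 + (A q.1)ᵀ * G q.1 * A q.1) ((A q.1)ᵀ * G q.1) (G q.1 * A q.1) (G q.1)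

/-- Differentiability need not be assumed: restriction to a slice shows that the composite is
differentiable only if `f` is, and otherwise both derivatives take the default value zero. -/
theorem fderiv_comp_fst (f : E2 → ℝ) (v : E2 × (Fin 2 → ℝ)) :
    fderiv ℝ (fun r : E2 × (Fin 2 → ℝ) => f r.1) q v = fderiv ℝ f q.1 v.1 := by
  by_cases hf : DifferentiableAt ℝ f q.1
  · have := (hf.hasFDerivAt.comp q (hasFDerivAt_fst (𝕜 := ℝ) (p := q))).fderiv
    simp only [Function.comp_def] at this
    rw [this]; simp
  · have h2 : ¬ DifferentiableAt ℝ (fun r : E2 × (Fin 2 → ℝ) => f r.1) q := by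
      intro h
      apply hf
      have h3 : DifferentiableAt ℝ (fun y : E2 => (y, q.2)) q.1 :=
        differentiableAt_id.prodMk (differentiableAt_const _)
      exact DifferentiableAt.comp (g := fun r : E2 × (Fin 2 → ℝ) => f r.1) q.1 h h3
    rw [fderiv_zero_of_not_differentiableAt hf, fderiv_zero_of_not_differentiableAt h2]; simp

/-- Only the base components of the basis vectors enter. This allows the sheared bases that make the
connection vanish at a point. -/
theorem pd_base (he : ∀ α, (eT (Sum.inl α)).1 = e α) (α : Fin 2) (f : E2 → ℝ) :
    pd eT (Sum.inl α) (fun r => f r.1) = fun r => pd e α f r.1 := by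
  ext r; simp only [pd, fderiv_comp_fst, he]

theorem pd_fibre (he : ∀ I, (eT (Sum.inr I)).1 = 0) (I : Fin 2) (f : E2 → ℝ) :
    pd eT (Sum.inr I) (fun r => f r.1) = fun _ => 0 := by
  ext r; simp only [pd, fderiv_comp_fst, he, map_zero]

theorem contDiffAt_comp_fst {f : E2 → ℝ} (hf : ContDiffAt ℝ ∞ f q.1) :
    ContDiffAt ℝ ∞ (fun r : E2 × (Fin 2 → ℝ) => f r.1) q :=
  hf.comp q _root_.contDiffAt_fst

theorem contDiffAt_bundleMetric (hg : ∀ i j, ContDiffAt ℝ ∞ (fun r => g r i j) q.1)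
    (hG : ∀ i j, ContDiffAt ℝ ∞ (fun r => G r i j) q.1)
    (hA : ∀ i j, ContDiffAt ℝ ∞ (fun r => A r i j) q.1) (i j : Fin 2 ⊕ Fin 2) :
    ContDiffAt ℝ ∞ (fun r => bundleMetric g G A r i j) q := by
  rcases i with i | i <;> rcases j with j | j <;>
    simp only [bundleMetric, Matrix.fromBlocks_apply₁₁, Matrix.fromBlocks_apply₁₂,
      Matrix.fromBlocks_apply₂₁, Matrix.fromBlocks_apply₂₂, Matrix.add_apply, Matrix.mul_apply,
      Matrix.transpose_apply]
  · exact (contDiffAt_comp_fst (hg i j)).add (ContDiffAt.sum fun x _ => (ContDiffAt.sum fun y _ =>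
      (contDiffAt_comp_fst (hA _ _)).mul (contDiffAt_comp_fst (hG _ _))).mul (contDiffAt_comp_fst (hA _ _)))
  · exact ContDiffAt.sum fun y _ => (contDiffAt_comp_fst (hA _ _)).mul (contDiffAt_comp_fst (hG _ _))
  · exact ContDiffAt.sum fun y _ => (contDiffAt_comp_fst (hG _ _)).mul (contDiffAt_comp_fst (hA _ _))
  · exact contDiffAt_comp_fst (hG i j)

end Bundle

end CoordGeom

namespace CoordGeom

section BundleJets

variable {e : Fin 2 → E2} {eT : Fin 2 ⊕ Fin 2 → E2 × (Fin 2 → ℝ)}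
  {g G A : E2 → Matrix (Fin 2) (Fin 2) ℝ} {q : E2 × (Fin 2 → ℝ)}

open Sum

theorem bundleMetric_eq_comp (g G A : E2 → Matrix (Fin 2) (Fin 2) ℝ) (i j : Fin 2 ⊕ Fin 2) :
    (fun r => bundleMetric g G A r i j) =
      fun r => (fun y => bundleMetric g G A (y, 0) i j) r.1 := rfl

theorem pd_fibre_bundleMetric (he : ∀ I, (eT (inr I)).1 = 0) (I : Fin 2) (i j : Fin 2 ⊕ Fin 2) :
    pd eT (inr I) (fun r => bundleMetric g G A r i j) = fun _ => 0 := by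
  rw [bundleMetric_eq_comp]
  exact pd_fibre he I (fun y => bundleMetric g G A (y, 0) i j)

theorem pd_fibre_base_bundleMetric (he : ∀ I, (eT (inr I)).1 = 0)
    (he' : ∀ α, (eT (inl α)).1 = e α) (I : Fin 2) (α : Fin 2) (i j : Fin 2 ⊕ Fin 2) :
    pd eT (inr I) (pd eT (inl α) (fun r => bundleMetric g G A r i j)) q = 0 := by
  rw [bundleMetric_eq_comp, pd_base he' α (fun y => bundleMetric g G A (y, 0) i j)]
  exact congrFun (pd_fibre he I (pd e α (fun y => bundleMetric g G A (y, 0) i j))) q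

theorem pd_base_bundleMetric (he' : ∀ α, (eT (inl α)).1 = e α) (α : Fin 2) (i j : Fin 2 ⊕ Fin 2) :
    pd eT (inl α) (fun r => bundleMetric g G A r i j) q =
      pd e α (fun y => bundleMetric g G A (y, 0) i j) q.1 :=
  congrFun (pd_base he' α (fun y => bundleMetric g G A (y, 0) i j)) q

theorem pd_base_base_bundleMetric (he' : ∀ α, (eT (inl α)).1 = e α) (α β : Fin 2)
    (i j : Fin 2 ⊕ Fin 2) :
    pd eT (inl α) (pd eT (inl β) (fun r => bundleMetric g G A r i j)) q =
      pd e α (pd e β (fun y => bundleMetric g G A (y, 0) i j)) q.1 := by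
  rw [bundleMetric_eq_comp, pd_base he' β (fun y => bundleMetric g G A (y, 0) i j)]
  exact congrFun (pd_base he' α (pd e β fun y => bundleMetric g G A (y, 0) i j)) q

variable {y : E2} (hg : ∀ i j, ContDiffAt ℝ ∞ (fun r => g r i j) y)
    (hG : ∀ i j, ContDiffAt ℝ ∞ (fun r => G r i j) y)
    (hA : ∀ i j, ContDiffAt ℝ ∞ (fun r => A r i j) y) (hG1 : G y = 1) (hA0 : A y = 0)

include hg hG hA hG1 hA0

omit hG1 in
-- The correction `Aᵀ * G * A` vanishes to second order at `y`, so it has no influence on first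
-- derivatives.
theorem pd_bundleMetric_bb (γ α β : Fin 2) :
    pd e γ (fun y => bundleMetric g G A (y, 0) (inl α) (inl β)) y =
      pd e γ (fun r => g r α β) y := by
  have h1 : (fun y => bundleMetric g G A (y, 0) (inl α) (inl β)) =
      fun r => g r α β + ∑ K, (∑ J, A r J α * G r J K) * A r K β := by
    ext r; simp [bundleMetric, Matrix.mul_apply]
  have h2 : ∀ K, ContDiffAt ℝ ∞ (fun r => ∑ J, A r J α * G r J K) y := fun K =>
    ContDiffAt.sum fun J _ => (hA _ _).mul (hG _ _)
  rw [h1, pd_add _ (hg _ _).dAt (ContDiffAt.sum fun K _ => (h2 K).mul (hA _ _)).dAt,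
    pd_sum _ _ fun K _ => ((h2 K).mul (hA _ _)).dAt]
  have h3 : ∀ K, pd e γ (fun r => (∑ J, A r J α * G r J K) * A r K β) y = 0 := fun K => by
    rw [pd_mul (e := e) γ (h2 K).dAt (hA K β).dAt]; simp [hA0]
  simp only [h3, Finset.sum_const_zero, add_zero]

/-- Of the second derivatives of `Aᵀ * G * A` only products of two first derivatives of `A` survive
where `A = 0` and `G = 1`. -/
theorem pd_pd_bundleMetric_bb (γ δ α β : Fin 2) :
    pd e γ (pd e δ (fun y => bundleMetric g G A (y, 0) (inl α) (inl β))) y =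
      pd e γ (pd e δ (fun r => g r α β)) y +
      ∑ K, (pd e δ (fun r => A r K α) y * pd e γ (fun r => A r K β) y
        + pd e γ (fun r => A r K α) y * pd e δ (fun r => A r K β) y) := by
  have h1 : (fun y => bundleMetric g G A (y, 0) (inl α) (inl β)) =
      fun r => g r α β + ∑ K, (∑ J, A r J α * G r J K) * A r K β := by
    ext r; simp [bundleMetric, Matrix.mul_apply]
  have h2 : ∀ K, ContDiffAt ℝ ∞ (fun r => ∑ J, A r J α * G r J K) y := fun K =>
    ContDiffAt.sum fun J _ => (hA _ _).mul (hG _ _)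
  have h3 := pd_pd_sum (e := e) γ δ (Finset.univ : Finset (Fin 2))
    fun K _ => (h2 K).mul (hA K β)
  have h4 : ∀ γ K, pd e γ (fun r => ∑ J, A r J α * G r J K) y = pd e γ (fun r => A r K α) y := by
    intro γ K
    rw [pd_sum _ _ fun J _ => ((hA J α).mul (hG J K)).dAt]
    simp only [fun J => pd_mul (e := e) γ (hA J α).dAt (hG J K).dAt, hA0, hG1, Matrix.zero_apply,
      Matrix.one_apply, mul_ite, mul_one, mul_zero, zero_mul, add_zero, Finset.sum_ite_eq',
      Finset.mem_univ, if_true]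
  have h5 : pd e δ (fun r => g r α β + ∑ K, (∑ J, A r J α * G r J K) * A r K β) =ᶠ[𝓝 y]
      fun r => pd e δ (fun r => g r α β) r
        + pd e δ (fun r => ∑ K, (∑ J, A r J α * G r J K) * A r K β) r := by
    have hev : ∀ {w : E2 → ℝ}, ContDiffAt ℝ ∞ w y → ∀ᶠ r in 𝓝 y, DifferentiableAt ℝ w r :=
      fun hw => ((hw.of_le (m := 1) (mod_cast le_top)).eventually (by simp)).mono fun r hr =>
        hr.differentiableAt (by simp)
    filter_upwards [hev (hg α β), hev (ContDiffAt.sum fun K _ => (h2 K).mul (hA K β))] with r h h'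
    exact pd_add _ h h'
  have h6 : ContDiffAt ℝ ∞ (fun r => ∑ K, (∑ J, A r J α * G r J K) * A r K β) y :=
    ContDiffAt.sum fun K _ => (h2 K).mul (hA K β)
  rw [h1, pd_congr γ h5, pd_add _ ((hg _ _).pd _).dAt (h6.pd _).dAt]
  congr 1
  refine h3.trans (Finset.sum_congr rfl fun K _ => ?_)
  rw [pd_pd_mul _ _ (h2 K) (hA K β), h4, h4]
  simp [hA0]

omit hg in
theorem pd_bundleMetric_bf (γ α I : Fin 2) :
    pd e γ (fun y => bundleMetric g G A (y, 0) (inl α) (inr I)) y =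
      pd e γ (fun r => A r I α) y := by
  have h1 : (fun y => bundleMetric g G A (y, 0) (inl α) (inr I)) =
      fun r => ∑ J, A r J α * G r J I := by
    ext r; simp [bundleMetric, Matrix.mul_apply]
  rw [h1, pd_sum _ _ fun J _ => ((hA J α).mul (hG J I)).dAt]
  simp only [fun J => pd_mul (e := e) γ (hA J α).dAt (hG J I).dAt, hA0, hG1, Matrix.zero_apply,
    Matrix.one_apply, mul_ite, mul_one, mul_zero, zero_mul, add_zero, Finset.sum_ite_eq',
    Finset.mem_univ, if_true]

omit hg in
theorem pd_bundleMetric_fb (γ α I : Fin 2) :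
    pd e γ (fun y => bundleMetric g G A (y, 0) (inr I) (inl α)) y =
      pd e γ (fun r => A r I α) y := by
  have h1 : (fun y => bundleMetric g G A (y, 0) (inr I) (inl α)) =
      fun r => ∑ J, G r I J * A r J α := by
    ext r; simp [bundleMetric, Matrix.mul_apply]
  rw [h1, pd_sum _ _ fun J _ => ((hG I J).mul (hA J α)).dAt]
  simp only [fun J => pd_mul (e := e) γ (hG I J).dAt (hA J α).dAt, hA0, hG1, Matrix.zero_apply,
    Matrix.one_apply, ite_mul, one_mul, mul_zero, zero_mul, zero_add, Finset.sum_ite_eq,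
    Finset.mem_univ, if_true]

omit hg hG hA hG1 hA0 in
theorem bundleMetric_ff (I J : Fin 2) :
    (fun y => bundleMetric g G A (y, 0) (inr I) (inr J)) = fun r => G r I J := rfl

omit hg hG hA in
theorem bundleMetric_of_eq_one (hg1 : g y = 1) (x : Fin 2 → ℝ) :
    bundleMetric g G A (y, x) = 1 := by
  simp [bundleMetric, hg1, hG1, hA0]

/-- With `G y = 1`, the second term is the gradient of `log (det G)` paired with that of `G`, the
third is the contraction of `∂G G⁻¹ ∂G`, and the last is the curvature of the connection acting as a
source. -/
theorem ricci_bundleMetric_fibre (hg1 : g y = 1) (he : ∀ I, (eT (inr I)).1 = 0)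
    (he' : ∀ α, (eT (inl α)).1 = e α) (hgs : ∀ r i j, g r i j = g r j i)
    (hGs : ∀ᶠ r in 𝓝 y, ∀ i j, G r i j = G r j i) (x : Fin 2 → ℝ) (I J : Fin 2) :
    ricci eT (bundleMetric g G A) (inr I) (inr J) (y, x) =
      -(1 / 2) * laplacian e g (fun r => G r I J) y
      - (1 / 4) * ∑ α, (∑ K, pd e α (fun r => G r K K) y) * pd e α (fun r => G r I J) y
      + (1 / 2) * ∑ α, ∑ K, pd e α (fun r => G r I K) y * pd e α (fun r => G r K J) y
      + (1 / 2) * ((pd e 0 (fun r => A r I 1) y - pd e 1 (fun r => A r I 0) y)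
        * (pd e 0 (fun r => A r J 1) y - pd e 1 (fun r => A r J 0) y)) := by
  rw [ricci_of_eq_one (contDiffAt_bundleMetric (q := (y, x)) hg hG hA)
    (bundleMetric_of_eq_one hG1 hA0 hg1 x), laplacian_of_eq_one hg1]
  have hg10 : (fun r => g r 1 0) = fun r => g r 0 1 := funext fun r => hgs r 1 0
  have hG10 : (fun r => G r 1 0) =ᶠ[𝓝 y] fun r => G r 0 1 := hGs.mono fun r h => h 1 0
  have hGd := fun γ => pd_congr (e := e) γ hG10
  have hGdd := fun γ δ => pd_congr (e := e) γ (pd_eventuallyEq (e := e) δ hG10)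
  simp only [Fintype.sum_sum_type, Fin.sum_univ_two, christoffelLow,
    pd_fibre_base_bundleMetric he he', pd_fibre_bundleMetric he, pd_const,
    pd_base_base_bundleMetric he', pd_base_bundleMetric he',
    pd_bundleMetric_bb hg hG hA hA0, pd_bundleMetric_bf hG hA hG1 hA0,
    pd_bundleMetric_fb hG hA hG1 hA0, bundleMetric_ff, hg10]
  fin_cases I <;> fin_cases J <;> simp only [Fin.zero_eta, Fin.mk_one, hGd, hGdd] <;> ring

/-- This is used once the connection is flat and the fibre volume is constant, whence the
assumptions `hF` and `ht`. The last sum is then the pairing whose trace-free part measures the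
failure of conformality of the map to the hyperbolic plane. -/
theorem ricci_bundleMetric_base (hg1 : g y = 1) (he : ∀ I, (eT (inr I)).1 = 0)
    (he' : ∀ α, (eT (inl α)).1 = e α) (hgs : ∀ r i j, g r i j = g r j i)
    (hGs : ∀ᶠ r in 𝓝 y, ∀ i j, G r i j = G r j i) (x : Fin 2 → ℝ)
    (hF : ∀ I, pd e 0 (fun r => A r I 1) y = pd e 1 (fun r => A r I 0) y)
    (ht : ∀ α, pd e α (fun r => G r 0 0) y + pd e α (fun r => G r 1 1) y = 0) (α β : Fin 2) :
    ricci eT (bundleMetric g G A) (inl α) (inl β) (y, x) = ricci e g α β y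
      - (1 / 2) * ∑ K, pd e β (pd e α (fun r => G r K K)) y
      + (1 / 4) * ∑ I, ∑ K, pd e α (fun r => G r I K) y * pd e β (fun r => G r K I) y := by
  rw [ricci_of_eq_one (contDiffAt_bundleMetric (q := (y, x)) hg hG hA)
    (bundleMetric_of_eq_one hG1 hA0 hg1 x), ricci_of_eq_one hg hg1]
  have hg10 : (fun r => g r 1 0) = fun r => g r 0 1 := funext fun r => hgs r 1 0
  have hG10 : (fun r => G r 1 0) =ᶠ[𝓝 y] fun r => G r 0 1 := hGs.mono fun r h => h 1 0
  have hGd := fun γ => pd_congr (e := e) γ hG10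
  have ht' : ∀ α, pd e α (fun r => G r 1 1) y = - pd e α (fun r => G r 0 0) y :=
    fun α => by linarith [ht α]
  simp only [Fintype.sum_sum_type, Fin.sum_univ_two, christoffelLow,
    pd_fibre_base_bundleMetric he he', pd_fibre_bundleMetric he, pd_const,
    pd_base_base_bundleMetric he', pd_base_bundleMetric he',
    pd_bundleMetric_bb hg hG hA hA0, pd_bundleMetric_bf hG hA hG1 hA0,
    pd_pd_bundleMetric_bb hg hG hA hG1 hA0,
    pd_bundleMetric_fb hG hA hG1 hA0, bundleMetric_ff, hg10]
  fin_cases α <;> fin_cases β <;> simp only [Fin.zero_eta, Fin.mk_one, hGd, hF, ht'] <;> ring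

end BundleJets

end CoordGeom

namespace CoordGeom

/-! ### Affine changes of functions, and linear algebra of the Euclidean plane. -/

section LaplacianLinear

variable {k : Type*} [Fintype k] [DecidableEq k] {V : Type*} [NormedAddCommGroup V]
  [NormedSpace ℝ V] {e : k → V} {g : V → Matrix k k ℝ} {q : V}

theorem laplacian_congr {f f' : V → ℝ} (h : f =ᶠ[𝓝 q] f') :
    laplacian e g f q = laplacian e g f' q := by
  simp only [laplacian, pd_congr _ h, pd_congr _ (pd_eventuallyEq _ h)]

omit [Fintype k] [DecidableEq k] in
theorem eventually_differentiableAt {f : V → ℝ} (hf : ContDiffAt ℝ ∞ f q) :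
    ∀ᶠ r in 𝓝 q, DifferentiableAt ℝ f r :=
  ((hf.of_le (m := 1) (mod_cast le_top)).eventually (by simp)).mono fun r hr =>
    hr.differentiableAt (by simp)

omit [Fintype k] [DecidableEq k] in
theorem pd_affine {f : V → ℝ} (hf : DifferentiableAt ℝ f q) (c d : ℝ) (i : k) :
    pd e i (fun r => c * f r + d) q = c * pd e i f q := by
  rw [pd_add i (hf.const_mul c) (differentiableAt_const d), pd_const, pd_const_mul i c hf, add_zero]

/-- An upper triangular change of the fibre frame changes `√det G` and the two coordinates of the
half-plane by affine maps, so no other rescaling has to be understood. -/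
theorem laplacian_affine {f : V → ℝ} (hf : ContDiffAt ℝ ∞ f q) (c d : ℝ) :
    laplacian e g (fun r => c * f r + d) q = c * laplacian e g f q := by
  have h1 : ∀ i j, pd e i (pd e j fun r => c * f r + d) q = c * pd e i (pd e j f) q := by
    intro i j
    have h2 : (pd e j fun r => c * f r + d) =ᶠ[𝓝 q] fun r => c * pd e j f r + 0 := by
      filter_upwards [eventually_differentiableAt hf] with r hr
      rw [pd_affine hr, add_zero]
    rw [pd_congr i h2, pd_affine (hf.pd j).dAt]
  simp only [laplacian, h1, pd_affine hf.dAt, Finset.mul_sum, mul_sub]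
  refine Finset.sum_congr rfl fun i _ => Finset.sum_congr rfl fun j _ => ?_
  congr 1
  · ring
  · exact Finset.sum_congr rfl fun l _ => by ring

end LaplacianLinear

section TwoDim

/-- The rotation by a right angle of an oriented Euclidean plane with Gram matrix `M`. -/
noncomputable def rotation (M : Matrix (Fin 2) (Fin 2) ℝ) : Matrix (Fin 2) (Fin 2) ℝ :=
  !![-M 1 0 / √M.det, -M 1 1 / √M.det; M 0 0 / √M.det, M 0 1 / √M.det]

/-- With `E` the standard quarter turn, `rotation M` is `E * M` divided by `√M.det`, and `N * E * Nᵀ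
= N.det • E`, while the root of the determinant only scales by `|N.det|`. For singular `N` both
sides are zero, division by zero being zero. -/
theorem mul_rotation_congruence (M N : Matrix (Fin 2) (Fin 2) ℝ) :
    N * rotation (Nᵀ * M * N) = (N.det / |N.det|) • (rotation M * N) := by
  have h1 : √(Nᵀ * M * N).det = |N.det| * √M.det := by
    rw [Matrix.det_mul, Matrix.det_mul, Matrix.det_transpose,
      show N.det * M.det * N.det = N.det ^ 2 * M.det by ring, Real.sqrt_mul (sq_nonneg _),
      Real.sqrt_sq_eq_abs]
  have key : ∀ i j, (N * rotation (Nᵀ * M * N)) i j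
      = (|N.det| * √M.det)⁻¹ * (N.det * (!![-M 1 0, -M 1 1; M 0 0, M 0 1] * N) i j) := by
    intro i j
    simp only [rotation, h1]
    fin_cases i <;> fin_cases j <;>
      simp only [Matrix.mul_apply, Fin.sum_univ_two, Matrix.transpose_apply, Matrix.det_fin_two,
        Fin.zero_eta, Fin.mk_one, Matrix.of_apply, Matrix.cons_val', Matrix.cons_val_zero,
        Matrix.cons_val_one, Matrix.cons_val_fin_one, div_eq_mul_inv] <;> ring
  ext i j
  rw [key]
  simp only [Matrix.smul_apply, smul_eq_mul, rotation]
  have h3 : (!![-M 1 0 / √M.det, -M 1 1 / √M.det; M 0 0 / √M.det, M 0 1 / √M.det] * N) i j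
      = (√M.det)⁻¹ * (!![-M 1 0, -M 1 1; M 0 0, M 0 1] * N) i j := by
    fin_cases i <;> fin_cases j <;> simp [Matrix.mul_apply, Fin.sum_univ_two] <;> ring
  rw [h3, mul_inv]
  ring

theorem rotation_one : rotation 1 = !![0, -1; 1, 0] := by
  ext i j; fin_cases i <;> fin_cases j <;> simp [rotation]

/-- Gram–Schmidt. The triangular shape matters: it keeps the direction of the first basis vector,
hence acts on the upper half-plane by real affine maps. -/
theorem exists_upperTriangular {M : Matrix (Fin 2) (Fin 2) ℝ} (hM : M.PosDef) :
    ∃ p : Matrix (Fin 2) (Fin 2) ℝ, p 1 0 = 0 ∧ 0 < p 0 0 ∧ 0 < p 1 1 ∧ pᵀ * M * p = 1 := by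
  have h0 : 0 < M 0 0 := hM.diag_pos
  have hd : 0 < M.det := hM.det_pos
  have hs : M 1 0 = M 0 1 := by simpa using congrFun (congrFun hM.isHermitian 0) 1
  have e0 : √(M 0 0) ^ 2 = M 0 0 := Real.sq_sqrt h0.le
  have ed : √M.det ^ 2 = M.det := Real.sq_sqrt hd.le
  have p0 := Real.sqrt_pos.2 h0
  have pd' := Real.sqrt_pos.2 hd
  refine ⟨!![(√(M 0 0))⁻¹, -M 0 1 / (√(M 0 0) * √M.det); 0, √(M 0 0) / √M.det], by simp,
    by simpa, by simpa using div_pos p0 pd', ?_⟩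
  have hdet := Matrix.det_fin_two M
  rw [hs] at hdet
  set a := √(M 0 0)
  set d := √M.det
  ext i j
  fin_cases i <;> fin_cases j <;>
    simp [Matrix.mul_apply, Fin.sum_univ_two, hs]
  · field_simp; linarith
  · field_simp; linear_combination M 0 1 * e0
  · field_simp; left; linear_combination M 0 1 * e0
  · field_simp
    linear_combination (-M 0 1 ^ 2 + a ^ 2 * M 1 1) * e0 - a ^ 2 * hdet - a ^ 2 * ed

/-- With `z₀ = p0 + i q0` and `z₁ = p1 + i q1`, the product in `h3` is `|z₁ - i z₀|² |z₁ + i z₀|² =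
|z₀² + z₁²|²`, which equals `(|z₀|² - |z₁|²)²` plus four times the square of the inner product. -/
theorem rotation_alternative {p0 q0 p1 q1 : ℝ} (h1 : p0 * p1 + q0 * q1 = 0)
    (h2 : p0 ^ 2 + q0 ^ 2 = p1 ^ 2 + q1 ^ 2) :
    (p1 = -q0 ∧ q1 = p0) ∨ (p1 = q0 ∧ q1 = -p0) := by
  have h3 : ((p1 + q0) ^ 2 + (q1 - p0) ^ 2) * ((p1 - q0) ^ 2 + (q1 + p0) ^ 2) = 0 := by
    linear_combination (4 * (p0 * p1 + q0 * q1)) * h1 + (p0 ^ 2 + q0 ^ 2 - (p1 ^ 2 + q1 ^ 2)) * h2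
  rcases mul_eq_zero.1 h3 with h | h
  · left
    constructor <;> nlinarith [sq_nonneg (p1 + q0), sq_nonneg (q1 - p0)]
  · right
    constructor <;> nlinarith [sq_nonneg (p1 - q0), sq_nonneg (q1 + p0)]

variable {e : Fin 2 → E2} {g : E2 → Matrix (Fin 2) (Fin 2) ℝ} {y : E2}

/-- The Ricci tensor of a surface is the Gauss curvature times the metric, so it has no trace-free
part. -/
theorem ricci_two_dim (hg : ∀ i j, ContDiffAt ℝ ∞ (fun r => g r i j) y) (hg1 : g y = 1)
    (hgs : ∀ r i j, g r i j = g r j i) :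
    ricci e g 0 1 y = 0 ∧ ricci e g 0 0 y = ricci e g 1 1 y := by
  have hg10 : (fun r => g r 1 0) = fun r => g r 0 1 := funext fun r => hgs r 1 0
  have hc := fun i j => pd_comm (e := e) 0 1 (hg i j)
  constructor <;>
  · simp only [ricci_of_eq_one hg hg1, Fin.sum_univ_two, christoffelLow, hg10, hc]
    ring

end TwoDim

end CoordGeom

namespace CoordGeom

open Sum

/-! ### Consequences of the Ricci equations at a normalized point. -/

section Normalized

variable {e : Fin 2 → E2} {eT : Fin 2 ⊕ Fin 2 → E2 × (Fin 2 → ℝ)}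
  {g G A : E2 → Matrix (Fin 2) (Fin 2) ℝ} {y : E2} {x : Fin 2 → ℝ}
  (hg : ∀ i j, ContDiffAt ℝ ∞ (fun r => g r i j) y)
  (hG : ∀ i j, ContDiffAt ℝ ∞ (fun r => G r i j) y)
  (hA : ∀ i j, ContDiffAt ℝ ∞ (fun r => A r i j) y) (hG1 : G y = 1) (hA0 : A y = 0)
  (hg1 : g y = 1) (he : ∀ I, (eT (inr I)).1 = 0)
  (he' : ∀ α, (eT (inl α)).1 = e α) (hgs : ∀ r i j, g r i j = g r j i)
  (hGs : ∀ᶠ r in 𝓝 y, ∀ i j, G r i j = G r j i)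

include hG hG1 hGs in
theorem det_jets : (∀ α, pd e α (fun r => (G r).det) y =
      pd e α (fun r => G r 0 0) y + pd e α (fun r => G r 1 1) y) ∧
    ∀ α β, pd e α (pd e β (fun r => (G r).det)) y =
      pd e α (pd e β (fun r => G r 0 0)) y + pd e α (pd e β (fun r => G r 1 1)) y
      + pd e α (fun r => G r 0 0) y * pd e β (fun r => G r 1 1) y
      + pd e β (fun r => G r 0 0) y * pd e α (fun r => G r 1 1) y
      - 2 * (pd e α (fun r => G r 0 1) y * pd e β (fun r => G r 0 1) y) := by
  have hdet : (fun r => (G r).det) =ᶠ[𝓝 y] fun r => G r 0 0 * G r 1 1 - G r 0 1 * G r 0 1 :=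
    hGs.mono fun r h => by
      simp only [Matrix.det_fin_two, h 1 0]
  have h1 := (hG 0 0).mul (hG 1 1)
  have h2 := (hG 0 1).mul (hG 0 1)
  constructor
  · intro α
    rw [pd_congr α hdet, pd_sub _ h1.dAt h2.dAt, pd_mul _ (hG _ _).dAt (hG _ _).dAt,
      pd_mul _ (hG _ _).dAt (hG _ _).dAt, hG1]
    simp
  · intro α β
    have h3 : pd e β (fun r => G r 0 0 * G r 1 1 - G r 0 1 * G r 0 1) =ᶠ[𝓝 y] fun r =>
        pd e β (fun r => G r 0 0 * G r 1 1) r - pd e β (fun r => G r 0 1 * G r 0 1) r := by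
      filter_upwards [eventually_differentiableAt h1, eventually_differentiableAt h2] with r h h'
      exact pd_sub _ h h'
    rw [pd_congr α ((pd_eventuallyEq β hdet).trans h3), pd_sub _ (h1.pd _).dAt (h2.pd _).dAt,
      pd_pd_mul _ _ (hG _ _) (hG _ _), pd_pd_mul _ _ (hG _ _) (hG _ _), hG1]
    simp
    ring

include hg hG hA hG1 hA0 hg1 he he' hgs hGs

/-- Add the two diagonal fibre equations. The quadratic terms in the first derivatives of `G` are
exactly those created by the determinant and its square root, so that only the curvature remains.
This is why the square root, rather than `det G` itself, is used. -/
theorem laplacian_sqrt_det_of_eq_one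
    (hR : ∀ I, ricci eT (bundleMetric g G A) (inr I) (inr I) (y, x) = 0) :
    laplacian e g (fun r => √(G r).det) y =
      (1 / 2) * ∑ I, (pd e 0 (fun r => A r I 1) y - pd e 1 (fun r => A r I 0) y) ^ 2 := by
  obtain ⟨hd1, hd2⟩ := det_jets (e := e) hG hG1 hGs
  have hdp : 0 < (G y).det := by simp [hG1]
  have hdc := contDiffAt_det hG
  have hu : ContDiffAt ℝ ∞ (fun r => √(G r).det) y := hdc.sqrt hdp.ne'
  have huu : (fun r => √(G r).det * √(G r).det) =ᶠ[𝓝 y] fun r => (G r).det := by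
    filter_upwards [hdc.continuousAt.eventually (lt_mem_nhds hdp)] with r hr
    exact Real.mul_self_sqrt hr.le
  have hu1 : √(G y).det = 1 := by simp [hG1]
  have e1 : ∀ α, pd e α (fun r => √(G r).det) y = (1 / 2) * pd e α (fun r => (G r).det) y := by
    intro α
    have := pd_congr (e := e) α huu
    rw [pd_mul _ hu.dAt hu.dAt, hu1] at this
    linarith
  have e2 : ∀ α, pd e α (pd e α (fun r => √(G r).det)) y =
      (1 / 2) * pd e α (pd e α (fun r => (G r).det)) y
        - (1 / 4) * pd e α (fun r => (G r).det) y ^ 2 := by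
    intro α
    have := pd_congr (e := e) α (pd_eventuallyEq (e := e) α huu)
    rw [pd_pd_mul _ _ hu hu, hu1, e1] at this
    linear_combination (1 / 2) * this
  have hR0 := hR 0
  have hR1 := hR 1
  have hG10 : (fun r => G r 1 0) =ᶠ[𝓝 y] fun r => G r 0 1 := hGs.mono fun r h => h 1 0
  have hGd := fun γ => pd_congr (e := e) γ hG10
  rw [ricci_bundleMetric_fibre hg hG hA hG1 hA0 hg1 he he' hgs hGs,
    laplacian_of_eq_one hg1] at hR0 hR1
  rw [laplacian_of_eq_one hg1]
  simp only [Fin.sum_univ_two, e1, e2, hd1, hd2, hGd] at hR0 hR1 ⊢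
  linear_combination -hR0 - hR1

/-- The base equations give pointwise conformality of the map to the half-plane, and the fibre
equations give the harmonic map equation. For a conformal map the Christoffel terms of the
hyperbolic metric cancel in the coordinates `x` and `s`, so both are harmonic functions in the
ordinary sense. -/
theorem harmonic_conformal_of_eq_one
    (hR : ∀ i j, ricci eT (bundleMetric g G A) i j (y, x) = 0)
    (hF : ∀ I, pd e 0 (fun r => A r I 1) y = pd e 1 (fun r => A r I 0) y)
    (hdet : ∀ᶠ r in 𝓝 y, (G r).det = 1) :
    laplacian e g (fun r => G r 0 1 / G r 0 0) y = 0 ∧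
    laplacian e g (fun r => √(G r).det / G r 0 0) y = 0 ∧
    ∃ σ : ℝ, (σ = 1 ∨ σ = -1) ∧
      pd e 0 (fun r => √(G r).det / G r 0 0) y
        + σ * pd e 1 (fun r => G r 0 1 / G r 0 0) y = 0 ∧
      pd e 1 (fun r => √(G r).det / G r 0 0) y
        - σ * pd e 0 (fun r => G r 0 1 / G r 0 0) y = 0 := by
  obtain ⟨hd1, hd2⟩ := det_jets (e := e) hG hG1 hGs
  have hdet' : (fun r => (G r).det) =ᶠ[𝓝 y] fun _ => 1 := hdet
  have ht : ∀ α, pd e α (fun r => G r 0 0) y + pd e α (fun r => G r 1 1) y = 0 := by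
    intro α; rw [← hd1, pd_congr α hdet', pd_const]
  have ht2 : ∀ α β, pd e α (pd e β (fun r => (G r).det)) y = 0 := by
    intro α β
    rw [pd_congr α (pd_eventuallyEq β hdet')]
    have : pd e β (fun _ : E2 => (1 : ℝ)) = fun _ => 0 := funext fun r => pd_const β 1
    rw [this, pd_const]
  simp only [hd2] at ht2
  have ht' : ∀ α, pd e α (fun r => G r 1 1) y = -pd e α (fun r => G r 0 0) y :=
    fun α => by linarith [ht α]
  have hG10 : (fun r => G r 1 0) =ᶠ[𝓝 y] fun r => G r 0 1 := hGs.mono fun r h => h 1 0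
  have hGd := fun γ => pd_congr (e := e) γ hG10
  -- the base equations
  obtain ⟨hr01, hr00⟩ := ricci_two_dim (e := e) hg hg1 hgs
  have hb := fun α β => hR (inl α) (inl β)
  simp only [ricci_bundleMetric_base hg hG hA hG1 hA0 hg1 he he' hgs hGs x hF ht,
    Fin.sum_univ_two, hGd, ht'] at hb
  simp only [ht'] at ht2
  -- The second derivatives of the equation `det G = 1` eliminate the second derivatives of the
  -- trace of `G`. What is left of the trace-free base equations says that the vectors `(∂_α G₀₀,
  -- ∂_α G₀₁)`, for the two values of `α`, are orthogonal (`c1`) and of equal length (`c2`).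
  have c1 : pd e 0 (fun r => G r 0 0) y * pd e 1 (fun r => G r 0 0) y
      + pd e 0 (fun r => G r 0 1) y * pd e 1 (fun r => G r 0 1) y = 0 := by
    linear_combination -2 * hb 0 1 + 2 * hr01 - ht2 1 0
  have c2 : pd e 0 (fun r => G r 0 0) y ^ 2 + pd e 0 (fun r => G r 0 1) y ^ 2
      = pd e 1 (fun r => G r 0 0) y ^ 2 + pd e 1 (fun r => G r 0 1) y ^ 2 := by
    linear_combination -2 * hb 0 0 + 2 * hb 1 1 + 2 * hr00 - ht2 0 0 + ht2 1 1
  have halt := rotation_alternative c1 c2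
  -- the fibre equations
  have hf := fun J => hR (inr 0) (inr J)
  simp only [ricci_bundleMetric_fibre hg hG hA hG1 hA0 hg1 he he' hgs hGs,
    laplacian_of_eq_one hg1, Fin.sum_univ_two, ht', hF] at hf
  have hf0 := hf 0
  have hf1 := hf 1
  simp only [hGd, ht'] at hf0 hf1
  -- the jets of the two functions
  have h00 : ContDiffAt ℝ ∞ (fun r => (G r 0 0)⁻¹) y := (hG 0 0).inv (by simp [hG1])
  have h00e : ∀ᶠ r in 𝓝 y, G r 0 0 ≠ 0 := (hG 0 0).continuousAt.eventually_ne (by simp [hG1])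
  have hx : ContDiffAt ℝ ∞ (fun r => G r 0 1 / G r 0 0) y := (hG 0 1).mul h00
  have hs : ContDiffAt ℝ ∞ (fun r => √(G r).det / G r 0 0) y :=
    ((contDiffAt_det hG).sqrt (by simp [hG1])).mul h00
  -- Differentiating the products `x G₀₀ = G₀₁` and `s G₀₀ = 1` replaces the quotient rule.
  have hxe : (fun r => G r 0 1 / G r 0 0 * G r 0 0) =ᶠ[𝓝 y] fun r => G r 0 1 := by
    filter_upwards [h00e] with r hr
    field_simp
  have hse : (fun r => √(G r).det / G r 0 0 * G r 0 0) =ᶠ[𝓝 y] fun _ => 1 := by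
    filter_upwards [h00e, hdet] with r hr hr'
    rw [hr']; field_simp; simp
  have x1 : ∀ α, pd e α (fun r => G r 0 1 / G r 0 0) y = pd e α (fun r => G r 0 1) y := by
    intro α
    have := pd_congr (e := e) α hxe
    rw [pd_mul _ hx.dAt (hG 0 0).dAt, hG1] at this
    simpa using this
  have x2 : ∀ α, pd e α (pd e α (fun r => G r 0 1 / G r 0 0)) y =
      pd e α (pd e α (fun r => G r 0 1)) y
        - 2 * pd e α (fun r => G r 0 1) y * pd e α (fun r => G r 0 0) y := by
    intro α
    have := pd_congr (e := e) α (pd_eventuallyEq (e := e) α hxe)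
    rw [pd_pd_mul _ _ hx (hG 0 0), hG1, x1] at this
    simp only [Matrix.one_apply_eq, ne_eq, zero_ne_one, not_false_eq_true, Matrix.one_apply_ne,
      zero_div, zero_mul, mul_one] at this
    linear_combination this
  have s1 : ∀ α, pd e α (fun r => √(G r).det / G r 0 0) y = -pd e α (fun r => G r 0 0) y := by
    intro α
    have := pd_congr (e := e) α hse
    rw [pd_mul _ hs.dAt (hG 0 0).dAt, hG1, pd_const] at this
    simp at this
    linarith
  have s2 : ∀ α, pd e α (pd e α (fun r => √(G r).det / G r 0 0)) y =
      -pd e α (pd e α (fun r => G r 0 0)) y + 2 * pd e α (fun r => G r 0 0) y ^ 2 := by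
    intro α
    have := pd_congr (e := e) α (pd_eventuallyEq (e := e) α hse)
    have hz : pd e α (fun _ : E2 => (1 : ℝ)) = fun _ => 0 := funext fun r => pd_const α 1
    rw [pd_pd_mul _ _ hs (hG 0 0), hG1, s1, hz, pd_const] at this
    simp only [Matrix.one_apply_eq, Matrix.det_one, Real.sqrt_one, div_one, mul_one, one_mul] at this
    linear_combination this
  -- Once the conformal alternative is inserted, the quadratic terms of the fibre equations match
  -- those from the jets of the quotients.
  refine ⟨?_, ?_, ?_⟩
  · rw [laplacian_of_eq_one hg1]
    simp only [Fin.sum_univ_two, x1, x2]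
    rcases halt with ⟨a1, a2⟩ | ⟨a1, a2⟩ <;> simp only [a1, a2] at hf1 ⊢ <;>
      linear_combination -2 * hf1
  · rw [laplacian_of_eq_one hg1]
    simp only [Fin.sum_univ_two, s1, s2]
    rcases halt with ⟨a1, a2⟩ | ⟨a1, a2⟩ <;> simp only [a1, a2] at hf0 ⊢ <;>
      linear_combination 2 * hf0
  · rcases halt with ⟨a1, a2⟩ | ⟨a1, a2⟩
    · exact ⟨1, Or.inl rfl, by rw [s1, x1, a2]; ring, by rw [s1, x1, a1]; ring⟩
    · exact ⟨-1, Or.inr rfl, by rw [s1, x1, a2]; ring, by rw [s1, x1, a1]; ring⟩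

end Normalized

end CoordGeom

namespace CoordGeom

open Sum

/-! ### Reduction of an arbitrary point to a normalized one. -/

section ChangeBundle

variable {g G A : E2 → Matrix (Fin 2) (Fin 2) ℝ} {p r A0 : Matrix (Fin 2) (Fin 2) ℝ} {y : E2}

/-- The base change `∂_α ↦ p^β_α (∂_β - A0^I_β ∂_I)`, `∂_I ↦ r^J_I ∂_J`. -/
def bundleChange (p r A0 : Matrix (Fin 2) (Fin 2) ℝ) : Matrix (Fin 2 ⊕ Fin 2) (Fin 2 ⊕ Fin 2) ℝ :=
  Matrix.fromBlocks p 0 (-(A0 * p)) r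

/-- The basis obtained by `bundleChange` from the coordinate basis. -/
noncomputable def bundleBasis (p r A0 : Matrix (Fin 2) (Fin 2) ℝ) (i : Fin 2 ⊕ Fin 2) :
    E2 × (Fin 2 → ℝ) :=
  ∑ a, bundleChange p r A0 a i • totalBasis a

/-- The basis `p^β_α ∂_β` of the plane. -/
noncomputable def planeBasis (p : Matrix (Fin 2) (Fin 2) ℝ) (α : Fin 2) : E2 :=
  ∑ β, p β α • baseBasis β

theorem bundleBasis_inr (I : Fin 2) : (bundleBasis p r A0 (inr I)).1 = 0 := by
  simp [bundleBasis, bundleChange, totalBasis, Fintype.sum_sum_type]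

theorem bundleBasis_inl (α : Fin 2) : (bundleBasis p r A0 (inl α)).1 = planeBasis p α := by
  simp [bundleBasis, bundleChange, totalBasis, Fintype.sum_sum_type, planeBasis]

/-- In terms of the coframe `dx + A`, the constant shear by `A0` replaces `A` by `A - A0`, while `p`
and `r` change the bases of the base and of the fibre separately. The new data are again of bundle
form. -/
theorem bundleMetric_change (hr : IsUnit r.det) (q : E2 × (Fin 2 → ℝ)) :
    (bundleChange p r A0)ᵀ * bundleMetric g G A q * bundleChange p r A0 =
      bundleMetric (fun z => pᵀ * g z * p) (fun z => rᵀ * G z * r)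
        (fun z => r⁻¹ * ((A z - A0) * p)) q := by
  have h1 : ∀ B : Matrix (Fin 2) (Fin 2) ℝ, r * (r⁻¹ * B) = B := fun B => by
    rw [← Matrix.mul_assoc, Matrix.mul_nonsing_inv _ hr, Matrix.one_mul]
  have h2 : ∀ B : Matrix (Fin 2) (Fin 2) ℝ, r⁻¹ᵀ * (rᵀ * B) = B := fun B => by
    rw [← Matrix.mul_assoc, ← Matrix.transpose_mul, Matrix.mul_nonsing_inv _ hr,
      Matrix.transpose_one, Matrix.one_mul]
  simp only [bundleChange, bundleMetric, Matrix.fromBlocks_transpose, Matrix.fromBlocks_multiply]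
  congr 1 <;>
  · simp only [Matrix.mul_assoc, h1, h2, Matrix.transpose_zero, Matrix.zero_mul, Matrix.mul_zero,
      zero_add, add_zero, Matrix.transpose_mul, Matrix.transpose_neg, Matrix.transpose_sub,
      Matrix.mul_add, Matrix.add_mul, Matrix.sub_mul, Matrix.mul_sub, Matrix.neg_mul,
      Matrix.mul_neg]
    try abel

variable (hg : ∀ i j, ContDiffAt ℝ ∞ (fun r => g r i j) y)
  (hG : ∀ i j, ContDiffAt ℝ ∞ (fun r => G r i j) y)
  (hA : ∀ i j, ContDiffAt ℝ ∞ (fun r => A r i j) y)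

theorem contDiffAt_congruence {M : E2 → Matrix (Fin 2) (Fin 2) ℝ}
    (hM : ∀ i j, ContDiffAt ℝ ∞ (fun r => M r i j) y) (p p' : Matrix (Fin 2) (Fin 2) ℝ)
    (i j : Fin 2) : ContDiffAt ℝ ∞ (fun z => (p * M z * p') i j) y := by
  simp only [Matrix.mul_apply]
  exact ContDiffAt.sum fun a _ => (ContDiffAt.sum fun b _ =>
    contDiffAt_const.mul (hM b a)).mul contDiffAt_const

/-- The connection enters through unipotent factors only, so it does not affect the determinant. -/
theorem det_bundleMetric (q : E2 × (Fin 2 → ℝ)) :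
    (bundleMetric g G A q).det = (g q.1).det * (G q.1).det := by
  have : bundleMetric g G A q = Matrix.fromBlocks 1 (A q.1)ᵀ 0 1 *
      Matrix.fromBlocks (g q.1) 0 0 (G q.1) * Matrix.fromBlocks 1 0 (A q.1) 1 := by
    simp only [bundleMetric, Matrix.fromBlocks_multiply]
    congr 1 <;> simp
  rw [this, Matrix.det_mul, Matrix.det_mul, Matrix.det_fromBlocks_zero₂₁,
    Matrix.det_fromBlocks_zero₁₂, Matrix.det_fromBlocks_zero₁₂]
  simp

include hg hG hA in
theorem ricci_bundle_change (hp : IsUnit p.det) (hr : IsUnit r.det) (hg0 : (g y).det ≠ 0)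
    (hG0 : (G y).det ≠ 0) {x : Fin 2 → ℝ}
    (hR : ∀ i j, ricci totalBasis (bundleMetric g G A) i j (y, x) = 0) (i j : Fin 2 ⊕ Fin 2) :
    ricci (bundleBasis p r A0) (bundleMetric (fun z => pᵀ * g z * p) (fun z => rᵀ * G z * r)
        (fun z => r⁻¹ * ((A z - A0) * p))) i j (y, x) = 0 := by
  have hP : IsUnit (bundleChange p r A0).det := by
    rw [bundleChange, Matrix.det_fromBlocks_zero₁₂]; exact hp.mul hr
  have h1 := ricci_change (e := totalBasis) (e' := bundleBasis p r A0) (fun _ => rfl) hP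
    (contDiffAt_bundleMetric (q := (y, x)) hg hG hA)
    (by rw [det_bundleMetric]; exact mul_ne_zero hg0 hG0) i j
  simp only [hR, mul_zero, Finset.sum_const_zero, bundleMetric_change hr] at h1
  exact h1

include hA in
-- The curvature is a two-form on the plane, which produces `p.det`, with values in the fibre, which
-- produces `r⁻¹`; the constant `A0` is killed by differentiation.
theorem curvature_change (I : Fin 2) :
    pd (planeBasis p) 0 (fun z => (r⁻¹ * ((A z - A0) * p)) I 1) y
      - pd (planeBasis p) 1 (fun z => (r⁻¹ * ((A z - A0) * p)) I 0) y =
    p.det * ∑ J, r⁻¹ I J * (pd baseBasis 0 (fun z => A z J 1) y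
      - pd baseBasis 1 (fun z => A z J 0) y) := by
  have h1 : ∀ γ α, pd baseBasis γ (fun z => (r⁻¹ * ((A z - A0) * p)) I α) y =
      ∑ J, ∑ β, r⁻¹ I J * p β α * pd baseBasis γ (fun z => A z J β) y := by
    intro γ α
    have : (fun z => (r⁻¹ * ((A z - A0) * p)) I α) =
        fun z => ∑ J, ∑ β, ((r⁻¹ I J * p β α) * A z J β + -(r⁻¹ I J * p β α * A0 J β)) := by
      ext z
      simp only [Matrix.mul_apply, Finset.mul_sum, Matrix.sub_apply]
      exact Finset.sum_congr rfl fun J _ => Finset.sum_congr rfl fun β _ => by ring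
    have hd : ∀ J β, DifferentiableAt ℝ
        (fun z => (r⁻¹ I J * p β α) * A z J β + -(r⁻¹ I J * p β α * A0 J β)) y :=
      fun J β => ((hA J β).dAt.const_mul _).add_const _
    rw [this, pd_sum _ _ fun J _ => DifferentiableAt.fun_sum fun β _ => hd J β]
    refine Finset.sum_congr rfl fun J _ => ?_
    rw [pd_sum _ _ fun β _ => hd J β]
    exact Finset.sum_congr rfl fun β _ => pd_affine (hA J β).dAt _ _ _
  rw [pd_change (e := baseBasis) (e' := planeBasis p) (fun _ => rfl),
    pd_change (e := baseBasis) (e' := planeBasis p) (fun _ => rfl)]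
  simp only [h1, Fin.sum_univ_two, Matrix.det_fin_two]
  ring

end ChangeBundle

section RicciFlat

variable {g G A : E2 → Matrix (Fin 2) (Fin 2) ℝ} {y : E2} {x : Fin 2 → ℝ}
  (hg : ∀ i j, ContDiffAt ℝ ∞ (fun r => g r i j) y)
  (hG : ∀ i j, ContDiffAt ℝ ∞ (fun r => G r i j) y)
  (hA : ∀ i j, ContDiffAt ℝ ∞ (fun r => A r i j) y)
  (hgp : (g y).PosDef) (hGp : (G y).PosDef) (hgs : ∀ r i j, g r i j = g r j i)
  (hGs : ∀ᶠ r in 𝓝 y, ∀ i j, G r i j = G r j i)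
  (hR : ∀ i j, ricci totalBasis (bundleMetric g G A) i j (y, x) = 0)

theorem symm_congruence {M p : Matrix (Fin 2) (Fin 2) ℝ} (hM : ∀ i j, M i j = M j i)
    (i j : Fin 2) : (pᵀ * M * p) i j = (pᵀ * M * p) j i := by
  have h : Mᵀ = M := by ext i j; exact hM j i
  have : (pᵀ * M * p)ᵀ = pᵀ * M * p := by
    rw [Matrix.transpose_mul, Matrix.transpose_mul, Matrix.transpose_transpose, h,
      Matrix.mul_assoc]
  exact congrFun (congrFun this j) i

theorem isUnit_det_upperTriangular {p : Matrix (Fin 2) (Fin 2) ℝ} (h10 : p 1 0 = 0)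
    (h0 : 0 < p 0 0) (h1 : 0 < p 1 1) : 0 < p.det := by
  rw [Matrix.det_fin_two, h10]; simp; positivity

include hg hG hA hgp hGp hgs hGs hR

/-- Choose `p` and `r` making `g` and `G` the identity at `y`, and subtract `A y` from the
connection. In the normalized identity `√det G` is multiplied by the positive number `r.det` and the
curvature by invertible matrices, so the sign of the Laplacian and the vanishing of the curvature
can be carried back. -/
theorem laplacian_sqrt_det :
    0 ≤ laplacian baseBasis g (fun r => √(G r).det) y ∧
    (laplacian baseBasis g (fun r => √(G r).det) y = 0 → ∀ I,
      pd baseBasis 0 (fun z => A z I 1) y = pd baseBasis 1 (fun z => A z I 0) y) := by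
  obtain ⟨p, p10, p00, p11, hp1⟩ := exists_upperTriangular hgp
  obtain ⟨r, r10, r00, r11, hr1⟩ := exists_upperTriangular hGp
  have hp := isUnit_det_upperTriangular p10 p00 p11
  have hr := isUnit_det_upperTriangular r10 r00 r11
  have hpu : IsUnit p.det := isUnit_iff_ne_zero.2 hp.ne'
  have hru : IsUnit r.det := isUnit_iff_ne_zero.2 hr.ne'
  have hR' := ricci_bundle_change (A0 := A y) hg hG hA hpu hru hgp.det_pos.ne' hGp.det_pos.ne' hR
  have hA' : ∀ i j, ContDiffAt ℝ ∞ (fun z => (r⁻¹ * ((A z - A y) * p)) i j) y := fun i j => by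
    simp only [← Matrix.mul_assoc]
    exact contDiffAt_congruence (M := fun z => A z - A y)
      (fun i j => (hA i j).sub contDiffAt_const) _ _ i j
  have key := laplacian_sqrt_det_of_eq_one (e := planeBasis p) (x := x)
    (contDiffAt_congruence hg _ _) (contDiffAt_congruence hG _ _)
    hA' hr1 (by simp) hp1 bundleBasis_inr bundleBasis_inl (fun z => symm_congruence (hgs z))
    (hGs.mono fun z hz => symm_congruence hz) (fun I => hR' _ _)
  have hu : ContDiffAt ℝ ∞ (fun r => √(G r).det) y :=
    (contDiffAt_det hG).sqrt hGp.det_pos.ne'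
  have h1 : (fun z => √(rᵀ * G z * r).det) = fun z => r.det * √(G z).det + 0 := by
    ext z
    rw [Matrix.det_mul, Matrix.det_mul, Matrix.det_transpose,
      show r.det * (G z).det * r.det = r.det ^ 2 * (G z).det by ring,
      Real.sqrt_mul (sq_nonneg _), Real.sqrt_sq hr.le, add_zero]
  rw [h1, laplacian_affine hu,
    laplacian_change (e := baseBasis) (e' := planeBasis p) (fun _ => rfl) hpu (fun i j => (hg i j).dAt) hu] at key
  simp only [curvature_change hA] at key
  constructor
  · have h2 : 0 ≤ r.det * laplacian baseBasis g (fun r => √(G r).det) y := by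
      rw [key]; positivity
    exact nonneg_of_mul_nonneg_right h2 hr
  · intro h0
    rw [h0, mul_zero] at key
    set F : Fin 2 → ℝ := fun J => pd baseBasis 0 (fun z => A z J 1) y
      - pd baseBasis 1 (fun z => A z J 0) y with hF
    have h2 : r⁻¹ *ᵥ F = 0 := by
      ext I
      have h3 : ∑ I, (p.det * ∑ J, r⁻¹ I J * F J) ^ 2 = 0 := by linarith
      rw [Finset.sum_eq_zero_iff_of_nonneg fun _ _ => sq_nonneg _] at h3
      have h4 := pow_eq_zero_iff (two_ne_zero) |>.1 (h3 I (Finset.mem_univ I))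
      exact (mul_eq_zero.1 h4).resolve_left hp.ne'
    have h5 : F = 0 := by
      have := congrArg r.mulVec h2
      rwa [Matrix.mulVec_mulVec, Matrix.mul_nonsing_inv r hru, Matrix.one_mulVec,
        Matrix.mulVec_zero] at this
    intro I
    exact sub_eq_zero.1 (congrFun h5 I)

/-- As `r` is upper triangular with positive diagonal, normalization multiplies both `x` and `s` by
`r 1 1 / r 0 0` and only adds a constant to `x`. Harmonicity and the Cauchy–Riemann sign `σ` are
therefore unaffected. -/
theorem harmonic_conformal
    (hF : ∀ I, pd baseBasis 0 (fun z => A z I 1) y = pd baseBasis 1 (fun z => A z I 0) y)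
    {c : ℝ} (hdet : ∀ᶠ r in 𝓝 y, (G r).det = c) :
    laplacian baseBasis g (fun r => G r 0 1 / G r 0 0) y = 0 ∧
    laplacian baseBasis g (fun r => √(G r).det / G r 0 0) y = 0 ∧
    ∃ σ : ℝ, (σ = 1 ∨ σ = -1) ∧ ∀ a,
      pd baseBasis a (fun r => √(G r).det / G r 0 0) y
        + σ * ∑ b, pd baseBasis b (fun r => G r 0 1 / G r 0 0) y * rotation (g y) b a = 0 := by
  obtain ⟨p, p10, p00, p11, hp1⟩ := exists_upperTriangular hgp
  obtain ⟨r, r10, r00, r11, hr1⟩ := exists_upperTriangular hGp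
  have hp := isUnit_det_upperTriangular p10 p00 p11
  have hr := isUnit_det_upperTriangular r10 r00 r11
  have hpu : IsUnit p.det := isUnit_iff_ne_zero.2 hp.ne'
  have hru : IsUnit r.det := isUnit_iff_ne_zero.2 hr.ne'
  have hR' := ricci_bundle_change (A0 := A y) hg hG hA hpu hru hgp.det_pos.ne' hGp.det_pos.ne' hR
  have hA' : ∀ i j, ContDiffAt ℝ ∞ (fun z => (r⁻¹ * ((A z - A y) * p)) i j) y := fun i j => by
    simp only [← Matrix.mul_assoc]
    exact contDiffAt_congruence (M := fun z => A z - A y)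
      (fun i j => (hA i j).sub contDiffAt_const) _ _ i j
  have hF' : ∀ I, pd (planeBasis p) 0 (fun z => (r⁻¹ * ((A z - A y) * p)) I 1) y =
      pd (planeBasis p) 1 (fun z => (r⁻¹ * ((A z - A y) * p)) I 0) y := by
    intro I
    rw [← sub_eq_zero, curvature_change hA]
    simp [hF]
  have hdet1 : ∀ z, (rᵀ * G z * r).det = r.det ^ 2 * (G z).det := fun z => by
    rw [Matrix.det_mul, Matrix.det_mul, Matrix.det_transpose]; ring
  have hdet' : ∀ᶠ z in 𝓝 y, (rᵀ * G z * r).det = 1 := by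
    have h0 : (rᵀ * G y * r).det = 1 := by rw [hr1, Matrix.det_one]
    filter_upwards [hdet] with z hz
    rw [← h0, hdet1, hdet1, hz, hdet.self_of_nhds]
  obtain ⟨k1, k2, σ, hσ, k3, k4⟩ := harmonic_conformal_of_eq_one (e := planeBasis p) (x := x)
    (contDiffAt_congruence hg _ _) (contDiffAt_congruence hG _ _)
    hA' hr1 (by simp) hp1 bundleBasis_inr bundleBasis_inl (fun z => symm_congruence (hgs z))
    (hGs.mono fun z hz => symm_congruence hz) hR' hF' hdet'
  have hG0 : G y 0 0 ≠ 0 := hGp.diag_pos.ne'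
  have h00e : ∀ᶠ r in 𝓝 y, G r 0 0 ≠ 0 := (hG 0 0).continuousAt.eventually_ne hG0
  have hX : ContDiffAt ℝ ∞ (fun r => G r 0 1 / G r 0 0) y := (hG 0 1).div (hG 0 0) hG0
  have hS : ContDiffAt ℝ ∞ (fun r => √(G r).det / G r 0 0) y :=
    ((contDiffAt_det hG).sqrt hGp.det_pos.ne').div (hG 0 0) hG0
  have e00 : ∀ z, (rᵀ * G z * r) 0 0 = r 0 0 ^ 2 * G z 0 0 := fun z => by
    simp [Matrix.mul_apply, Fin.sum_univ_two, r10]; ring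
  have e01 : ∀ z, (rᵀ * G z * r) 0 1 = r 0 0 * (r 0 1 * G z 0 0 + r 1 1 * G z 0 1) := fun z => by
    simp [Matrix.mul_apply, Fin.sum_univ_two, r10]; ring
  have hXe : (fun z => (rᵀ * G z * r) 0 1 / (rᵀ * G z * r) 0 0) =ᶠ[𝓝 y]
      fun z => r 1 1 / r 0 0 * (G z 0 1 / G z 0 0) + r 0 1 / r 0 0 := by
    filter_upwards [h00e] with z hz
    rw [e00, e01]; field_simp; ring
  have hSe : (fun z => √(rᵀ * G z * r).det / (rᵀ * G z * r) 0 0) =ᶠ[𝓝 y]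
      fun z => r 1 1 / r 0 0 * (√(G z).det / G z 0 0) + 0 := by
    filter_upwards [h00e] with z hz
    rw [e00, hdet1, Real.sqrt_mul (sq_nonneg _), Real.sqrt_sq hr.le, Matrix.det_fin_two r, r10]
    field_simp; ring
  have hlam : r 1 1 / r 0 0 ≠ 0 := (div_pos r11 r00).ne'
  rw [laplacian_congr hXe, laplacian_affine hX,
    laplacian_change (e := baseBasis) (e' := planeBasis p) (fun _ => rfl) hpu (fun i j => (hg i j).dAt) hX] at k1
  rw [laplacian_congr hSe, laplacian_affine hS,
    laplacian_change (e := baseBasis) (e' := planeBasis p) (fun _ => rfl) hpu (fun i j => (hg i j).dAt) hS] at k2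
  refine ⟨(mul_eq_zero.1 k1).resolve_left hlam, (mul_eq_zero.1 k2).resolve_left hlam, σ, hσ, ?_⟩
  rw [pd_congr _ hXe, pd_congr _ hSe, pd_affine hX.dAt, pd_affine hS.dAt,
    pd_change (e := baseBasis) (e' := planeBasis p) (fun _ => rfl),
    pd_change (e := baseBasis) (e' := planeBasis p) (fun _ => rfl)] at k3 k4
  -- Because `pᵀ * g y * p = 1` and `p.det > 0`, the matrix `p` conjugates the standard quarter turn
  -- into `rotation (g y)`. The equations `k3` and `k4` in the basis `planeBasis p` are then solved
  -- for the coordinate basis by back substitution.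
  have hrot := mul_rotation_congruence (g y) p
  rw [hp1, rotation_one, abs_of_pos hp, div_self hp.ne', one_smul] at hrot
  have hj := fun i j => congrFun (congrFun hrot i) j
  have j00 := hj 0 0
  have j01 := hj 0 1
  have j10 := hj 1 0
  have j11 := hj 1 1
  simp [Matrix.mul_apply, Fin.sum_univ_two, p10] at j00 j01 j10 j11
  simp only [Fin.sum_univ_two, p10] at k3 k4
  set X0 := pd baseBasis 0 (fun r => G r 0 1 / G r 0 0) y
  set X1 := pd baseBasis 1 (fun r => G r 0 1 / G r 0 0) y
  set S0 := pd baseBasis 0 (fun r => √(G r).det / G r 0 0) y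
  set S1 := pd baseBasis 1 (fun r => √(G r).det / G r 0 0) y
  have m3 : p 0 0 * S0 + σ * (p 0 1 * X0 + p 1 1 * X1) = 0 := by
    have : r 1 1 / r 0 0 * (p 0 0 * S0 + σ * (p 0 1 * X0 + p 1 1 * X1)) = 0 := by
      linear_combination k3
    exact (mul_eq_zero.1 this).resolve_left hlam
  have m4 : p 0 1 * S0 + p 1 1 * S1 - σ * (p 0 0 * X0) = 0 := by
    have : r 1 1 / r 0 0 * (p 0 1 * S0 + p 1 1 * S1 - σ * (p 0 0 * X0)) = 0 := by
      linear_combination k4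
    exact (mul_eq_zero.1 this).resolve_left hlam
  have n0 : S0 + σ * (X0 * rotation (g y) 0 0 + X1 * rotation (g y) 1 0) = 0 := by
    have : p 0 0 * (S0 + σ * (X0 * rotation (g y) 0 0 + X1 * rotation (g y) 1 0)) = 0 := by
      linear_combination m3 - σ * X0 * j00 - σ * X1 * j10
    exact (mul_eq_zero.1 this).resolve_left p00.ne'
  have n1 : S1 + σ * (X0 * rotation (g y) 0 1 + X1 * rotation (g y) 1 1) = 0 := by
    have : p 1 1 * (S1 + σ * (X0 * rotation (g y) 0 1 + X1 * rotation (g y) 1 1)) = 0 := by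
      linear_combination m4 - σ * X0 * j01 - σ * X1 * j11 - p 0 1 * n0
    exact (mul_eq_zero.1 this).resolve_left p11.ne'
  intro a
  fin_cases a
  · simpa [Fin.sum_univ_two] using n0
  · simpa [Fin.sum_univ_two] using n1

end RicciFlat

end CoordGeom

namespace CoordGeom

/-! ### Maximum principle and Hopf barrier for a planar elliptic operator. -/

section Elliptic

/-- The elliptic operator `u₁₁ - 2 h u₀₁ + (h² + n²) u₀₀ + α u₀ + β u₁` in the plane. -/
noncomputable def ellipticOp (n h α β : E2 → ℝ) (u : E2 → ℝ) (y : E2) : ℝ :=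
  pd baseBasis 1 (pd baseBasis 1 u) y - 2 * h y * pd baseBasis 0 (pd baseBasis 1 u) y
    + (h y ^ 2 + n y ^ 2) * pd baseBasis 0 (pd baseBasis 0 u) y
    + α y * pd baseBasis 0 u y + β y * pd baseBasis 1 u y

variable {n h α β κ u v L : E2 → ℝ} {y : E2}

/-- If the second derivative were positive, the point would also be a local minimum; the function
would be locally constant and its second derivative zero. -/
theorem deriv_deriv_nonpos_of_isLocalMax {f : ℝ → ℝ} (hf : ContinuousAt f 0)
    (hmax : IsLocalMax f 0) : deriv (deriv f) 0 ≤ 0 := by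
  by_contra! hpos
  have h0 : deriv f 0 = 0 := hmax.deriv_eq_zero
  have hmin : IsLocalMin f 0 := isLocalMin_of_deriv_deriv_pos hpos h0 hf
  have hc : f =ᶠ[𝓝 0] fun _ => f 0 := by
    filter_upwards [hmin, hmax] with t h1 h2 using le_antisymm h2 h1
  have hd : deriv f =ᶠ[𝓝 0] fun _ => 0 := by
    filter_upwards [hc.eventuallyEq_nhds] with t ht
    rw [ht.deriv_eq]; simp
  rw [hd.deriv_eq] at hpos
  simp at hpos

theorem fderiv_fderiv_nonpos_of_isLocalMax (hu : ContDiffAt ℝ ∞ u y) (hmax : IsLocalMax u y)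
    (d : E2) : fderiv ℝ (fderiv ℝ u) y d d ≤ 0 := by
  have hline : ∀ t : ℝ, HasDerivAt (fun t : ℝ => y + t • d) d t := fun t => by
    simpa using ((hasDerivAt_id t).smul_const d).const_add y
  have hc : Filter.Tendsto (fun t : ℝ => y + t • d) (𝓝 0) (𝓝 y) := by
    have : ContinuousAt (fun t : ℝ => y + t • d) 0 := (hline 0).continuousAt
    simpa [ContinuousAt] using this
  have h1 : deriv (fun t : ℝ => u (y + t • d)) =ᶠ[𝓝 0] fun t => fderiv ℝ u (y + t • d) d := by
    filter_upwards [hc.eventually (eventually_differentiableAt hu)] with t ht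
    exact (ht.hasFDerivAt.comp_hasDerivAt t (hline t)).deriv
  have hfd : DifferentiableAt ℝ (fderiv ℝ u) y :=
    (hu.fderiv_right (m := ∞) (by simp)).differentiableAt (by simp)
  have h2 : deriv (deriv fun t : ℝ => u (y + t • d)) 0 = fderiv ℝ (fderiv ℝ u) y d d := by
    rw [h1.deriv_eq]
    have hψ : DifferentiableAt ℝ (fun r => fderiv ℝ u r d) y :=
      hfd.clm_apply (differentiableAt_const d)
    have hψ1 : fderiv ℝ (fun r => fderiv ℝ u r d) y d = fderiv ℝ (fderiv ℝ u) y d d := by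
      rw [fderiv_clm_apply hfd (differentiableAt_const _)]
      simp
    have hψ2 : HasFDerivAt (fun r => fderiv ℝ u r d) (fderiv ℝ (fun r => fderiv ℝ u r d) y)
        (y + (0 : ℝ) • d) := by
      rw [zero_smul, add_zero]; exact hψ.hasFDerivAt
    rw [← hψ1]
    exact (hψ2.comp_hasDerivAt (0 : ℝ) (hline 0)).deriv
  rw [← h2]
  refine deriv_deriv_nonpos_of_isLocalMax ?_ ?_
  · have : ContinuousAt u (y + (0 : ℝ) • d) := by simpa using hu.continuousAt
    exact ContinuousAt.comp this (hline 0).continuousAt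
  · have := hc.eventually hmax
    simpa [IsLocalMax, IsMaxFilter] using this

theorem ellipticOp_nonpos_of_isLocalMax (hu : ContDiffAt ℝ ∞ u y) (hmax : IsLocalMax u y) :
    ellipticOp n h α β u y ≤ 0 := by
  have hfd : DifferentiableAt ℝ (fderiv ℝ u) y :=
    (hu.fderiv_right (m := ∞) (by simp)).differentiableAt (by simp)
  have key : ∀ a b : Fin 2, pd baseBasis a (pd baseBasis b u) y
      = fderiv ℝ (fderiv ℝ u) y (baseBasis a) (baseBasis b) := by
    intro a b
    have : pd baseBasis b u = fun r => fderiv ℝ u r (baseBasis b) := rfl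
    rw [this]
    simp only [pd]
    rw [fderiv_clm_apply hfd (differentiableAt_const _)]
    simp
  have h0 : ∀ a, pd baseBasis a u y = 0 := fun a => by
    simp [pd, hmax.fderiv_eq_zero]
  have hs : pd baseBasis 1 (pd baseBasis 0 u) y = pd baseBasis 0 (pd baseBasis 1 u) y :=
    pd_comm 1 0 hu
  have h1 := fderiv_fderiv_nonpos_of_isLocalMax hu hmax (baseBasis 0)
  -- The principal part is the second derivative along `e₁ - h e₀` plus `n²` times the second
  -- derivative along `e₀`, with the coefficients frozen at `y`.
  have h2 := fderiv_fderiv_nonpos_of_isLocalMax hu hmax (baseBasis 1 - h y • baseBasis 0)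
  simp only [map_sub, map_smul, _root_.sub_apply, _root_.smul_apply,
    smul_eq_mul] at h2
  simp only [← key] at h1 h2
  rw [hs] at h2
  simp only [ellipticOp, h0]
  nlinarith [mul_nonneg (sq_nonneg (n y)) (neg_nonneg.2 h1)]

theorem pd_coord (i j : Fin 2) : pd baseBasis i (fun r : E2 => r j) y = if i = j then 1 else 0 := by
  have : (fun r : E2 => r j) = EuclideanSpace.proj (𝕜 := ℝ) j := rfl
  simp only [pd, this, ContinuousLinearMap.fderiv]
  simp [baseBasis, eq_comm]

/-- The Gaussian `exp (-A |r - p|²)`. -/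
noncomputable def gauss (A : ℝ) (p : E2) (r : E2) : ℝ :=
  Real.exp (-A * ((r 0 - p 0) ^ 2 + (r 1 - p 1) ^ 2))

theorem contDiff_coord (i : Fin 2) : ContDiff ℝ ∞ (fun r : E2 => r i) :=
  (EuclideanSpace.proj (𝕜 := ℝ) i).contDiff

theorem contDiff_gauss (A : ℝ) (p : E2) : ContDiff ℝ ∞ (gauss A p) :=
  (contDiff_const.mul ((((contDiff_coord 0).sub contDiff_const).pow 2).add
    (((contDiff_coord 1).sub contDiff_const).pow 2))).exp

theorem pd_gauss (A : ℝ) (p : E2) (i : Fin 2) :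
    pd baseBasis i (gauss A p) = fun r => (-2 * A) * ((r i - p i) * gauss A p r) := by
  ext r
  have hc : ∀ j, DifferentiableAt ℝ (fun r : E2 => r j - p j) r := fun j =>
    ((contDiff_coord j).sub contDiff_const).contDiffAt.dAt
  have h1 : ∀ j, pd baseBasis i (fun r : E2 => r j - p j) r = if i = j then 1 else 0 := by
    intro j
    rw [pd_sub _ (contDiff_coord j).contDiffAt.dAt (differentiableAt_const _), pd_coord, pd_const,
      sub_zero]
  have h2 : (fun r : E2 => (r 0 - p 0) ^ 2 + (r 1 - p 1) ^ 2) =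
      fun r => (r 0 - p 0) * (r 0 - p 0) + (r 1 - p 1) * (r 1 - p 1) := by ext; ring
  have hd : DifferentiableAt ℝ (fun r : E2 => (r 0 - p 0) ^ 2 + (r 1 - p 1) ^ 2) r := by
    rw [h2]; exact ((hc 0).fun_mul (hc 0)).fun_add ((hc 1).fun_mul (hc 1))
  have h3 : gauss A p = fun r => Real.exp (-A * ((r 0 - p 0) ^ 2 + (r 1 - p 1) ^ 2)) := rfl
  rw [h3, pd_comp i Real.differentiableAt_exp (hd.const_mul _), pd_const_mul _ _ hd, Real.deriv_exp,
    h2, pd_add _ ((hc 0).fun_mul (hc 0)) ((hc 1).fun_mul (hc 1)), pd_mul _ (hc 0) (hc 0),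
    pd_mul _ (hc 1) (hc 1), h1, h1]
  fin_cases i <;> simp <;> ring_nf

/-- The bracket grows linearly in `A` wherever the symbol is positive on `y - p`. So for large `A`
the Gaussian is a strict subsolution away from its centre, as a barrier requires. -/
theorem ellipticOp_gauss (A : ℝ) (p : E2) :
    ellipticOp n h α β (gauss A p) y = 2 * A * gauss A p y *
      (2 * A * (((y 1 - p 1) - h y * (y 0 - p 0)) ^ 2 + n y ^ 2 * (y 0 - p 0) ^ 2)
        - (1 + h y ^ 2 + n y ^ 2 + α y * (y 0 - p 0) + β y * (y 1 - p 1))) := by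
  have hc : ∀ j, DifferentiableAt ℝ (fun r : E2 => r j - p j) y := fun j =>
    ((contDiff_coord j).sub contDiff_const).contDiffAt.dAt
  have h1 : ∀ i j, pd baseBasis i (fun r : E2 => r j - p j) y = if i = j then 1 else 0 := by
    intro i j
    rw [pd_sub _ (contDiff_coord j).contDiffAt.dAt (differentiableAt_const _), pd_coord, pd_const,
      sub_zero]
  have hg := (contDiff_gauss A p).contDiffAt (x := y) |>.dAt
  have h2 : ∀ i j, pd baseBasis i (fun r => (-2 * A) * ((r j - p j) * gauss A p r)) y =
      (-2 * A) * ((if i = j then 1 else 0) * gauss A p y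
        + (y j - p j) * ((-2 * A) * ((y i - p i) * gauss A p y))) := by
    intro i j
    rw [pd_const_mul _ _ ((hc j).fun_mul hg), pd_mul _ (hc j) hg, h1, pd_gauss]
  simp only [ellipticOp, pd_gauss, h2]
  simp
  ring

end Elliptic

end CoordGeom

namespace CoordGeom

section Barrier

variable {n h α β κ u v L : E2 → ℝ} {y : E2}

theorem ellipticOp_add_const_mul (hu : ContDiffAt ℝ ∞ u y) (hv : ContDiffAt ℝ ∞ v y) (N : ℝ) :
    ellipticOp n h α β (fun r => u r + N * v r) y =
      ellipticOp n h α β u y + N * ellipticOp n h α β v y := by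
  have hNv : ContDiffAt ℝ ∞ (fun r => N * v r) y := contDiffAt_const.mul hv
  have h1 : ∀ i, pd baseBasis i (fun r => u r + N * v r) =ᶠ[𝓝 y]
      fun r => pd baseBasis i u r + N * pd baseBasis i v r := by
    intro i
    filter_upwards [eventually_differentiableAt hu, eventually_differentiableAt hv] with r h h'
    rw [pd_add i h (h'.const_mul N), pd_const_mul i N h']
  have h2 : ∀ i j, pd baseBasis i (pd baseBasis j (fun r => u r + N * v r)) y =
      pd baseBasis i (pd baseBasis j u) y + N * pd baseBasis i (pd baseBasis j v) y := by
    intro i j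
    rw [pd_congr i (h1 j), pd_add i (hu.pd j).dAt ((hv.pd j).dAt.const_mul N),
      pd_const_mul i N (hv.pd j).dAt]
  simp only [ellipticOp, h2, (h1 _).self_of_nhds]
  ring

/-- The principal symbol of `ellipticOp`, applied to the differential of `u`. -/
noncomputable def symbolSq (n h : E2 → ℝ) (u : E2 → ℝ) (y : E2) : ℝ :=
  pd baseBasis 1 u y ^ 2 - 2 * h y * (pd baseBasis 0 u y * pd baseBasis 1 u y)
    + (h y ^ 2 + n y ^ 2) * pd baseBasis 0 u y ^ 2

theorem ellipticOp_log (hL : ContDiffAt ℝ ∞ L y) {ε : ℝ} (h0 : 0 < L y + ε) :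
    ellipticOp n h α β (fun r => Real.log (L r + ε)) y =
      ellipticOp n h α β L y / (L y + ε) - symbolSq n h L y / (L y + ε) ^ 2 := by
  have hLe : ContDiffAt ℝ ∞ (fun r => L r + ε) y := hL.add contDiffAt_const
  have hev : ∀ᶠ r in 𝓝 y, L r + ε ≠ 0 := hLe.continuousAt.eventually_ne h0.ne'
  have hi : ContDiffAt ℝ ∞ (fun r => (L r + ε)⁻¹) y := hLe.inv h0.ne'
  have e0 : ∀ i r, DifferentiableAt ℝ L r → pd baseBasis i (fun r => L r + ε) r
      = pd baseBasis i L r := fun i r hr => by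
    rw [pd_add i hr (differentiableAt_const _), pd_const, add_zero]
  have h1 : ∀ i, pd baseBasis i (fun r => Real.log (L r + ε)) =ᶠ[𝓝 y]
      fun r => pd baseBasis i L r * (L r + ε)⁻¹ := by
    intro i
    filter_upwards [hev, eventually_differentiableAt hL] with r hr hr'
    rw [pd_comp (h := Real.log) (f := fun r => L r + ε) i (Real.differentiableAt_log hr) (hr'.add_const ε), Real.deriv_log, e0 i r hr',
      mul_comm]
  have h2 : ∀ i j, pd baseBasis i (pd baseBasis j (fun r => Real.log (L r + ε))) y =
      pd baseBasis i (pd baseBasis j L) y * (L y + ε)⁻¹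
        - pd baseBasis j L y * pd baseBasis i L y / (L y + ε) ^ 2 := by
    intro i j
    rw [pd_congr i (h1 j), pd_mul i (hL.pd j).dAt hi.dAt, pd_inv i hLe.dAt h0.ne', e0 i y hL.dAt]
    ring
  simp only [ellipticOp, symbolSq, h2, (h1 _).self_of_nhds]
  ring

theorem symbolSq_nonneg : 0 ≤ symbolSq n h u y := by
  have : symbolSq n h u y = (pd baseBasis 1 u y - h y * pd baseBasis 0 u y) ^ 2
      + (n y * pd baseBasis 0 u y) ^ 2 := by simp only [symbolSq]; ring
  rw [this]; positivity

/-- Approximate logarithmic subharmonicity. -/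
theorem neg_abs_le_ellipticOp_log (hL : ContDiffAt ℝ ∞ L y) (hpos : ∀ᶠ r in 𝓝 y, 0 ≤ L r)
    (hid : L y * ellipticOp n h α β L y - symbolSq n h L y = κ y * L y ^ 2) {ε : ℝ} (hε : 0 < ε) :
    -|κ y| ≤ ellipticOp n h α β (fun r => Real.log (L r + ε)) y := by
  have hLy : 0 ≤ L y := hpos.self_of_nhds
  have h0 : 0 < L y + ε := by linarith
  rw [ellipticOp_log hL h0]
  have hq : 0 ≤ symbolSq n h L y := symbolSq_nonneg
  rcases hLy.eq_or_lt with hy0 | hy0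
  · have hmin : IsLocalMax (fun r => 0 + (-1) * L r) y := by
      filter_upwards [hpos] with r hr
      rw [← hy0]; linarith
    have hn := ellipticOp_nonpos_of_isLocalMax (n := n) (h := h) (α := α) (β := β)
      (contDiffAt_const.add (contDiffAt_const.mul hL)) hmin
    have hmin' : IsLocalMin L y := by
      filter_upwards [hpos] with r hr
      rw [← hy0]; exact hr
    have hz : symbolSq n h L y = 0 := by
      simp [symbolSq, pd, hmin'.fderiv_eq_zero]
    rw [ellipticOp_add_const_mul contDiffAt_const hL] at hn
    have h3 : ellipticOp n h α β (fun _ => (0 : ℝ)) y = 0 := by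
      have : ∀ i, pd baseBasis i (fun _ : E2 => (0 : ℝ)) = fun _ => 0 :=
        fun i => funext fun r => pd_const i 0
      simp [ellipticOp, this]
    rw [h3] at hn
    rw [hz, zero_div, sub_zero]
    have : 0 ≤ ellipticOp n h α β L y / (L y + ε) := div_nonneg (by linarith) h0.le
    linarith [abs_nonneg (κ y)]
  -- Where `L > 0`, the identity `hid` together with `q ≥ 0` gives `T ≥ κ L`. Eliminating `q` leaves
  -- `(ε T + κ L²) / (L + ε)²`, which is at least `κ L / (L + ε)`.
  · set T := ellipticOp n h α β L y
    set q := symbolSq n h L y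
    have hT : κ y * L y ≤ T := by
      have : κ y * L y * L y ≤ T * L y := by nlinarith
      exact le_of_mul_le_mul_right this hy0
    have e1 : T / (L y + ε) - q / (L y + ε) ^ 2 = (ε * T + κ y * L y ^ 2) / (L y + ε) ^ 2 := by
      rw [show q = L y * T - κ y * L y ^ 2 by linarith]
      field_simp
      ring
    rw [e1, le_div_iff₀ (by positivity)]
    have e2 : ε * (κ y * L y) ≤ ε * T := mul_le_mul_of_nonneg_left hT hε.le
    have e3 : -|κ y| ≤ κ y := neg_abs_le _
    have e4 : -|κ y| * (L y * (L y + ε)) ≤ κ y * (L y * (L y + ε)) :=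
      mul_le_mul_of_nonneg_right e3 (by positivity)
    have e5 : 0 ≤ |κ y| * (ε * (L y + ε)) := by positivity
    nlinarith

theorem gauss_eq (A : ℝ) (p y : E2) : gauss A p y = Real.exp (-A * dist y p ^ 2) := by
  rw [gauss, EuclideanSpace.dist_eq, Real.sq_sqrt (by positivity), Fin.sum_univ_two, Real.dist_eq,
    Real.dist_eq, sq_abs, sq_abs]

/-- Propagation of zeros to a larger concentric disc, by means of Hopf's barrier. -/
theorem eq_zero_of_eq_zero_on_ball {p : E2} {r R : ℝ} (hr : 0 < r)
    (hn : ContinuousOn n (Metric.closedBall p R)) (hh : ContinuousOn h (Metric.closedBall p R))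
    (hα : ContinuousOn α (Metric.closedBall p R)) (hβ : ContinuousOn β (Metric.closedBall p R))
    (hκ : ContinuousOn κ (Metric.closedBall p R)) (hn0 : ∀ y ∈ Metric.closedBall p R, n y ≠ 0)
    (hL : ∀ y ∈ Metric.closedBall p R, ContDiffAt ℝ ∞ L y) (hpos : ∀ y, 0 ≤ L y)
    (hid : ∀ y ∈ Metric.closedBall p R,
      L y * ellipticOp n h α β L y - symbolSq n h L y = κ y * L y ^ 2)
    (h0 : ∀ y ∈ Metric.ball p r, L y = 0) {z : E2} (hz : z ∈ Metric.ball p R) : L z = 0 := by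
  by_contra hLz
  have hLz' : 0 < L z := lt_of_le_of_ne (hpos z) (Ne.symm hLz)
  have hzr : r ≤ dist z p := by
    by_contra! hlt; exact hLz (h0 z hlt)
  have hzR : dist z p < R := hz
  have hrR : r < R := hzr.trans_lt hzR
  have hcb : Metric.closedBall p r ⊆ Metric.closedBall p R := Metric.closedBall_subset_closedBall hrR.le
  have h0' : ∀ y, dist y p = r → L y = 0 := by
    intro y hy
    have hyc : y ∈ closure (Metric.ball p r) := by
      rw [closure_ball p hr.ne']; exact hy.le
    have hcl : IsClosed ({0} : Set ℝ) := isClosed_singleton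
    have : ContinuousWithinAt L (Metric.ball p r) y :=
      (hL y (hcb hy.le)).continuousAt.continuousWithinAt
    have := this.mem_closure hyc (t := {0}) (fun w hw => h0 w hw)
    simpa using this
  set K : Set E2 := Metric.closedBall p R \ Metric.ball p r with hK
  have hKc : IsCompact K := (isCompact_closedBall p R).diff Metric.isOpen_ball
  have hKs : K ⊆ Metric.closedBall p R := sdiff_subset
  have hzK : z ∈ K := ⟨hzR.le, fun hlt => absurd (show dist z p < r from hlt) (not_lt.2 hzr)⟩
  have hco : ∀ i, ContinuousOn (fun y : E2 => y i - p i) K := fun i =>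
    ((contDiff_coord i).continuous.sub continuous_const).continuousOn
  -- `Q` is the symbol applied to `y - p` and `E` collects the other terms in `ellipticOp_gauss`; on
  -- the annulus `K` the first is bounded below by a positive constant and the second is bounded.
  let Q : E2 → ℝ := fun y =>
    ((y 1 - p 1) - h y * (y 0 - p 0)) ^ 2 + n y ^ 2 * (y 0 - p 0) ^ 2
  let E : E2 → ℝ := fun y =>
    1 + h y ^ 2 + n y ^ 2 + α y * (y 0 - p 0) + β y * (y 1 - p 1)
  have hQc : ContinuousOn Q K :=
    (((hco 1).sub ((hh.mono hKs).mul (hco 0))).pow 2).add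
      (((hn.mono hKs).pow 2).mul ((hco 0).pow 2))
  have hEc : ContinuousOn E K :=
    (((continuousOn_const.add ((hh.mono hKs).pow 2)).add ((hn.mono hKs).pow 2)).add
      ((hα.mono hKs).mul (hco 0))).add ((hβ.mono hKs).mul (hco 1))
  have hQpos : ∀ y ∈ K, 0 < Q y := by
    intro y hy
    by_cases h00 : y 0 - p 0 = 0
    · have h11 : y 1 - p 1 ≠ 0 := by
        intro h11
        have : y = p := by
          ext i; fin_cases i
          · exact sub_eq_zero.1 h00
          · exact sub_eq_zero.1 h11
        exact hy.2 (by rw [this]; exact Metric.mem_ball_self hr)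
      simp only [Q, h00]
      simp only [mul_zero, sub_zero, ne_eq, OfNat.ofNat_ne_zero, not_false_eq_true, zero_pow,
        add_zero]
      positivity
    · have := hn0 y (hKs hy)
      simp only [Q]
      positivity
  obtain ⟨K0, hK0⟩ := hKc.exists_bound_of_continuousOn (hκ.mono hKs)
  obtain ⟨C, hC⟩ := hKc.exists_bound_of_continuousOn hEc
  obtain ⟨C', hC'⟩ := hKc.exists_bound_of_continuousOn
    (hQc.inv₀ fun y hy => (hQpos y hy).ne')
  obtain ⟨Lm, hLm⟩ := hKc.exists_bound_of_continuousOn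
    (fun y hy => (hL y (hKs hy)).continuousAt.continuousWithinAt)
  have hC0 : 0 ≤ C := (norm_nonneg _).trans (hC z hzK)
  have hK00 : 0 ≤ K0 := (norm_nonneg _).trans (hK0 z hzK)
  have hLm0 : 0 ≤ Lm := (norm_nonneg _).trans (hLm z hzK)
  have hC'0 : 0 < C' := (norm_pos_iff.2 (inv_ne_zero (hQpos z hzK).ne')).trans_le (hC' z hzK)
  -- With this value `2 A Q = (C + 1) (C' Q) ≥ C + 1 ≥ E + 1`, so the bracket of `ellipticOp_gauss`
  -- is at least one on the annulus.
  set A : ℝ := C' * (C + 1) / 2 with hA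
  have hA0 : 0 < A := by positivity
  set wR := Real.exp (-A * R ^ 2) with hwR
  set wr := Real.exp (-A * r ^ 2) with hwr
  have hwlt : wR < wr := Real.exp_lt_exp.2 (by nlinarith [mul_pos hA0 (sub_pos.2 hrR)])
  have hwR0 : 0 < wR := Real.exp_pos _
  set δ := 2 * A * wR with hδ
  have hδ0 : 0 < δ := by positivity
  have hTg : ∀ y ∈ K, δ ≤ ellipticOp n h α β (gauss A p) y := by
    intro y hy
    have hq := hQpos y hy
    have h1 : 1 ≤ C' * Q y := by
      have : ‖(Q y)⁻¹‖ ≤ C' := hC' y hy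
      rw [Real.norm_eq_abs, abs_of_pos (inv_pos.2 hq)] at this
      rw [inv_le_iff_one_le_mul₀ hq] at this
      exact this
    have h2 : E y ≤ C := (le_abs_self _).trans (hC y hy)
    have h3 : 1 ≤ 2 * A * Q y - E y := by
      have : 2 * A * Q y = (C + 1) * (C' * Q y) := by rw [hA]; ring
      nlinarith
    have h4 : wR ≤ gauss A p y := by
      rw [gauss_eq]
      refine Real.exp_le_exp.2 ?_
      have hd : dist y p ≤ R := hKs hy
      have : dist y p ^ 2 ≤ R ^ 2 := pow_le_pow_left₀ dist_nonneg hd 2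
      nlinarith
    rw [ellipticOp_gauss]
    change δ ≤ 2 * A * gauss A p y * (2 * A * Q y - E y)
    have h5 : δ ≤ 2 * A * gauss A p y := by rw [hδ]; nlinarith
    nlinarith
  set wz := gauss A p z with hwz
  have hwz' : wR < wz := by
    rw [hwz, gauss_eq]
    refine Real.exp_lt_exp.2 ?_
    have : dist z p ^ 2 < R ^ 2 := pow_lt_pow_left₀ hzR dist_nonneg two_ne_zero
    nlinarith
  set C1 := Real.log (Lm + 1) with hC1
  set t := (wz - wR) / (wr - wR) with ht
  have ht0 : 0 < t := div_pos (sub_pos.2 hwz') (sub_pos.2 hwlt)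
  -- `S` is the depth of the logarithm on the inner circle, where `ε = exp (C1 - S)`. The first
  -- bound gives `ε ≤ 1`; the second makes `N δ` exceed the bound `K0` for `κ`; the third
  -- contradicts `log (L z) ≤ C1 - S t`. The slope `N = S / (wr - wR)` is chosen so that the two
  -- boundary estimates coincide.
  obtain ⟨S, hS1, hS2, hS3, hS4⟩ : ∃ S : ℝ, C1 ≤ S ∧ K0 * (wr - wR) / δ < S ∧
      (C1 - Real.log (L z)) / t < S ∧ 0 ≤ S := by
    refine ⟨max (max C1 0) (max (K0 * (wr - wR) / δ) ((C1 - Real.log (L z)) / t)) + 1, ?_, ?_, ?_, ?_⟩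
    · linarith [le_max_left (max C1 0) (max (K0 * (wr - wR) / δ) ((C1 - Real.log (L z)) / t)),
        le_max_left C1 0]
    · linarith [le_max_right (max C1 0) (max (K0 * (wr - wR) / δ) ((C1 - Real.log (L z)) / t)),
        le_max_left (K0 * (wr - wR) / δ) ((C1 - Real.log (L z)) / t)]
    · linarith [le_max_right (max C1 0) (max (K0 * (wr - wR) / δ) ((C1 - Real.log (L z)) / t)),
        le_max_right (K0 * (wr - wR) / δ) ((C1 - Real.log (L z)) / t)]
    · linarith [le_max_left (max C1 0) (max (K0 * (wr - wR) / δ) ((C1 - Real.log (L z)) / t)),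
        le_max_right C1 0]
  set ε := Real.exp (C1 - S) with hε
  have hε0 : 0 < ε := Real.exp_pos _
  have hε1 : ε ≤ 1 := Real.exp_le_one_iff.2 (by linarith)
  set N := S / (wr - wR) with hN
  have hwd : 0 < wr - wR := sub_pos.2 hwlt
  have hN0 : 0 ≤ N := div_nonneg hS4 hwd.le
  have hNd : K0 < N * δ := by
    rw [div_lt_iff₀ hδ0] at hS2
    rw [hN, div_mul_eq_mul_div, lt_div_iff₀ hwd]
    exact hS2
  have hlog : ∀ y ∈ K, ContDiffAt ℝ ∞ (fun y => Real.log (L y + ε)) y := fun y hy =>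
    ((hL y (hKs hy)).add contDiffAt_const).log (by have := hpos y; positivity)
  have hv : ∀ y ∈ K, ContDiffAt ℝ ∞ (fun y => Real.log (L y + ε) + N * gauss A p y) y :=
    fun y hy => (hlog y hy).add (contDiffAt_const.mul (contDiff_gauss A p).contDiffAt)
  obtain ⟨m, hmK, hm⟩ := hKc.exists_isMaxOn ⟨z, hzK⟩
    (fun y hy => (hv y hy).continuousAt.continuousWithinAt)
  -- On the outer circle the bound is the definition of `C1`, and on the inner one `L = 0` and the
  -- choice of `N` gives equality. An interior maximum is impossible, since there the operator would
  -- be both nonpositive and at least `N δ - K0 > 0`.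
  have hmax : Real.log (L m + ε) + N * gauss A p m ≤ C1 + N * wR := by
    have hmR : dist m p ≤ R := hKs hmK
    have hmr : r ≤ dist m p := not_lt.1 fun hlt => hmK.2 hlt
    rcases hmR.eq_or_lt with hR | hR
    · have h1 : L m ≤ Lm := (le_abs_self _).trans (hLm m hmK)
      have h2 : Real.log (L m + ε) ≤ C1 :=
        Real.log_le_log (by have := hpos m; positivity) (by linarith)
      rw [gauss_eq, hR]
      linarith
    · rcases hmr.eq_or_lt with hr' | hr'
      · rw [h0' m hr'.symm, zero_add, hε, Real.log_exp, gauss_eq, ← hr', ← hwr]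
        have : N * (wr - wR) = S := div_mul_cancel₀ _ hwd.ne'
        linarith
      · exfalso
        have hnhds : K ∈ 𝓝 m := by
          refine Filter.mem_of_superset
            ((Metric.isOpen_ball.inter (isOpen_lt continuous_const
              (continuous_id.dist continuous_const))).mem_nhds
              (show m ∈ Metric.ball p R ∩ {y | r < dist (id y) p} from ⟨hR, hr'⟩)) ?_
          rintro y ⟨hy1, hy2⟩
          exact ⟨(show dist y p < R from hy1).le, not_lt.2 (show r < dist y p from hy2).le⟩
        have hT := ellipticOp_nonpos_of_isLocalMax (n := n) (h := h) (α := α) (β := β)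
          (hv m hmK) (hm.isLocalMax hnhds)
        rw [ellipticOp_add_const_mul (hlog m hmK) (contDiff_gauss A p).contDiffAt] at hT
        have h1 := neg_abs_le_ellipticOp_log (κ := κ) (hL m (hKs hmK)) (Filter.Eventually.of_forall hpos)
          (hid m (hKs hmK)) hε0
        have h2 : |κ m| ≤ K0 := hK0 m hmK
        have h3 := mul_le_mul_of_nonneg_left (hTg m hmK) hN0
        linarith
  have hfin : Real.log (L z + ε) + N * wz ≤ C1 + N * wR := (hm hzK).trans hmax
  have h1 : Real.log (L z) ≤ Real.log (L z + ε) := Real.log_le_log hLz' (by linarith)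
  have h2 : N * (wz - wR) = S * t := by rw [hN, ht]; ring
  rw [div_lt_iff₀ ht0] at hS3
  linarith

/-- Weak unique continuation. -/
theorem eq_zero_of_isPreconnected {O W : Set E2} (hO : IsOpen O) (hOc : IsPreconnected O)
    (hn : ContinuousOn n O) (hh : ContinuousOn h O)
    (hα : ContinuousOn α O) (hβ : ContinuousOn β O)
    (hκ : ContinuousOn κ O) (hn0 : ∀ y ∈ O, n y ≠ 0)
    (hL : ∀ y ∈ O, ContDiffAt ℝ ∞ L y) (hpos : ∀ y, 0 ≤ L y)
    (hid : ∀ y ∈ O,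
      L y * ellipticOp n h α β L y - symbolSq n h L y = κ y * L y ^ 2)
    (hW : IsOpen W) (hWn : (O ∩ W).Nonempty) (h0 : ∀ y ∈ W, L y = 0) : ∀ y ∈ O, L y = 0 := by
  set Z := interior {y | L y = 0} with hZ
  have hWZ : W ⊆ Z := interior_maximal h0 hW
  have hsub : O ⊆ Z := by
    refine hOc.subset_of_closure_inter_subset isOpen_interior
      (hWn.mono (inter_subset_inter_right _ hWZ)) ?_
    rintro q ⟨hq, hqO⟩
    obtain ⟨ρ, hρ, hball⟩ := Metric.isOpen_iff.1 hO q hqO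
    -- The disc is centred at a nearby interior zero `p` rather than at the limit point `q`. As `p`
    -- is within `ρ / 3` of `q`, the disc of radius `ρ / 2` about `p` contains `q` and its closure
    -- lies in `O`.
    obtain ⟨p, hpZ, hpq⟩ := Metric.mem_closure_iff.1 hq (ρ / 3) (by positivity)
    obtain ⟨r, hr, hrZ⟩ := Metric.isOpen_iff.1 isOpen_interior p hpZ
    have hcb : Metric.closedBall p (ρ / 2) ⊆ O := by
      refine Subset.trans (fun w hw => ?_) hball
      have h1 : dist w p ≤ ρ / 2 := hw
      have h2 := dist_triangle w p q
      rw [dist_comm p q] at h2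
      exact show dist w q < ρ by linarith
    have key : Metric.ball p (ρ / 2) ⊆ {y | L y = 0} := fun z hz =>
      eq_zero_of_eq_zero_on_ball hr (hn.mono hcb) (hh.mono hcb) (hα.mono hcb) (hβ.mono hcb)
        (hκ.mono hcb) (fun y hy => hn0 y (hcb hy)) (fun y hy => hL y (hcb hy)) hpos
        (fun y hy => hid y (hcb hy)) (fun y hy => interior_subset (s := {y | L y = 0}) (hrZ hy)) hz
    refine interior_maximal key Metric.isOpen_ball ?_
    exact show dist q p < ρ / 2 by linarith
  exact fun y hy => interior_subset (s := {y | L y = 0}) (hsub hy)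

end Barrier

end CoordGeom

namespace CoordGeom

/-! ### Unique continuation for a first order elliptic system. -/

section UniqueContinuation

variable {n h P Q : E2 → ℝ} {y : E2}

/-- The first order coefficients and the potential in the equation for `log (P² + Q²)`. -/
noncomputable def twist (n h : E2 → ℝ) (y : E2) : ℝ :=
  pd baseBasis 1 n y + n y * pd baseBasis 0 h y - h y * pd baseBasis 0 n y

/-- Let `λ = h - i n` and `D = ∂₁ - λ ∂₀`. The composite `D̄ D` has a complex first order term;
adding the real multiple `c D` with `c = -twist / n` makes all coefficients real, and the resulting
first order coefficients are `drift₀` and `drift₁`. -/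
noncomputable def drift₀ (n h : E2 → ℝ) (y : E2) : ℝ :=
  -pd baseBasis 1 h y + n y * pd baseBasis 0 n y + h y * pd baseBasis 0 h y
    + twist n h y * h y / n y

noncomputable def drift₁ (n h : E2 → ℝ) (y : E2) : ℝ := -twist n h y / n y

noncomputable def potential (n h : E2 → ℝ) (y : E2) : ℝ :=
  2 * (pd baseBasis 0 (pd baseBasis 1 h) y - n y * pd baseBasis 0 (pd baseBasis 0 n) y
    - h y * pd baseBasis 0 (pd baseBasis 0 h) y - twist n h y * pd baseBasis 0 h y / n y)

/-- For `w = P + i Q` the system says `∂₁ w = ∂₀ (λ w)` with `λ = h - i n`, that is, `D log w = ∂₀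
λ` where `D = ∂₁ - λ ∂₀`. Applying `D̄ + c` with `c = -twist / n` and taking twice the real part
expresses the operator on `log |w|²` by the coefficients alone. Multiplied by `|w|⁴`, the identity
remains meaningful at zeros of `w`. -/
theorem norm_sq_identity (hn : ContDiffAt ℝ ∞ n y) (hh : ContDiffAt ℝ ∞ h y)
    (hP : ContDiffAt ℝ ∞ P y) (hQ : ContDiffAt ℝ ∞ Q y) (hn0 : n y ≠ 0)
    (e1 : pd baseBasis 1 P =ᶠ[𝓝 y] pd baseBasis 0 fun r => n r * Q r + h r * P r)
    (e2 : pd baseBasis 1 Q =ᶠ[𝓝 y] pd baseBasis 0 fun r => h r * Q r + (-1) * (n r * P r)) :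
    (P y * P y + Q y * Q y) *
      ellipticOp n h (drift₀ n h) (drift₁ n h) (fun r => P r * P r + Q r * Q r) y
      - symbolSq n h (fun r => P r * P r + Q r * Q r) y =
    potential n h y * (P y * P y + Q y * Q y) ^ 2 := by
  have add2 : ∀ (i j : Fin 2) {u v : E2 → ℝ}, ContDiffAt ℝ ∞ u y → ContDiffAt ℝ ∞ v y →
      pd baseBasis i (pd baseBasis j fun r => u r + v r) y =
        pd baseBasis i (pd baseBasis j u) y + pd baseBasis i (pd baseBasis j v) y := by
    intro i j u v hu hv
    have : pd baseBasis j (fun r => u r + v r) =ᶠ[𝓝 y]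
        fun r => pd baseBasis j u r + pd baseBasis j v r := by
      filter_upwards [eventually_differentiableAt hu, eventually_differentiableAt hv] with r a b
      exact pd_add j a b
    rw [pd_congr i this, pd_add i (hu.pd j).dAt (hv.pd j).dAt]
  have neg2 : ∀ (i j : Fin 2) {u : E2 → ℝ}, ContDiffAt ℝ ∞ u y →
      pd baseBasis i (pd baseBasis j fun r => (-1) * u r) y =
        (-1) * pd baseBasis i (pd baseBasis j u) y := by
    intro i j u hu
    have : pd baseBasis j (fun r => (-1) * u r) =ᶠ[𝓝 y] fun r => (-1) * pd baseBasis j u r := by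
      filter_upwards [eventually_differentiableAt hu] with r a
      exact pd_const_mul j _ a
    rw [pd_congr i this, pd_const_mul i _ (hu.pd j).dAt]
  have hnQ := hn.mul hQ
  have hhP := hh.mul hP
  have hhQ := hh.mul hQ
  have hnP := hn.mul hP
  have hnP' : ContDiffAt ℝ ∞ (fun r => (-1) * (n r * P r)) y := contDiffAt_const.mul hnP
  have P1 := e1.self_of_nhds
  have Q1 := e2.self_of_nhds
  rw [pd_add _ hnQ.dAt hhP.dAt, pd_mul _ hn.dAt hQ.dAt, pd_mul _ hh.dAt hP.dAt] at P1
  rw [pd_add _ hhQ.dAt hnP'.dAt, pd_const_mul _ _ hnP.dAt, pd_mul _ hh.dAt hQ.dAt,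
    pd_mul _ hn.dAt hP.dAt] at Q1
  have P1' : ∀ i, pd baseBasis i (pd baseBasis 1 P) y =
      pd baseBasis i (pd baseBasis 0 fun r => n r * Q r) y
        + pd baseBasis i (pd baseBasis 0 fun r => h r * P r) y := fun i => by
    rw [pd_congr i e1, add2 i 0 hnQ hhP]
  have Q1' : ∀ i, pd baseBasis i (pd baseBasis 1 Q) y =
      pd baseBasis i (pd baseBasis 0 fun r => h r * Q r) y
        + (-1) * pd baseBasis i (pd baseBasis 0 fun r => n r * P r) y := fun i => by
    rw [pd_congr i e2, add2 i 0 hhQ hnP', neg2 i 0 hnP]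
  have P01 := P1' 0
  have P11 := P1' 1
  have Q01 := Q1' 0
  have Q11 := Q1' 1
  rw [pd_pd_mul _ _ hn hQ, pd_pd_mul _ _ hh hP] at P01 P11
  rw [pd_pd_mul _ _ hh hQ, pd_pd_mul _ _ hn hP] at Q01 Q11
  rw [pd_comm 1 0 hn, pd_comm 1 0 hh, pd_comm 1 0 hQ, pd_comm 1 0 hP, P01, Q01, P1, Q1] at P11 Q11
  have L1 : ∀ i, pd baseBasis i (fun r => P r * P r + Q r * Q r) y =
      2 * (P y * pd baseBasis i P y + Q y * pd baseBasis i Q y) := fun i => by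
    rw [pd_add _ (hP.mul hP).dAt (hQ.mul hQ).dAt, pd_mul _ hP.dAt hP.dAt, pd_mul _ hQ.dAt hQ.dAt]
    ring
  have L2 : ∀ i j, pd baseBasis i (pd baseBasis j (fun r => P r * P r + Q r * Q r)) y =
      2 * (P y * pd baseBasis i (pd baseBasis j P) y + pd baseBasis i P y * pd baseBasis j P y
       + Q y * pd baseBasis i (pd baseBasis j Q) y + pd baseBasis i Q y * pd baseBasis j Q y) := by
    intro i j
    rw [add2 i j (hP.mul hP) (hQ.mul hQ), pd_pd_mul _ _ hP hP, pd_pd_mul _ _ hQ hQ]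
    ring
  simp only [ellipticOp, symbolSq, drift₀, drift₁, potential, twist, L1, L2, P11, Q11, P01, Q01, P1,
    Q1]
  field_simp
  ring

theorem eq_zero_of_first_order_system {O W : Set E2} (hO : IsOpen O) (hOc : IsPreconnected O)
    (hn : ∀ y ∈ O, ContDiffAt ℝ ∞ n y) (hh : ∀ y ∈ O, ContDiffAt ℝ ∞ h y)
    (hP : ∀ y ∈ O, ContDiffAt ℝ ∞ P y) (hQ : ∀ y ∈ O, ContDiffAt ℝ ∞ Q y)
    (hn0 : ∀ y ∈ O, n y ≠ 0)
    (e1 : ∀ y ∈ O, pd baseBasis 1 P y = pd baseBasis 0 (fun r => n r * Q r + h r * P r) y)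
    (e2 : ∀ y ∈ O, pd baseBasis 1 Q y = pd baseBasis 0 (fun r => h r * Q r + (-1) * (n r * P r)) y)
    (hW : IsOpen W) (hWn : (O ∩ W).Nonempty) (h0 : ∀ y ∈ W, P y = 0 ∧ Q y = 0) :
    ∀ y ∈ O, P y = 0 ∧ Q y = 0 := by
  have cn : ContinuousOn n O := fun y hy => (hn y hy).continuousAt.continuousWithinAt
  have ch : ContinuousOn h O := fun y hy => (hh y hy).continuousAt.continuousWithinAt
  have cn1 : ∀ i, ContinuousOn (pd baseBasis i n) O :=
    fun i y hy => ((hn y hy).pd i).continuousAt.continuousWithinAt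
  have ch1 : ∀ i, ContinuousOn (pd baseBasis i h) O :=
    fun i y hy => ((hh y hy).pd i).continuousAt.continuousWithinAt
  have cn2 : ∀ i j, ContinuousOn (pd baseBasis i (pd baseBasis j n)) O :=
    fun i j y hy => (((hn y hy).pd j).pd i).continuousAt.continuousWithinAt
  have ch2 : ∀ i j, ContinuousOn (pd baseBasis i (pd baseBasis j h)) O :=
    fun i j y hy => (((hh y hy).pd j).pd i).continuousAt.continuousWithinAt
  have ct : ContinuousOn (twist n h) O := ((cn1 1).add (cn.mul (ch1 0))).sub (ch.mul (cn1 0))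
  have key := eq_zero_of_isPreconnected (L := fun r => P r * P r + Q r * Q r)
    (α := drift₀ n h) (β := drift₁ n h) (κ := potential n h) hO hOc cn ch
    ((((ch1 1).neg.add (cn.mul (cn1 0))).add (ch.mul (ch1 0))).add ((ct.mul ch).div cn hn0))
    (ct.neg.div cn hn0)
    (continuousOn_const.mul ((((ch2 0 1).sub (cn.mul (cn2 0 0))).sub (ch.mul (ch2 0 0))).sub
      ((ct.mul (ch1 0)).div cn hn0))) hn0
    (fun y hy => ((hP y hy).mul (hP y hy)).add ((hQ y hy).mul (hQ y hy)))
    (fun y => add_nonneg (mul_self_nonneg _) (mul_self_nonneg _))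
    (fun y hy => norm_sq_identity (hn y hy) (hh y hy) (hP y hy) (hQ y hy) (hn0 y hy)
      (Filter.eventuallyEq_of_mem (hO.mem_nhds hy) e1)
      (Filter.eventuallyEq_of_mem (hO.mem_nhds hy) e2))
    hW hWn (fun y hy => by simp [h0 y hy])
  intro y hy
  have := key y hy
  exact mul_self_add_mul_self_eq_zero.1 this

end UniqueContinuation

/-! ### Harmonic functions on a surface and their Cauchy–Riemann defects. -/

section TwoDim

variable {g : E2 → Matrix (Fin 2) (Fin 2) ℝ} {y : E2} {u : E2 → ℝ}

/-- The divergence form of the Laplacian; in dimension two `√det g` times the inverse metric is the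
adjugate of `g` divided by `√det g`. -/
theorem laplacian_divergence (hg : ∀ i j, ContDiffAt ℝ ∞ (fun r => g r i j) y)
    (hgp : (g y).PosDef) (hgs : ∀ r i j, g r i j = g r j i) (hu : ContDiffAt ℝ ∞ u y) :
    √(g y).det * laplacian baseBasis g u y =
      pd baseBasis 0 (fun r => g r 1 1 / √(g r).det * pd baseBasis 0 u r
        + (-1) * (g r 0 1 / √(g r).det * pd baseBasis 1 u r)) y
      + pd baseBasis 1 (fun r => g r 0 0 / √(g r).det * pd baseBasis 1 u r
        + (-1) * (g r 0 1 / √(g r).det * pd baseBasis 0 u r)) y := by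
  have hdp := hgp.det_pos
  have hw : ContDiffAt ℝ ∞ (fun r => √(g r).det) y := (contDiffAt_det hg).sqrt hdp.ne'
  have hw0 : 0 < √(g y).det := Real.sqrt_pos.2 hdp
  have hq : ∀ i j, ContDiffAt ℝ ∞ (fun r => g r i j / √(g r).det) y := fun i j =>
    (hg i j).div hw hw0.ne'
  have hww : (fun r => √(g r).det * √(g r).det) =ᶠ[𝓝 y]
      fun r => g r 0 0 * g r 1 1 - g r 0 1 * g r 0 1 := by
    filter_upwards [(contDiffAt_det hg).continuousAt.eventually (lt_mem_nhds hdp)] with r hr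
    rw [Real.mul_self_sqrt hr.le, Matrix.det_fin_two, hgs r 1 0]
  have w1 : ∀ i, 2 * √(g y).det * pd baseBasis i (fun r => √(g r).det) y =
      pd baseBasis i (fun r => g r 0 0) y * g y 1 1 + g y 0 0 * pd baseBasis i (fun r => g r 1 1) y
        - 2 * g y 0 1 * pd baseBasis i (fun r => g r 0 1) y := by
    intro i
    have := pd_congr (e := baseBasis) i hww
    rw [pd_mul _ hw.dAt hw.dAt, pd_sub _ ((hg 0 0).mul (hg 1 1)).dAt ((hg 0 1).mul (hg 0 1)).dAt,
      pd_mul _ (hg _ _).dAt (hg _ _).dAt, pd_mul _ (hg _ _).dAt (hg _ _).dAt] at this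
    linarith
  have q1 : ∀ i a b, pd baseBasis i (fun r => g r a b / √(g r).det) y =
      pd baseBasis i (fun r => g r a b) y / √(g y).det
        - g y a b * pd baseBasis i (fun r => √(g r).det) y / √(g y).det ^ 2 := by
    intro i a b
    have e : (fun r => g r a b / √(g r).det) = fun r => g r a b * (√(g r).det)⁻¹ :=
      funext fun r => div_eq_mul_inv _ _
    have hwi : ContDiffAt ℝ ∞ (fun r => (√(g r).det)⁻¹) y := hw.inv hw0.ne'
    rw [e, pd_mul _ (hg a b).dAt hwi.dAt, pd_inv _ hw.dAt hw0.ne']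
    field_simp
    ring
  have t1 : ∀ i a b c, pd baseBasis i (fun r => g r a b / √(g r).det * pd baseBasis c u r) y =
      pd baseBasis i (fun r => g r a b / √(g r).det) y * pd baseBasis c u y
        + g y a b / √(g y).det * pd baseBasis i (pd baseBasis c u) y := fun i a b c =>
    pd_mul _ (hq a b).dAt (hu.pd c).dAt
  have d1 : ∀ a b c, DifferentiableAt ℝ (fun r => g r a b / √(g r).det * pd baseBasis c u r) y :=
    fun a b c => ((hq a b).mul (hu.pd c)).dAt
  rw [pd_add _ (d1 _ _ _) ((d1 _ _ _).const_mul _), pd_add _ (d1 _ _ _) ((d1 _ _ _).const_mul _),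
    pd_const_mul _ _ (d1 _ _ _), pd_const_mul _ _ (d1 _ _ _), t1, t1, t1, t1, q1, q1, q1, q1]
  have hD : √(g y).det ^ 2 = (g y).det := Real.sq_sqrt hdp.le
  have hdet : (g y).det = g y 0 0 * g y 1 1 - g y 0 1 * g y 0 1 := by
    rw [Matrix.det_fin_two, hgs y 1 0]
  have hg10 : (fun r => g r 1 0) = fun r => g r 0 1 := funext fun r => hgs r 1 0
  have hinv : (g y)⁻¹ = (g y).det⁻¹ • !![g y 1 1, -g y 0 1; -g y 0 1, g y 0 0] := by
    rw [Matrix.inv_def, Matrix.adjugate_fin_two, Ring.inverse_eq_inv', hgs y 1 0]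
  have hc := pd_comm (e := baseBasis) 1 0 hu
  have w10 := w1 0
  have w11 := w1 1
  simp only [laplacian, christoffel, hinv, Fin.sum_univ_two, hg10, hc, Matrix.smul_apply, smul_eq_mul]
  simp only [Matrix.of_apply, Matrix.cons_val', Matrix.cons_val_zero, Matrix.cons_val_one,
    Matrix.cons_val_fin_one]
  set w := √(g y).det
  rw [← hD] at hdet ⊢
  have hv : ∀ i, pd baseBasis i (fun r => √(g r).det) y =
      (pd baseBasis i (fun r => g r 0 0) y * g y 1 1 + g y 0 0 * pd baseBasis i (fun r => g r 1 1) y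
        - 2 * g y 0 1 * pd baseBasis i (fun r => g r 0 1) y) / (2 * w) := fun i => by
    rw [← w1 i]; field_simp
  rw [hv, hv]
  -- Eliminating one component of the metric through `w² = det g` turns the claim into a rational
  -- identity in independent quantities.
  have h11 : g y 1 1 = (w ^ 2 + g y 0 1 ^ 2) / g y 0 0 := by
    have : g y 0 0 ≠ 0 := hgp.diag_pos.ne'
    field_simp; linarith
  have h00 : g y 0 0 ≠ 0 := hgp.diag_pos.ne'
  rw [h11]
  field_simp
  ring

end TwoDim

end CoordGeom

namespace CoordGeom

section CauchyRiemann

variable {g : E2 → Matrix (Fin 2) (Fin 2) ℝ} {x s : E2 → ℝ} {σ : ℝ} {y : E2}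

/-- The components of `ds + σ dx ∘ j`, where `j` is the rotation determined by `g`. -/
noncomputable def crDefect (g : E2 → Matrix (Fin 2) (Fin 2) ℝ) (x s : E2 → ℝ) (σ : ℝ)
    (a : Fin 2) (y : E2) : ℝ :=
  pd baseBasis a s y + σ * ∑ b, pd baseBasis b x y * rotation (g y) b a

/-- The form `ds + σ dx ∘ j` is closed because `x` is harmonic and coclosed because `s` is. With
components `P`, `R`, coclosedness involves `Q = a R - b P`; substituting `R = (Q + b P) / a` and `a
c - b² = 1` turns both conditions into the system of `eq_zero_of_first_order_system` with `n = 1 /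
a` and `h = b / a`. -/
theorem crDefect_eq_zero_of_eq_zero {O W : Set E2} (hO : IsOpen O) (hOc : IsPreconnected O)
    (hg : ∀ y ∈ O, ∀ i j, ContDiffAt ℝ ∞ (fun r => g r i j) y)
    (hgp : ∀ y ∈ O, (g y).PosDef) (hgs : ∀ r i j, g r i j = g r j i)
    (hx : ∀ y ∈ O, ContDiffAt ℝ ∞ x y) (hs : ∀ y ∈ O, ContDiffAt ℝ ∞ s y)
    (lx : ∀ y ∈ O, laplacian baseBasis g x y = 0) (ls : ∀ y ∈ O, laplacian baseBasis g s y = 0)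
    (hW : IsOpen W) (hWn : (O ∩ W).Nonempty) (h0 : ∀ y ∈ W, ∀ i, crDefect g x s σ i y = 0) :
    ∀ y ∈ O, ∀ i, crDefect g x s σ i y = 0 := by
  have hdp : ∀ y ∈ O, 0 < (g y).det := fun y hy => (hgp y hy).det_pos
  have hw : ∀ y ∈ O, ContDiffAt ℝ ∞ (fun r => √(g r).det) y := fun y hy =>
    (contDiffAt_det (hg y hy)).sqrt (hdp y hy).ne'
  have hw0 : ∀ y ∈ O, 0 < √(g y).det := fun y hy => Real.sqrt_pos.2 (hdp y hy)
  have h00 : ∀ y ∈ O, g y 0 0 ≠ 0 := fun y hy => (hgp y hy).diag_pos.ne'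
  have hq : ∀ y ∈ O, ∀ i j, ContDiffAt ℝ ∞ (fun r => g r i j / √(g r).det) y := fun y hy i j =>
    (hg y hy i j).div (hw y hy) (hw0 y hy).ne'
  have hdet : ∀ y ∈ O, √(g y).det ^ 2 = g y 0 0 * g y 1 1 - g y 0 1 * g y 0 1 := fun y hy => by
    rw [Real.sq_sqrt (hdp y hy).le, Matrix.det_fin_two, hgs y 1 0]
  let a : E2 → ℝ := fun r => g r 0 0 / √(g r).det
  let b : E2 → ℝ := fun r => g r 0 1 / √(g r).det
  let c : E2 → ℝ := fun r => g r 1 1 / √(g r).det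
  have ha : ∀ y ∈ O, ContDiffAt ℝ ∞ a y := fun y hy => hq y hy 0 0
  have hb : ∀ y ∈ O, ContDiffAt ℝ ∞ b y := fun y hy => hq y hy 0 1
  have hc : ∀ y ∈ O, ContDiffAt ℝ ∞ c y := fun y hy => hq y hy 1 1
  have ha0 : ∀ y ∈ O, a y ≠ 0 := fun y hy => div_ne_zero (h00 y hy) (hw0 y hy).ne'
  have habc : ∀ y ∈ O, a y * c y = 1 + b y * b y := fun y hy => by
    have := hdet y hy
    have h := (hw0 y hy).ne'
    simp only [a, b, c]
    field_simp
    linarith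
  have e0 : ∀ r, crDefect g x s σ 0 r =
      pd baseBasis 0 s r + σ * (a r * pd baseBasis 1 x r + (-1) * (b r * pd baseBasis 0 x r)) := by
    intro r
    simp only [crDefect, rotation, Fin.sum_univ_two, a, b, hgs r 1 0]
    simp only [Matrix.of_apply, Matrix.cons_val', Matrix.cons_val_zero, Matrix.cons_val_one,
      Matrix.cons_val_fin_one]
    ring
  have e1 : ∀ r, crDefect g x s σ 1 r =
      pd baseBasis 1 s r + σ * (b r * pd baseBasis 1 x r + (-1) * (c r * pd baseBasis 0 x r)) := by
    intro r
    simp only [crDefect, rotation, Fin.sum_univ_two, b, c]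
    simp only [Matrix.of_apply, Matrix.cons_val', Matrix.cons_val_zero, Matrix.cons_val_one,
      Matrix.cons_val_fin_one]
    ring
  let P : E2 → ℝ := fun r =>
    pd baseBasis 0 s r + σ * (a r * pd baseBasis 1 x r + (-1) * (b r * pd baseBasis 0 x r))
  let R : E2 → ℝ := fun r =>
    pd baseBasis 1 s r + σ * (b r * pd baseBasis 1 x r + (-1) * (c r * pd baseBasis 0 x r))
  let Q : E2 → ℝ := fun r => a r * R r + (-1) * (b r * P r)
  let n : E2 → ℝ := fun r => (a r)⁻¹
  let h : E2 → ℝ := fun r => b r * (a r)⁻¹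
  have sm : ∀ y ∈ O, ∀ {u v : E2 → ℝ}, ContDiffAt ℝ ∞ u y → ContDiffAt ℝ ∞ v y →
      ContDiffAt ℝ ∞ (fun r => u r * pd baseBasis 1 x r + (-1) * (v r * pd baseBasis 0 x r)) y :=
    fun y hy u v hu hv => (hu.mul ((hx y hy).pd 1)).add
      (contDiffAt_const.mul (hv.mul ((hx y hy).pd 0)))
  have hP : ∀ y ∈ O, ContDiffAt ℝ ∞ P y := fun y hy =>
    ((hs y hy).pd 0).add (contDiffAt_const.mul (sm y hy (ha y hy) (hb y hy)))
  have hR : ∀ y ∈ O, ContDiffAt ℝ ∞ R y := fun y hy =>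
    ((hs y hy).pd 1).add (contDiffAt_const.mul (sm y hy (hb y hy) (hc y hy)))
  have hQ : ∀ y ∈ O, ContDiffAt ℝ ∞ Q y := fun y hy =>
    ((ha y hy).mul (hR y hy)).add (contDiffAt_const.mul ((hb y hy).mul (hP y hy)))
  have hn : ∀ y ∈ O, ContDiffAt ℝ ∞ n y := fun y hy => (ha y hy).inv (ha0 y hy)
  have hh : ∀ y ∈ O, ContDiffAt ℝ ∞ h y := fun y hy => (hb y hy).mul (hn y hy)
  have div : ∀ {u : E2 → ℝ}, (∀ y ∈ O, ContDiffAt ℝ ∞ u y) →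
      (∀ y ∈ O, laplacian baseBasis g u y = 0) → ∀ y ∈ O,
      pd baseBasis 0 (fun r => b r * pd baseBasis 1 u r + (-1) * (c r * pd baseBasis 0 u r)) y =
        pd baseBasis 1 (fun r => a r * pd baseBasis 1 u r + (-1) * (b r * pd baseBasis 0 u r)) y := by
    intro u hu lu y hy
    have h1 := laplacian_divergence (hg y hy) (hgp y hy) hgs (hu y hy)
    rw [lu y hy, mul_zero] at h1
    have d : ∀ {v : E2 → ℝ} i, ContDiffAt ℝ ∞ v y →
        DifferentiableAt ℝ (fun r => v r * pd baseBasis i u r) y := fun i hv =>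
      (hv.mul ((hu y hy).pd i)).dAt
    rw [pd_add _ (d 0 (hc y hy)) ((d 1 (hb y hy)).const_mul _), pd_const_mul _ _ (d 1 (hb y hy))] at h1
    rw [pd_add _ (d 1 (hb y hy)) ((d 0 (hc y hy)).const_mul _), pd_const_mul _ _ (d 0 (hc y hy))]
    linarith
  have ePR : ∀ y ∈ O, pd baseBasis 1 P y = pd baseBasis 0 R y := by
    intro y hy
    have d1 := sm y hy (ha y hy) (hb y hy)
    have d2 := sm y hy (hb y hy) (hc y hy)
    rw [pd_add _ ((hs y hy).pd 0).dAt (d1.dAt.const_mul _),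
      pd_add _ ((hs y hy).pd 1).dAt (d2.dAt.const_mul _), pd_const_mul _ _ d1.dAt,
      pd_const_mul _ _ d2.dAt, div hx lx y hy, pd_comm 1 0 (hs y hy)]
  have eQ : ∀ y ∈ O, Q y = a y * pd baseBasis 1 s y + (-1) * (b y * pd baseBasis 0 s y)
      + (-σ) * pd baseBasis 0 x y := by
    intro y hy
    simp only [Q, P, R]
    linear_combination (-σ * pd baseBasis 0 x y) * habc y hy
  have eS : ∀ y ∈ O, h y * Q y + (-1) * (n y * P y) =
      b y * pd baseBasis 1 s y + (-1) * (c y * pd baseBasis 0 s y)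
      + (-σ) * pd baseBasis 1 x y := by
    intro y hy
    have h1 := habc y hy
    have h2 := ha0 y hy
    simp only [Q, P, R, h, n]
    field_simp
    linear_combination (pd baseBasis 0 s y - σ * b y * pd baseBasis 0 x y) * h1
  have key := eq_zero_of_first_order_system (n := n) (h := h) (P := P) (Q := Q) hO hOc hn hh hP hQ
    (fun y hy => inv_ne_zero (ha0 y hy))
    (fun y hy => by
      rw [ePR y hy]
      refine pd_congr 0 ?_
      filter_upwards [hO.mem_nhds hy] with r hr
      have h2 := ha0 r hr
      simp only [Q, h, n]
      field_simp
      ring)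
    (fun y hy => by
      have q1 := Filter.eventuallyEq_of_mem (hO.mem_nhds hy) eQ
      have q2 := Filter.eventuallyEq_of_mem (hO.mem_nhds hy) eS
      have d : ∀ {u v : E2 → ℝ}, ContDiffAt ℝ ∞ u y → ContDiffAt ℝ ∞ v y → ContDiffAt ℝ ∞
          (fun r => u r * pd baseBasis 1 s r + (-1) * (v r * pd baseBasis 0 s r)) y :=
        fun hu hv => (hu.mul ((hs y hy).pd 1)).add
          (contDiffAt_const.mul (hv.mul ((hs y hy).pd 0)))
      have dx : ∀ i, DifferentiableAt ℝ (pd baseBasis i x) y := fun i => ((hx y hy).pd i).dAt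
      rw [pd_congr 1 q1, pd_congr 0 q2,
        pd_add _ (d (ha y hy) (hb y hy)).dAt ((dx 0).const_mul _),
        pd_add _ (d (hb y hy) (hc y hy)).dAt ((dx 1).const_mul _), pd_const_mul _ _ (dx 0),
        pd_const_mul _ _ (dx 1), div hs ls y hy, pd_comm 1 0 (hx y hy)])
    (hW.inter hO) (hWn.mono fun r hr => ⟨hr.1, hr.2, hr.1⟩)
    (fun y hy => by
      have p : P y = 0 := (e0 y).symm.trans (h0 y hy.1 0)
      have r : R y = 0 := (e1 y).symm.trans (h0 y hy.1 1)
      simp [Q, p, r])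
  intro y hy i
  obtain ⟨hPy, hQy⟩ := key y hy
  have hRy : R y = 0 := by
    simp only [Q, hPy, mul_zero, add_zero] at hQy
    exact (mul_eq_zero.1 hQy).resolve_left (ha0 y hy)
  fin_cases i
  · exact (e0 y).trans hPy
  · exact (e1 y).trans hRy

end CauchyRiemann

end CoordGeom

/-! ### Locally constant cocycles on simply connected spaces. -/

/-- A locally constant cocycle on a simply connected space is a coboundary. -/
theorem exists_locally_constant_trivialization {Y : Type*} [TopologicalSpace Y]
    [SimplyConnectedSpace Y] [LocallyPathConnectedSpace Y] {K : Type*} {Γ : Type*} [Group Γ]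
    (V : K → Set Y) (hV : ∀ k, IsOpen (V k)) (hcov : ∀ y, ∃ k, y ∈ V k) (c : K → K → Y → Γ)
    (hc : ∀ k l, ∀ y ∈ V k ∩ V l, ∀ᶠ y' in 𝓝 y, c k l y' = c k l y)
    (hcc : ∀ k l m, ∀ y ∈ V k ∩ V l ∩ V m, c l m y * c k l y = c k m y) :
    ∃ h : K → Y → Γ, (∀ k, ∀ y ∈ V k, ∀ᶠ y' in 𝓝 y, h k y' = h k y) ∧
      ∀ k l, ∀ y ∈ V k ∩ V l, h l y = c k l y * h k y := by
  let _ : TopologicalSpace Γ := ⊥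
  have : DiscreteTopology Γ := ⟨rfl⟩
  have hself : ∀ k, ∀ y ∈ V k, c k k y = 1 := fun k y hy => by
    have := hcc k k k y ⟨⟨hy, hy⟩, hy⟩
    exact mul_eq_left.1 this
  choose ind hind using hcov
  -- The cocycle, acting by left multiplication on the discrete group, glues a covering space of
  -- `Y`.
  let Z : FiberBundleCore K Y Γ :=
    { baseSet := V
      isOpen_baseSet := hV
      indexAt := ind
      mem_baseSet_at := hind
      coordChange := fun k l y v => c k l y * v
      coordChange_self := fun k y hy v => by rw [hself k y hy, one_mul]
      continuousOn_coordChange := by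
        rintro k l ⟨y, v⟩ ⟨hy, -⟩
        refine ContinuousAt.continuousWithinAt ?_
        have h1 : ∀ᶠ q : Y × Γ in 𝓝 (y, v), c k l q.1 = c k l y :=
          (continuous_fst.tendsto (y, v)).eventually (hc k l y hy)
        have h2 : ∀ᶠ q : Y × Γ in 𝓝 (y, v), q.2 = v :=
          (continuous_snd.tendsto (y, v)).eventually
            (p := fun w => w = v) (by simp [nhds_discrete])
        have h3 : (fun q : Y × Γ => c k l q.1 * q.2) =ᶠ[𝓝 (y, v)] fun _ => c k l y * v := by
          filter_upwards [h1, h2] with q a b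
          rw [a, b]
        exact (continuousAt_congr h3).2 continuousAt_const
      coordChange_comp := fun k l m y hy v => by rw [← mul_assoc, hcc k l m y hy] }
  have hcm : IsCoveringMap (Bundle.TotalSpace.proj : Bundle.TotalSpace Γ Z.Fiber → Y) :=
    FiberBundle.isCoveringMap
  obtain ⟨y₀⟩ : Nonempty Y := inferInstance
  -- Lifting the identity map of the simply connected base yields a global section, whose
  -- expressions in the local trivializations are the required functions.
  obtain ⟨s, ⟨-, hs⟩, -⟩ := hcm.existsUnique_continuousMap_lifts (ContinuousMap.id Y) y₀
    (⟨y₀, (1 : Γ)⟩ : Bundle.TotalSpace Γ Z.Fiber) rfl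
  have hs' : ∀ y, (s y).proj = y := fun y => congrFun hs y
  refine ⟨fun k y => (Z.localTriv k (s y)).2, fun k y hy => ?_, fun k l y hy => ?_⟩
  · have hcont : ContinuousAt (fun y' => (Z.localTriv k (s y')).2) y := by
      refine continuous_snd.continuousAt.comp (ContinuousAt.comp ?_ s.continuous.continuousAt)
      refine (Z.localTriv k).continuousOn.continuousAt ((Z.localTriv k).open_source.mem_nhds ?_)
      rw [Z.mem_localTriv_source, hs' y]
      exact hy
    have := hcont.eventually (p := fun v => v = (Z.localTriv k (s y)).2) (by simp [nhds_discrete])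
    exact this
  · have e : ∀ k, (Z.localTriv k (s y)).2 = c (ind y) k y * (show Γ from (s y).2) := fun k => by
      rw [Z.localTriv_apply]
      change c (ind (s y).proj) k (s y).proj * (show Γ from (s y).2) = _
      rw [hs' y]
    simp only []
    rw [e, e, ← mul_assoc, hcc _ _ _ _ ⟨⟨hind y, hy.1⟩, hy.2⟩]

/-! ### Metrics and derivatives in smooth coordinate systems. -/

section SurfaceCharts

variable {S : Type*} [TopologicalSpace S] [ChartedSpace E2 S]

/-- The differential of a parametrization, as a map between planes. -/
noncomputable def paramDeriv (q : E2 → S) (y : E2) : E2 →L[ℝ] E2 :=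
  mfderiv 𝓘(ℝ, E2) 𝓘(ℝ, E2) q y

/-- The differential of a coordinate system, as a map between planes. -/
noncomputable def coordDeriv (f : S → E2) (b : S) : E2 →L[ℝ] E2 :=
  mfderiv 𝓘(ℝ, E2) 𝓘(ℝ, E2) f b

/-- The bilinear form of a metric at a point, as a form on the plane. -/
noncomputable def formAt (g : TangentForm S) (b : S) : E2 →L[ℝ] E2 →L[ℝ] ℝ := g b

/-- The components of the pullback of a metric by a parametrization. -/
noncomputable def metricAlong (g : TangentForm S) (q : E2 → S) (y : E2) :
    Matrix (Fin 2) (Fin 2) ℝ :=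
  Matrix.of fun α β =>
    formAt g (q y) (paramDeriv q y (baseBasis α)) (paramDeriv q y (baseBasis β))

/-- A coordinate system, not necessarily in the atlas, that is smooth with smooth inverse. -/
structure IsSmoothChart (φ : OpenPartialHomeomorph S E2) : Prop where
  smooth : ContMDiffOn 𝓘(ℝ, E2) 𝓘(ℝ, E2) ∞ φ φ.source
  smooth_symm : ContMDiffOn 𝓘(ℝ, E2) 𝓘(ℝ, E2) ∞ φ.symm φ.target

theorem isSmoothChart_of_mem_atlas [IsManifold 𝓘(ℝ, E2) ∞ S] {φ : OpenPartialHomeomorph S E2}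
    (hφ : φ ∈ atlas E2 S) : IsSmoothChart φ :=
  ⟨contMDiffOn_of_mem_maximalAtlas (IsManifold.subset_maximalAtlas hφ),
    contMDiffOn_symm_of_mem_maximalAtlas (IsManifold.subset_maximalAtlas hφ)⟩

theorem euclidean_eq_sum (v : E2) : v = ∑ i, v i • baseBasis i := by
  ext j; fin_cases j <;> simp [baseBasis, Fin.sum_univ_two]

namespace IsSmoothChart

variable {φ ψ : OpenPartialHomeomorph S E2} {y : E2} {b : S}

theorem contMDiffAt (hφ : IsSmoothChart φ) (hb : b ∈ φ.source) :
    ContMDiffAt 𝓘(ℝ, E2) 𝓘(ℝ, E2) ∞ φ b :=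
  hφ.smooth.contMDiffAt (φ.open_source.mem_nhds hb)

theorem contMDiffAt_symm (hφ : IsSmoothChart φ) (hy : y ∈ φ.target) :
    ContMDiffAt 𝓘(ℝ, E2) 𝓘(ℝ, E2) ∞ φ.symm y :=
  hφ.smooth_symm.contMDiffAt (φ.open_target.mem_nhds hy)

theorem mdifferentiable (hφ : IsSmoothChart φ) : φ.MDifferentiable 𝓘(ℝ, E2) 𝓘(ℝ, E2) :=
  ⟨hφ.smooth.mdifferentiableOn (by simp), hφ.smooth_symm.mdifferentiableOn (by simp)⟩

theorem coordDeriv_paramDeriv (hφ : IsSmoothChart φ) (hy : y ∈ φ.target) (v : E2) :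
    coordDeriv φ (φ.symm y) (paramDeriv φ.symm y v) = v :=
  congrArg (fun L : E2 →L[ℝ] E2 => L v) (hφ.mdifferentiable.comp_symm_deriv hy)

theorem paramDeriv_coordDeriv (hφ : IsSmoothChart φ) (hb : b ∈ φ.source) (v : E2) :
    paramDeriv φ.symm (φ b) (coordDeriv φ b v) = v :=
  congrArg (fun L : E2 →L[ℝ] E2 => L v) (hφ.mdifferentiable.symm_comp_deriv hb)

/-- The expression of a parametrization in coordinates. -/
theorem contDiffAt_comp (hφ : IsSmoothChart φ) {q : E2 → S}
    (hq : ContMDiffAt 𝓘(ℝ, E2) 𝓘(ℝ, E2) ∞ q y) (hy : q y ∈ φ.source) :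
    ContDiffAt ℝ ∞ (fun z => φ (q z)) y :=
  (ContMDiffAt.comp y (hφ.contMDiffAt hy) hq).contDiffAt

theorem paramDeriv_eq (hφ : IsSmoothChart φ) {q : E2 → S}
    (hq : ContMDiffAt 𝓘(ℝ, E2) 𝓘(ℝ, E2) ∞ q y) (hy : q y ∈ φ.source) (v : E2) :
    paramDeriv q y v = paramDeriv φ.symm (φ (q y)) (fderiv ℝ (fun z => φ (q z)) y v) := by
  have h := hφ.contDiffAt_comp hq hy
  have e : q =ᶠ[𝓝 y] φ.symm ∘ fun z => φ (q z) := by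
    filter_upwards [hq.continuousAt (φ.open_source.mem_nhds hy)] with z hz
    exact (φ.left_inv hz).symm
  have h1 : mfderiv 𝓘(ℝ, E2) 𝓘(ℝ, E2) q y =
      mfderiv 𝓘(ℝ, E2) 𝓘(ℝ, E2) (φ.symm ∘ fun z => φ (q z)) y := e.mfderiv_eq
  rw [mfderiv_comp y ((hφ.contMDiffAt_symm (φ.map_source hy)).mdifferentiableAt (by simp))
    (h.contMDiffAt.mdifferentiableAt (by simp)), mfderiv_eq_fderiv] at h1
  exact congrArg (fun L : E2 →L[ℝ] E2 => L v) h1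

theorem coordDeriv_eq_fderiv (hφ : IsSmoothChart φ) {q : E2 → S}
    (hq : ContMDiffAt 𝓘(ℝ, E2) 𝓘(ℝ, E2) ∞ q y) (hy : q y ∈ φ.source) (v : E2) :
    coordDeriv φ (q y) (paramDeriv q y v) = fderiv ℝ (fun z => φ (q z)) y v := by
  have h1 := mfderiv_comp y ((hφ.contMDiffAt hy).mdifferentiableAt (by simp))
    (hq.mdifferentiableAt (by simp))
  rw [show ⇑φ ∘ q = fun z => φ (q z) from rfl, mfderiv_eq_fderiv] at h1
  exact (congrArg (fun L : E2 →L[ℝ] E2 => L v) h1).symm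

end IsSmoothChart

/-- The Jacobian matrix of a map of the plane. -/
noncomputable def jacobian (T : E2 → E2) (y : E2) : Matrix (Fin 2) (Fin 2) ℝ :=
  Matrix.of fun i j => fderiv ℝ T y (baseBasis j) i

theorem contDiffAt_jacobian {T : E2 → E2} {y : E2} (hT : ContDiffAt ℝ ∞ T y) (i j : Fin 2) :
    ContDiffAt ℝ ∞ (fun z => jacobian T z i j) y := by
  have h1 : ContDiffAt ℝ ∞ (fun z => fderiv ℝ T z (baseBasis j)) y :=
    (hT.fderiv_right (m := ∞) (by simp)).clm_apply contDiffAt_const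
  exact ((CoordGeom.contDiff_coord i).contDiffAt (x := fderiv ℝ T y (baseBasis j))).comp y h1

theorem fderiv_eq_sum_jacobian (T : E2 → E2) (y : E2) (j : Fin 2) :
    fderiv ℝ T y (baseBasis j) = ∑ i, jacobian T y i j • baseBasis i :=
  euclidean_eq_sum _

theorem bilin_expand (B : E2 →L[ℝ] E2 →L[ℝ] ℝ) (a b c d : ℝ) (u v w z : E2) :
    B (a • u + b • v) (c • w + d • z) =
      a * c * B u w + a * d * B u z + b * c * B v w + b * d * B v z := by
  simp; ring

theorem metricAlong_eq (g : TangentForm S) {φ : OpenPartialHomeomorph S E2} (hφ : IsSmoothChart φ)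
    {q : E2 → S} {y : E2} (hq : ContMDiffAt 𝓘(ℝ, E2) 𝓘(ℝ, E2) ∞ q y) (hy : q y ∈ φ.source) :
    metricAlong g q y = (jacobian (fun z => φ (q z)) y)ᵀ * metricComp g φ (φ (q y)) *
      jacobian (fun z => φ (q z)) y := by
  have h : ∀ α, paramDeriv q y (baseBasis α) =
      ∑ i, jacobian (fun z => φ (q z)) y i α • paramDeriv φ.symm (φ (q y)) (baseBasis i) := by
    intro α
    rw [hφ.paramDeriv_eq hq hy, fderiv_eq_sum_jacobian, map_sum]
    simp only [map_smul]
  have hb : φ.symm (φ (q y)) = q y := φ.left_inv hy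
  have hm : ∀ i j, metricComp g φ (φ (q y)) i j =
      formAt g (q y) (paramDeriv φ.symm (φ (q y)) (baseBasis i))
        (paramDeriv φ.symm (φ (q y)) (baseBasis j)) := by
    intro i j
    change formAt g (φ.symm (φ (q y))) _ _ = _
    rw [hb]
    rfl
  ext α β
  have e : ∀ α, paramDeriv q y (baseBasis α) = jacobian (fun z => φ (q z)) y 0 α •
      paramDeriv φ.symm (φ (q y)) (baseBasis 0) + jacobian (fun z => φ (q z)) y 1 α •
      paramDeriv φ.symm (φ (q y)) (baseBasis 1) := fun α => by rw [h α, Fin.sum_univ_two]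
  change formAt g (q y) _ _ = _
  rw [e α, e β]
  refine (bilin_expand (formAt g (q y)) _ _ _ _ _ _ _ _).trans ?_
  simp only [Matrix.mul_apply, Matrix.transpose_apply, hm, Fin.sum_univ_two]
  ring

/-- A smooth metric, expressed by its components in all smooth coordinate systems. -/
structure IsSmoothMetric (g : TangentForm S) : Prop where
  symm : ∀ b (v w : E2), formAt g b v w
    = formAt g b w v
  pos : ∀ b (v : E2), v ≠ 0 → 0 < formAt g b v v
  smooth : ∀ φ, IsSmoothChart φ → ∀ y ∈ φ.target, ∀ i j,
    ContDiffAt ℝ ∞ (fun z => metricComp g φ z i j) y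

/-- The metric is a smooth section of a bundle of bilinear forms and the vectors `dq(v)`, for fixed
`v`, form a smooth lift of `q` to the tangent bundle; evaluation of one on the other is smooth. -/
theorem contDiffOn_metricAlong [IsManifold 𝓘(ℝ, E2) ∞ S] {g : TangentForm S}
    (hg : IsRiemannianMetric g) {q : E2 → S} {O : Set E2} (hO : IsOpen O)
    (hq : ContMDiffOn 𝓘(ℝ, E2) 𝓘(ℝ, E2) ∞ q O) (i j : Fin 2) :
    ContDiffOn ℝ ∞ (fun z => metricAlong g q z i j) O := by
  obtain ⟨m, hm⟩ := hg
  have : IsManifold 𝓘(ℝ, E2) 1 S := .of_le (n := ∞) (by simp)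
  have hv : ∀ v : E2, ContMDiffOn 𝓘(ℝ, E2) (𝓘(ℝ, E2).prod 𝓘(ℝ, E2)) ∞
      (fun z => Bundle.TotalSpace.mk' E2 (E := fun b : S => TangentSpace 𝓘(ℝ, E2) b) (q z)
        (mfderiv 𝓘(ℝ, E2) 𝓘(ℝ, E2) q z v)) O := by
    intro v
    have h1 := hq.contMDiffOn_tangentMapWithin (m := ∞) (by simp) hO.uniqueMDiffOn
    have h2 : ContMDiffOn 𝓘(ℝ, E2) (𝓘(ℝ, E2).prod 𝓘(ℝ, E2)) ∞
        (fun z => (⟨z, v⟩ : TangentBundle 𝓘(ℝ, E2) E2)) O :=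
      contMDiffOn_vectorSpace_iff_contDiffOn.2 contDiffOn_const
    refine (h1.comp h2 fun z hz => hz).congr fun z hz => ?_
    change _ = (⟨q z, mfderivWithin 𝓘(ℝ, E2) 𝓘(ℝ, E2) q O z v⟩ : TangentBundle 𝓘(ℝ, E2) S)
    rw [mfderivWithin_of_isOpen hO hz]
  rw [← contMDiffOn_iff_contDiffOn]
  have key : ContMDiffOn 𝓘(ℝ, E2) (𝓘(ℝ, E2).prod 𝓘(ℝ, ℝ)) ∞
      (fun z => Bundle.TotalSpace.mk' ℝ (E := Bundle.Trivial S ℝ) (q z)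
        (m.inner (q z) (mfderiv 𝓘(ℝ, E2) 𝓘(ℝ, E2) q z (baseBasis i))
          (mfderiv 𝓘(ℝ, E2) 𝓘(ℝ, E2) q z (baseBasis j)))) O := by
    apply ContMDiffOn.clm_bundle_apply₂ (F₁ := E2) (F₂ := E2)
    · exact m.contMDiff.comp_contMDiffOn hq
    · exact hv _
    · exact hv _
  intro z hz
  have := key z hz
  simp only [Bundle.contMDiffWithinAt_totalSpace] at this
  have h2 := this.2
  simp only [hm] at h2
  exact h2

theorem IsRiemannianMetric.isSmoothMetric [IsManifold 𝓘(ℝ, E2) ∞ S] {g : TangentForm S}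
    (hg : IsRiemannianMetric g) : IsSmoothMetric g := by
  refine ⟨fun b v w => ?_, fun b v hv => ?_, fun φ hφ y hy i j => ?_⟩
  · obtain ⟨m, hm⟩ := hg
    rw [formAt, ← hm]; exact m.symm b v w
  · obtain ⟨m, hm⟩ := hg
    rw [formAt, ← hm]; exact m.pos b v hv
  · exact (contDiffOn_metricAlong hg φ.open_target hφ.smooth_symm i j).contDiffAt
      (φ.open_target.mem_nhds hy)

namespace IsSmoothMetric

variable {g : TangentForm S} {φ : OpenPartialHomeomorph S E2} {y : E2}

theorem metricComp_symm (hg : IsSmoothMetric g) (φ : OpenPartialHomeomorph S E2) (y : E2)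
    (i j : Fin 2) : metricComp g φ y i j = metricComp g φ y j i :=
  hg.symm _ _ _

theorem metricComp_posDef (hg : IsSmoothMetric g) (hφ : IsSmoothChart φ) (hy : y ∈ φ.target) :
    (metricComp g φ y).PosDef := by
  refine Matrix.PosDef.of_dotProduct_mulVec_pos ?_ fun x hx => ?_
  · ext i j; exact hg.metricComp_symm φ y j i
  · have h : 0 < formAt g (φ.symm y) _ _ := hg.pos (φ.symm y) (paramDeriv φ.symm y (∑ i, x i • baseBasis i)) (by
      intro h0
      have h1 := hφ.coordDeriv_paramDeriv hy (∑ i, x i • baseBasis i)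
      rw [h0, map_zero] at h1
      apply hx
      ext i
      have := congrArg (fun v : E2 => v i) h1
      fin_cases i <;> simpa [baseBasis, Fin.sum_univ_two, eq_comm] using this)
    refine lt_of_lt_of_eq h ?_
    have hm : ∀ i j, metricComp g φ y i j = formAt g (φ.symm y)
        (paramDeriv φ.symm y (baseBasis i)) (paramDeriv φ.symm y (baseBasis j)) := fun i j => rfl
    rw [Fin.sum_univ_two, map_add, map_smul, map_smul]
    refine (bilin_expand (formAt g (φ.symm y)) _ _ _ _ _ _ _ _).trans ?_
    simp only [dotProduct, Matrix.mulVec, Fin.sum_univ_two, hm, star_trivial]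
    ring

end IsSmoothMetric

end SurfaceCharts

namespace CoordGeom

/-! ### Rotations by a right angle and orientations. -/

section RotationMatrix

variable {M : Matrix (Fin 2) (Fin 2) ℝ}

theorem rotation_mul_self (hM : M.PosDef) : rotation M * rotation M = -1 := by
  have hd := hM.det_pos
  have hs : M 1 0 = M 0 1 := by simpa using (hM.1.apply 0 1)
  have hw0 : √M.det ≠ 0 := (Real.sqrt_pos.2 hd).ne'
  have hw : √M.det ^ 2 = M 0 0 * M 1 1 - M 0 1 * M 0 1 := by
    rw [Real.sq_sqrt hd.le, Matrix.det_fin_two, hs]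
  ext i j
  fin_cases i <;> fin_cases j <;> simp [rotation, Matrix.mul_apply, Fin.sum_univ_two, hs] <;>
    field_simp <;> linarith

/-- This is the area form `⟨J·, ·⟩`, which depends on the metric only through its determinant.
Applied to the fibres, it reduces closedness of the fundamental form to constancy of the fibre
volume. -/
theorem transpose_rotation_mul (hM : M.PosDef) :
    (rotation M)ᵀ * M = √M.det • !![0, 1; -1, 0] := by
  have hd := hM.det_pos
  have hs : M 1 0 = M 0 1 := by simpa using (hM.1.apply 0 1)
  have hw0 : √M.det ≠ 0 := (Real.sqrt_pos.2 hd).ne'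
  have hw : √M.det ^ 2 = M 0 0 * M 1 1 - M 0 1 * M 0 1 := by
    rw [Real.sq_sqrt hd.le, Matrix.det_fin_two, hs]
  ext i j
  fin_cases i <;> fin_cases j <;> simp [rotation, Matrix.mul_apply, Fin.sum_univ_two, hs] <;>
    field_simp <;> linarith

theorem transpose_rotation_mul_mul (hM : M.PosDef) :
    (rotation M)ᵀ * M * rotation M = M := by
  have hd := hM.det_pos
  have hs : M 1 0 = M 0 1 := by simpa using (hM.1.apply 0 1)
  have hw0 : √M.det ≠ 0 := (Real.sqrt_pos.2 hd).ne'
  rw [transpose_rotation_mul hM]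
  ext i j
  fin_cases i <;> fin_cases j <;>
    simp [rotation, Matrix.mul_apply, Fin.sum_univ_two, hs] <;> field_simp

theorem contDiffAt_rotation {g : E2 → Matrix (Fin 2) (Fin 2) ℝ} {y : E2}
    (hg : ∀ i j, ContDiffAt ℝ ∞ (fun r => g r i j) y) (hp : (g y).PosDef) (i j : Fin 2) :
    ContDiffAt ℝ ∞ (fun r => rotation (g r) i j) y := by
  have hd := hp.det_pos
  have hw : ContDiffAt ℝ ∞ (fun r => √(g r).det) y := (contDiffAt_det hg).sqrt hd.ne'
  have hw0 : √(g y).det ≠ 0 := (Real.sqrt_pos.2 hd).ne'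
  fin_cases i <;> fin_cases j
  · exact ((hg 1 0).neg).div hw hw0
  · exact ((hg 1 1).neg).div hw hw0
  · exact (hg 0 0).div hw hw0
  · exact (hg 0 1).div hw hw0

end RotationMatrix

/-- The endomorphism of the plane defined by a matrix. -/
noncomputable def matEndo (M : Matrix (Fin 2) (Fin 2) ℝ) : E2 →L[ℝ] E2 :=
  Matrix.toEuclideanCLM (𝕜 := ℝ) M

theorem matEndo_apply (M : Matrix (Fin 2) (Fin 2) ℝ) (v : E2) (i : Fin 2) :
    matEndo M v i = ∑ j, M i j * v j := rfl

theorem matEndo_mul_apply (M N : Matrix (Fin 2) (Fin 2) ℝ) (v : E2) :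
    matEndo (M * N) v = matEndo M (matEndo N v) := by
  rw [matEndo, map_mul]; rfl

theorem matEndo_smul_apply (c : ℝ) (M : Matrix (Fin 2) (Fin 2) ℝ) (v : E2) :
    matEndo (c • M) v = c • matEndo M v := by
  rw [matEndo, map_smul]; rfl

theorem matEndo_neg_one_apply (v : E2) : matEndo (-1) v = -v := by
  rw [matEndo, map_neg, map_one]; rfl

theorem matEndo_baseBasis (M : Matrix (Fin 2) (Fin 2) ℝ) (i j : Fin 2) :
    matEndo M (baseBasis j) i = M i j := by
  fin_cases j <;> simp [matEndo_apply, baseBasis]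

theorem matEndo_jacobian (T : E2 → E2) (y : E2) : matEndo (jacobian T y) = fderiv ℝ T y := by
  ext v : 1
  conv_rhs => rw [euclidean_eq_sum v, map_sum]
  ext i
  simp only [matEndo_apply, map_smul, Fin.sum_univ_two, PiLp.add_apply, PiLp.smul_apply, jacobian,
    Matrix.of_apply, smul_eq_mul, mul_comm]

section Orientation

variable {S : Type*} [TopologicalSpace S] [ChartedSpace E2 S]

/-- The value at a point of a field of endomorphisms, as an endomorphism of the plane. -/
noncomputable def endoAt (J : TangentEndo S) (b : S) : E2 →L[ℝ] E2 := J b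

/-- The rotation by a right angle in the direction determined by a coordinate system. -/
noncomputable def chartRotation (g : TangentForm S) (φ : OpenPartialHomeomorph S E2) (b : S) :
    E2 →L[ℝ] E2 :=
  (paramDeriv φ.symm (φ b)).comp
    ((matEndo (rotation (metricComp g φ (φ b)))).comp (coordDeriv φ b))

theorem chartRotation_apply (g : TangentForm S) (φ : OpenPartialHomeomorph S E2) (b : S) (v : E2) :
    chartRotation g φ b v =
      paramDeriv φ.symm (φ b) (matEndo (rotation (metricComp g φ (φ b))) (coordDeriv φ b v)) := rfl

variable {g : TangentForm S} {φ ψ : OpenPartialHomeomorph S E2} {b : S}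

theorem formAt_paramDeriv (g : TangentForm S) (φ : OpenPartialHomeomorph S E2) (y : E2) (v w : E2) :
    formAt g (φ.symm y) (paramDeriv φ.symm y v) (paramDeriv φ.symm y w) =
      (v : Fin 2 → ℝ) ⬝ᵥ metricComp g φ y *ᵥ (w : Fin 2 → ℝ) := by
  conv_lhs => rw [euclidean_eq_sum v, euclidean_eq_sum w]
  simp only [Fin.sum_univ_two, map_add (paramDeriv φ.symm y), map_smul (paramDeriv φ.symm y)]
  refine (bilin_expand (formAt g (φ.symm y)) _ _ _ _ _ _ _ _).trans ?_
  have hm : ∀ i j, metricComp g φ y i j = formAt g (φ.symm y)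
      (paramDeriv φ.symm y (baseBasis i)) (paramDeriv φ.symm y (baseBasis j)) := fun i j => rfl
  simp only [dotProduct, Matrix.mulVec, Fin.sum_univ_two, hm]
  ring

theorem chartRotation_sq (hg : IsSmoothMetric g) (hφ : IsSmoothChart φ) (hb : b ∈ φ.source)
    (v : E2) : chartRotation g φ b (chartRotation g φ b v) = -v := by
  have h := hφ.coordDeriv_paramDeriv (φ.map_source hb)
  rw [φ.left_inv hb] at h
  rw [chartRotation_apply, chartRotation_apply, h, ← matEndo_mul_apply,
    rotation_mul_self (hg.metricComp_posDef hφ (φ.map_source hb)), matEndo_neg_one_apply, map_neg,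
    hφ.paramDeriv_coordDeriv hb]

theorem chartRotation_orth (hg : IsSmoothMetric g) (hφ : IsSmoothChart φ) (hb : b ∈ φ.source)
    (v w : E2) : formAt g b (chartRotation g φ b v) (chartRotation g φ b w) = formAt g b v w := by
  have hp := hg.metricComp_posDef hφ (φ.map_source hb)
  have h := formAt_paramDeriv g φ (φ b)
  rw [φ.left_inv hb] at h
  conv_rhs => rw [← hφ.paramDeriv_coordDeriv hb v, ← hφ.paramDeriv_coordDeriv hb w]
  rw [chartRotation_apply, chartRotation_apply, h, h]
  have e : ∀ u : E2, ((matEndo (rotation (metricComp g φ (φ b))) u : E2) : Fin 2 → ℝ) =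
    rotation (metricComp g φ (φ b)) *ᵥ (u : Fin 2 → ℝ) := fun u => rfl
  conv_rhs => rw [← transpose_rotation_mul_mul hp]
  rw [e, e, ← Matrix.mulVec_mulVec, ← Matrix.mulVec_mulVec, Matrix.dotProduct_mulVec _ (_ᵀ),
    Matrix.vecMul_transpose]

/-- The rotations determined by two coordinate systems agree up to the sign of the Jacobian. -/
theorem chartRotation_eq (hg : IsSmoothMetric g) (hφ : IsSmoothChart φ) (hψ : IsSmoothChart ψ)
    (hb : b ∈ φ.source) (hb' : b ∈ ψ.source) (v : E2) :
    (jacobian (fun z => ψ (φ.symm z)) (φ b)).det ≠ 0 ∧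
    chartRotation g φ b v = ((jacobian (fun z => ψ (φ.symm z)) (φ b)).det /
      |(jacobian (fun z => ψ (φ.symm z)) (φ b)).det|) • chartRotation g ψ b v := by
  have hq := hφ.contMDiffAt_symm (φ.map_source hb)
  have hl := φ.left_inv hb
  have h1 := metricAlong_eq g hψ hq (by rwa [hl])
  have h2 := hψ.paramDeriv_eq hq (by rwa [hl])
  have h3 := hψ.coordDeriv_eq_fderiv hq (by rwa [hl])
  rw [hl] at h1 h2 h3
  rw [← matEndo_jacobian] at h2 h3
  change metricComp g φ (φ b) = _ at h1
  set N := jacobian (fun z => ψ (φ.symm z)) (φ b)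
  refine ⟨fun h0 => ?_, ?_⟩
  · have := (hg.metricComp_posDef hφ (φ.map_source hb)).det_pos
    rw [h1, Matrix.det_mul, h0, mul_zero] at this
    exact this.false
  · rw [chartRotation_apply, h1, h2, ← matEndo_mul_apply, mul_rotation_congruence,
      matEndo_smul_apply, map_smul, matEndo_mul_apply, ← h3, hφ.paramDeriv_coordDeriv hb]
    rfl

/-- A field of rotations that is locally, up to a constant sign, the one determined by any
coordinate system. -/
def IsOrientationField (g : TangentForm S) (U : Set S) (j : TangentEndo S) : Prop :=
  ∀ φ : OpenPartialHomeomorph S E2, IsSmoothChart φ → ∀ b ∈ U ∩ φ.source, ∃ ε : ℤˣ,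
    ∀ᶠ b' in 𝓝 b, ∀ v, endoAt j b' v = ε • chartRotation g φ b' v

/-- The sign is that of the Jacobian determinant of the coordinate change, which is continuous and
nowhere zero. -/
theorem chartRotation_sign (hg : IsSmoothMetric g) (hφ : IsSmoothChart φ) (hψ : IsSmoothChart ψ)
    (hb : b ∈ φ.source ∩ ψ.source) : ∃ ε : ℤˣ, ∀ᶠ b' in 𝓝 b, ∀ v,
      chartRotation g φ b' v = ε • chartRotation g ψ b' v := by
  have hq := hφ.contMDiffAt_symm (φ.map_source hb.1)
  have hl := φ.left_inv hb.1
  have hT : ContDiffAt ℝ ∞ (fun z => ψ (φ.symm z)) (φ b) :=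
    hψ.contDiffAt_comp hq (by rw [hl]; exact hb.2)
  have hdet : ContinuousAt (fun b' => (jacobian (fun z => ψ (φ.symm z)) (φ b')).det) b := by
    have h1 : ContinuousAt (fun z => (jacobian (fun z => ψ (φ.symm z)) z).det) (φ b) :=
      (contDiffAt_det (contDiffAt_jacobian hT)).continuousAt
    exact ContinuousAt.comp (f := φ) h1 (φ.continuousAt hb.1)
  have hev : ∀ᶠ b' in 𝓝 b, b' ∈ φ.source ∩ ψ.source :=
    (φ.open_source.inter ψ.open_source).mem_nhds hb
  rcases lt_or_gt_of_ne (chartRotation_eq hg hφ hψ hb.1 hb.2 0).1 with h0 | h0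
  · refine ⟨-1, ?_⟩
    filter_upwards [hdet.eventually (gt_mem_nhds h0), hev] with b' hb' hs v
    rw [(chartRotation_eq hg hφ hψ hs.1 hs.2 v).2, abs_of_neg hb', div_neg, div_self hb'.ne]
    simp
  · refine ⟨1, ?_⟩
    filter_upwards [hdet.eventually (lt_mem_nhds h0), hev] with b' hb' hs v
    rw [(chartRotation_eq hg hφ hψ hs.1 hs.2 v).2, abs_of_pos hb', div_self hb'.ne']
    simp

theorem sign_unique (hg : IsSmoothMetric g) (hφ : IsSmoothChart φ) (hb : b ∈ φ.source) {ε δ : ℤˣ}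
    (h : ∀ v, ε • chartRotation g φ b v = δ • chartRotation g φ b v) : ε = δ := by
  have h1 : ∀ v : E2, ε • v = δ • v := fun v => by
    have := h (chartRotation g φ b v)
    rw [chartRotation_sq hg hφ hb] at this
    simpa using this
  have h2 := congrArg (fun v : E2 => v 0) (h1 (baseBasis 0))
  rcases Int.units_eq_one_or ε with rfl | rfl <;> rcases Int.units_eq_one_or δ with rfl | rfl <;>
    simp [baseBasis] at h2 ⊢ <;> norm_num at h2

/-- The signs comparing the rotations of any two smooth coordinate systems form a locally constant
cocycle, which is a coboundary on the simply connected set. Correcting each rotation by its sign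
makes them agree on overlaps. -/
theorem exists_orientationField [IsManifold 𝓘(ℝ, E2) ∞ S] (hg : IsSmoothMetric g) {U : Set S}
    (hU : IsOpen U) [SimplyConnectedSpace U] : ∃ j : TangentEndo S, IsOrientationField g U j := by
  classical
  have : LocallyPathConnectedSpace S := ChartedSpace.locallyPathConnectedSpace E2 S
  have : LocallyPathConnectedSpace U := hU.locallyPathConnectedSpace
  let K := {φ : OpenPartialHomeomorph S E2 // IsSmoothChart φ}
  let V : K → Set U := fun k => Subtype.val ⁻¹' k.1.source
  have hc : ∀ k l : K, ∀ y : U, ∃ ε : ℤˣ, y ∈ V k ∩ V l → ∀ v,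
      chartRotation g l.1 y v = ε • chartRotation g k.1 y v := fun k l y => by
    by_cases hy : y ∈ V k ∩ V l
    · obtain ⟨ε, h⟩ := chartRotation_sign hg l.2 k.2 hy.symm
      exact ⟨ε, fun _ => h.self_of_nhds⟩
    · exact ⟨1, fun h => absurd h hy⟩
  choose c hc using hc
  have hVo : ∀ k, IsOpen (V k) := fun k => k.1.open_source.preimage continuous_subtype_val
  have hcc : ∀ k l, ∀ y ∈ V k ∩ V l, ∀ᶠ y' in 𝓝 y, c k l y' = c k l y := by
    intro k l y hy
    obtain ⟨ε, h⟩ := chartRotation_sign hg l.2 k.2 hy.symm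
    have h' := (continuous_subtype_val.tendsto y).eventually h
    have key : ∀ y' : U, y' ∈ V k ∩ V l → (∀ v, chartRotation g l.1 y' v =
        ε • chartRotation g k.1 y' v) → c k l y' = ε := fun y' hy' e =>
      sign_unique hg k.2 hy'.1 fun v => by rw [← hc k l y' hy', e]
    filter_upwards [h', ((hVo k).inter (hVo l)).mem_nhds hy] with y' e hy'
    rw [key y' hy' e, key y hy h.self_of_nhds]
  obtain ⟨h, hh, hhc⟩ := exists_locally_constant_trivialization V hVo
    (fun y => ⟨⟨chartAt E2 y.1, isSmoothChart_of_mem_atlas (chart_mem_atlas E2 y.1)⟩,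
      mem_chart_source E2 y.1⟩) c hcc (fun k l m y hy => by
        refine sign_unique hg k.2 hy.1.1 fun v => ?_
        rw [← hc k m y ⟨hy.1.1, hy.2⟩, hc l m y ⟨hy.1.2, hy.2⟩, hc k l y hy.1, mul_smul])
  -- The field is written with the preferred coordinate system at each point and is zero off `U`;
  -- `hj` shows that every other coordinate system gives the same value, since a sign is its own
  -- inverse.
  let j : TangentEndo S := fun b => show E2 →L[ℝ] E2 from
    if hb : b ∈ U then h ⟨chartAt E2 b, isSmoothChart_of_mem_atlas (chart_mem_atlas E2 b)⟩ ⟨b, hb⟩ •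
      chartRotation g (chartAt E2 b) b else 0
  have hj : ∀ (k : K) (y : U), y ∈ V k → ∀ v, endoAt j y v = h k y • chartRotation g k.1 y v := by
    intro k y hy v
    set k' : K := ⟨chartAt E2 y.1, isSmoothChart_of_mem_atlas (chart_mem_atlas E2 y.1)⟩
    have hy' : y ∈ V k' := mem_chart_source E2 y.1
    have e : endoAt j y v = h k' y • chartRotation g k'.1 y v := by
      simp only [endoAt, j, y.2, dif_pos]
      rfl
    rw [e, hhc k k' y ⟨hy, hy'⟩, hc k k' y ⟨hy, hy'⟩, smul_smul]
    congr 1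
    rw [mul_right_comm, Int.units_mul_self, one_mul]
  refine ⟨j, fun φ hφ b hb => ⟨h ⟨φ, hφ⟩ ⟨b, hb.1⟩, ?_⟩⟩
  have h1 := hh ⟨φ, hφ⟩ ⟨b, hb.1⟩ hb.2
  have h2 : ∀ᶠ b' in 𝓝 b, ∀ hb' : b' ∈ U, h ⟨φ, hφ⟩ ⟨b', hb'⟩ = h ⟨φ, hφ⟩ ⟨b, hb.1⟩ := by
    rw [← hU.isOpenEmbedding_subtypeVal.map_nhds_eq ⟨b, hb.1⟩, Filter.eventually_map]
    filter_upwards [h1] with y e _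
    exact e
  filter_upwards [h2, (hU.inter φ.open_source).mem_nhds hb] with b' e hb' v
  rw [← e hb'.1]
  exact hj ⟨φ, hφ⟩ ⟨b', hb'.1⟩ hb'.2 v

end Orientation

end CoordGeom

namespace CoordGeom

/-! ### From a pointwise conformal alternative to a global orientation. -/

section Holomorphic

variable {S : Type*} [TopologicalSpace S] [ChartedSpace E2 S]

/-- The differential of a function, as a form on the plane. -/
noncomputable def funDeriv (f : S → ℝ) (b : S) : E2 →L[ℝ] ℝ := mfderiv 𝓘(ℝ, E2) 𝓘(ℝ, ℝ) f b

theorem pd_comp_param {f : S → ℝ} {q : E2 → S} {y : E2}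
    (hf : ContMDiffAt 𝓘(ℝ, E2) 𝓘(ℝ, ℝ) ∞ f (q y))
    (hq : ContMDiffAt 𝓘(ℝ, E2) 𝓘(ℝ, E2) ∞ q y) (a : Fin 2) :
    pd baseBasis a (fun z => f (q z)) y = funDeriv f (q y) (paramDeriv q y (baseBasis a)) := by
  have h1 := mfderiv_comp y (hf.mdifferentiableAt (by simp)) (hq.mdifferentiableAt (by simp))
  rw [show f ∘ q = fun z => f (q z) from rfl, mfderiv_eq_fderiv] at h1
  exact congrArg (fun L : E2 →L[ℝ] ℝ => L (baseBasis a)) h1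

variable {g : TangentForm S} {φ ψ : OpenPartialHomeomorph S E2} {b : S} {y : E2}

theorem chartRotation_paramDeriv (hφ : IsSmoothChart φ) (hy : y ∈ φ.target) (v : E2) :
    chartRotation g φ (φ.symm y) (paramDeriv φ.symm y v) =
      paramDeriv φ.symm y (matEndo (rotation (metricComp g φ y)) v) := by
  rw [chartRotation_apply, φ.right_inv hy, hφ.coordDeriv_paramDeriv hy]

theorem crDefect_eq {x s : S → ℝ} (hφ : IsSmoothChart φ) (hy : y ∈ φ.target)
    (hx : ContMDiffAt 𝓘(ℝ, E2) 𝓘(ℝ, ℝ) ∞ x (φ.symm y))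
    (hs : ContMDiffAt 𝓘(ℝ, E2) 𝓘(ℝ, ℝ) ∞ s (φ.symm y)) (σ : ℝ) (a : Fin 2) :
    crDefect (metricComp g φ) (fun z => x (φ.symm z)) (fun z => s (φ.symm z)) σ a y =
      funDeriv s (φ.symm y) (paramDeriv φ.symm y (baseBasis a)) + σ * funDeriv x (φ.symm y)
        (chartRotation g φ (φ.symm y) (paramDeriv φ.symm y (baseBasis a))) := by
  rw [chartRotation_paramDeriv hφ hy, euclidean_eq_sum (matEndo _ _), crDefect,
    pd_comp_param hs (hφ.contMDiffAt_symm hy)]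
  simp only [pd_comp_param hx (hφ.contMDiffAt_symm hy), matEndo_baseBasis, map_sum, map_smul,
    smul_eq_mul, mul_comm]

theorem IsOrientationField.isRotationField [IsManifold 𝓘(ℝ, E2) ∞ S] (hg : IsSmoothMetric g)
    {U : Set S} {j : TangentEndo S} (hj : IsOrientationField g U j) : IsRotationField g U j := by
  have hc := fun b : S => isSmoothChart_of_mem_atlas (chart_mem_atlas E2 b)
  refine ⟨fun b hb v => ?_, fun b hb v w => ?_, fun φ hφ α β y hy => ?_⟩
  · obtain ⟨ε, hε⟩ := hj _ (hc b) b ⟨hb, mem_chart_source E2 b⟩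
    have h := hε.self_of_nhds
    suffices H : ∀ v : E2, endoAt j b (endoAt j b v) = -v from H v
    intro v
    have hsq := chartRotation_sq hg (hc b) (mem_chart_source E2 b) v
    rw [h, h]
    rcases Int.units_eq_one_or ε with rfl | rfl <;> simpa using hsq
  · obtain ⟨ε, hε⟩ := hj _ (hc b) b ⟨hb, mem_chart_source E2 b⟩
    have h := hε.self_of_nhds
    suffices H : ∀ v w : E2, formAt g b (endoAt j b v) (endoAt j b w) = formAt g b v w from H v w
    intro v w
    have ho := chartRotation_orth hg (hc b) (mem_chart_source E2 b) v w
    rw [h, h]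
    rcases Int.units_eq_one_or ε with rfl | rfl <;> simpa using ho
  · have hs := isSmoothChart_of_mem_atlas hφ
    obtain ⟨ε, hε⟩ := hj φ hs (φ.symm y) ⟨hy.2, φ.map_target hy.1⟩
    have h1 : (fun z => endoComp j φ z α β) =ᶠ[𝓝 y]
        fun z => ((ε : ℤ) : ℝ) * rotation (metricComp g φ z) α β := by
      filter_upwards [(φ.symm.continuousAt hy.1).eventually hε, φ.open_target.mem_nhds hy.1]
        with z hz hz'
      change coordDeriv φ (φ.symm z) (endoAt j (φ.symm z) (paramDeriv φ.symm z (baseBasis β))) α = _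
      rw [hz, chartRotation_paramDeriv hs hz']
      rcases Int.units_eq_one_or ε with rfl | rfl <;>
        simp [hs.coordDeriv_paramDeriv hz', matEndo_baseBasis]
    refine ContDiffAt.contDiffWithinAt (ContDiffAt.congr_of_eventuallyEq ?_ h1)
    exact contDiffAt_const.mul (contDiffAt_rotation (hg.smooth φ hs y hy.1)
      (hg.metricComp_posDef hs hy.1) α β)

theorem IsOrientationField.neg {U : Set S} {j : TangentEndo S} (hj : IsOrientationField g U j) :
    IsOrientationField g U (fun b => show E2 →L[ℝ] E2 from -endoAt j b) := by
  intro φ hφ b hb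
  obtain ⟨ε, hε⟩ := hj φ hφ b hb
  refine ⟨-ε, ?_⟩
  filter_upwards [hε] with b' h v
  change -(endoAt j b' v) = _
  rw [h, Units.neg_smul]

/-- The differentials of `x` and `s` satisfy the Cauchy-Riemann equation `ds + σ dx ∘ j = 0`. -/
def IsCauchyRiemannAt (j : TangentEndo S) (x s : S → ℝ) (σ : ℝ) (b : S) : Prop :=
  ∀ v, funDeriv s b v + σ * funDeriv x b (endoAt j b v) = 0

/-- The number `δ` is the locally constant sign of `j` relative to the coordinate system. It
translates the invariant Cauchy–Riemann equation into vanishing of `crDefect`, where unique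
continuation is available. -/
theorem IsOrientationField.isCauchyRiemannAt_iff {U : Set S} {j : TangentEndo S}
    (hj : IsOrientationField g U j) (hU : IsOpen U) {x s : S → ℝ}
    (hx : ∀ b ∈ U, ContMDiffAt 𝓘(ℝ, E2) 𝓘(ℝ, ℝ) ∞ x b)
    (hs : ∀ b ∈ U, ContMDiffAt 𝓘(ℝ, E2) 𝓘(ℝ, ℝ) ∞ s b) (hφ : IsSmoothChart φ)
    (hb : b ∈ U ∩ φ.source) : ∃ δ : ℝ, (δ = 1 ∨ δ = -1) ∧ ∀ᶠ y in 𝓝 (φ b),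
      y ∈ φ.target ∧ φ.symm y ∈ U ∧ ∀ σ, IsCauchyRiemannAt j x s σ (φ.symm y) ↔
        ∀ a, crDefect (metricComp g φ) (fun z => x (φ.symm z)) (fun z => s (φ.symm z))
          (σ * δ) a y = 0 := by
  obtain ⟨ε, hε⟩ := hj φ hφ b hb
  have hc : Filter.Tendsto φ.symm (𝓝 (φ b)) (𝓝 b) := by
    have := φ.symm.continuousAt (φ.map_source hb.2)
    rwa [ContinuousAt, φ.left_inv hb.2] at this
  refine ⟨((ε : ℤ) : ℝ), ?_, ?_⟩
  · rcases Int.units_eq_one_or ε with rfl | rfl <;> simp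
  · filter_upwards [φ.open_target.mem_nhds (φ.map_source hb.2), hc.eventually hε,
      hc.eventually (hU.mem_nhds hb.1)] with y hy h hyU
    refine ⟨hy, hyU, fun σ => ?_⟩
    have e : ∀ v, funDeriv s (φ.symm y) v + σ * funDeriv x (φ.symm y) (endoAt j (φ.symm y) v) =
        funDeriv s (φ.symm y) v + (σ * ((ε : ℤ) : ℝ)) *
          funDeriv x (φ.symm y) (chartRotation g φ (φ.symm y) v) := by
      intro v
      rw [h]
      rcases Int.units_eq_one_or ε with rfl | rfl <;> simp
    constructor
    · intro hcr a
      rw [crDefect_eq hφ hy (hx _ hyU) (hs _ hyU), ← e]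
      exact hcr _
    · intro hcr v
      have hcr' : ∀ a, funDeriv s (φ.symm y) (paramDeriv φ.symm y (baseBasis a)) +
          (σ * ((ε : ℤ) : ℝ)) * funDeriv x (φ.symm y)
            (chartRotation g φ (φ.symm y) (paramDeriv φ.symm y (baseBasis a))) = 0 := fun a => by
        rw [← crDefect_eq hφ hy (hx _ hyU) (hs _ hyU)]
        exact hcr a
      have hv := hφ.paramDeriv_coordDeriv (φ.map_target hy) v
      rw [φ.right_inv hy] at hv
      rw [e, ← hv, euclidean_eq_sum (coordDeriv φ (φ.symm y) v)]
      simp only [Fin.sum_univ_two, map_add, map_smul, smul_eq_mul]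
      linear_combination (coordDeriv φ (φ.symm y) v 0) * hcr' 0 +
        (coordDeriv φ (φ.symm y) v 1) * hcr' 1

/-- A harmonic map that is at each point conformal or anticonformal is holomorphic for one of the
two orientations. -/
theorem exists_holomorphic_orientation [IsManifold 𝓘(ℝ, E2) ∞ S] (hg : IsSmoothMetric g)
    {U : Set S} (hU : IsOpen U) [SimplyConnectedSpace U] {x s : S → ℝ}
    (hx : ∀ b ∈ U, ContMDiffAt 𝓘(ℝ, E2) 𝓘(ℝ, ℝ) ∞ x b)
    (hs : ∀ b ∈ U, ContMDiffAt 𝓘(ℝ, E2) 𝓘(ℝ, ℝ) ∞ s b)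
    (hloc : ∀ b ∈ U, ∃ ψ : OpenPartialHomeomorph S E2, IsSmoothChart ψ ∧ b ∈ ψ.source ∧
      ∀ y ∈ ψ.target, ψ.symm y ∈ U →
        laplacian baseBasis (metricComp g ψ) (fun z => x (ψ.symm z)) y = 0 ∧
        laplacian baseBasis (metricComp g ψ) (fun z => s (ψ.symm z)) y = 0 ∧
        ∃ σ : ℝ, (σ = 1 ∨ σ = -1) ∧ ∀ a,
          crDefect (metricComp g ψ) (fun z => x (ψ.symm z)) (fun z => s (ψ.symm z)) σ a y = 0) :
    ∃ j, IsOrientationField g U j ∧ ∀ b ∈ U, IsCauchyRiemannAt j x s 1 b := by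
  obtain ⟨j, hj⟩ := exists_orientationField hg hU
  have hUc : IsPreconnected U := isPreconnected_iff_preconnectedSpace.2 inferInstance
  by_cases h1 : ∀ b ∈ U, IsCauchyRiemannAt j x s 1 b
  · exact ⟨j, hj, h1⟩
  refine ⟨_, hj.neg, fun b hb v => ?_⟩
  -- The equation with sign `1` fails somewhere, so the opposite orientation is used. The equation
  -- with sign `-1` for `j` has to hold throughout, by connectedness applied to the interior of its
  -- solution set.
  suffices h : U ⊆ interior {b | IsCauchyRiemannAt j x s (-1) b} by
    have := interior_subset (h hb) v
    change _ + 1 * funDeriv x b (-endoAt j b v) = 0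
    rw [map_neg, one_mul, ← neg_one_mul]
    exact this
  have hsm : ∀ (ψ : OpenPartialHomeomorph S E2), IsSmoothChart ψ → ∀ y ∈ ψ.target, ψ.symm y ∈ U →
      ContDiffAt ℝ ∞ (fun z => x (ψ.symm z)) y ∧ ContDiffAt ℝ ∞ (fun z => s (ψ.symm z)) y :=
    fun ψ hψ y hy hyU =>
      ⟨(ContMDiffAt.comp y (hx _ hyU) (hψ.contMDiffAt_symm hy)).contDiffAt,
        (ContMDiffAt.comp y (hs _ hyU) (hψ.contMDiffAt_symm hy)).contDiffAt⟩
  refine hUc.subset_of_closure_inter_subset isOpen_interior ?_ ?_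
  -- Where the defect of sign `1` is nonzero it stays nonzero nearby, and the pointwise alternative
  -- then forces the equation of sign `-1` on a neighbourhood.
  · push Not at h1
    obtain ⟨b, hb, hb1⟩ := h1
    refine ⟨b, hb, mem_interior_iff_mem_nhds.2 ?_⟩
    obtain ⟨ψ, hψ, hbψ, hl⟩ := hloc b hb
    obtain ⟨δ, hδ, hev⟩ := hj.isCauchyRiemannAt_iff hU hx hs hψ ⟨hb, hbψ⟩
    have hev' := (ψ.continuousAt hbψ).eventually hev
    have hself := hev.self_of_nhds
    rw [ψ.left_inv hbψ] at hself
    have hb2 := (not_congr (hself.2.2 1)).1 hb1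
    push Not at hb2
    obtain ⟨a, ha⟩ := hb2
    have hyt := ψ.map_source hbψ
    have hyU : ψ.symm (ψ b) ∈ U := by rwa [ψ.left_inv hbψ]
    have hcont : ContinuousAt (crDefect (metricComp g ψ) (fun z => x (ψ.symm z))
        (fun z => s (ψ.symm z)) (1 * δ) a) (ψ b) := by
      obtain ⟨sx, ss⟩ := hsm ψ hψ _ hyt hyU
      exact ((ss.pd a).add (contDiffAt_const.mul (ContDiffAt.sum fun i _ =>
        (sx.pd i).mul (contDiffAt_rotation (hg.smooth ψ hψ _ hyt)
          (hg.metricComp_posDef hψ hyt) i a)))).continuousAt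
    filter_upwards [hev', ((hcont.comp (f := ψ) (ψ.continuousAt hbψ)).eventually_ne ha),
      ψ.open_source.mem_nhds hbψ] with b' h h' hs'
    obtain ⟨ht, hU', hiff⟩ := h
    rw [ψ.left_inv hs'] at hU' hiff
    obtain ⟨-, -, σ, hσ, hcr⟩ := hl (ψ b') ht (by rwa [ψ.left_inv hs'])
    rw [hiff]
    have hne : σ ≠ 1 * δ := by
      rintro rfl
      exact h' (hcr a)
    have : σ = -1 * δ := by
      rcases hσ with rfl | rfl <;> rcases hδ with rfl | rfl <;>
        first | (norm_num; done) | exact absurd (by norm_num) hne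
    rw [← this]
    exact hcr
  -- A coordinate disc about a limit point meets the interior of the solution set, so unique
  -- continuation gives the equation on the whole disc.
  · rintro q ⟨hq, hqU⟩
    obtain ⟨ψ, hψ, hqψ, hl⟩ := hloc q hqU
    obtain ⟨δ, hδ, hev⟩ := hj.isCauchyRiemannAt_iff hU hx hs hψ ⟨hqU, hqψ⟩
    obtain ⟨ρ, hρ, hball⟩ := Metric.eventually_nhds_iff_ball.1 hev
    set O := Metric.ball (ψ q) ρ
    have hOt : O ⊆ ψ.target := fun y hy => (hball y hy).1
    have hN : ψ.source ∩ ψ ⁻¹' O ∈ 𝓝 q :=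
      Filter.inter_mem (ψ.open_source.mem_nhds hqψ)
        (ψ.continuousAt hqψ (Metric.ball_mem_nhds _ hρ))
    obtain ⟨q', hq'N, hq'⟩ := mem_closure_iff_nhds.1 hq _ hN
    have key := crDefect_eq_zero_of_eq_zero (g := metricComp g ψ) (x := fun z => x (ψ.symm z))
      (s := fun z => s (ψ.symm z)) (σ := -1 * δ) (O := O)
      (W := O ∩ ψ.symm ⁻¹' interior {b | IsCauchyRiemannAt j x s (-1) b}) Metric.isOpen_ball
      (convex_ball _ _).isPreconnected (fun y hy => hg.smooth ψ hψ y (hOt hy))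
      (fun y hy => hg.metricComp_posDef hψ (hOt hy)) (hg.metricComp_symm ψ)
      (fun y hy => (hsm ψ hψ y (hOt hy) (hball y hy).2.1).1)
      (fun y hy => (hsm ψ hψ y (hOt hy) (hball y hy).2.1).2)
      (fun y hy => (hl y (hOt hy) (hball y hy).2.1).1)
      (fun y hy => (hl y (hOt hy) (hball y hy).2.1).2.1)
      ((ψ.symm.continuousOn.mono hOt).isOpen_inter_preimage Metric.isOpen_ball isOpen_interior)
      ⟨ψ q', hq'N.2, hq'N.2, by
        refine mem_preimage.2 ?_
        rwa [ψ.left_inv hq'N.1]⟩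
      (fun y hy => ((hball y hy.1).2.2 (-1)).1
        (interior_subset (s := {b | IsCauchyRiemannAt j x s (-1) b}) hy.2))
    refine mem_interior_iff_mem_nhds.2 (Filter.mem_of_superset hN fun b hb => ?_)
    have := ((hball _ hb.2).2.2 (-1)).2 (key _ hb.2)
    rwa [ψ.left_inv hb.1] at this

end Holomorphic

end CoordGeom

namespace CoordGeom

open Sum

/-! ### The conformal equations in an arbitrary constant fibre frame. -/

section FlatFrame

variable {g G A : E2 → Matrix (Fin 2) (Fin 2) ℝ} {y : E2}

/-- The derivative along a coordinate vector of `ℝ² × ℝ²` of a function of the base point. -/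
noncomputable def basePd (i : Fin 2 ⊕ Fin 2) (f : E2 → ℝ) : E2 → ℝ :=
  Sum.elim (fun α => pd baseBasis α f) (fun _ _ => 0) i

theorem pd_comp_fst {eT : Fin 2 ⊕ Fin 2 → E2 × (Fin 2 → ℝ)} (h : ∀ α, (eT (inl α)).1 = baseBasis α)
    (h' : ∀ I, (eT (inr I)).1 = 0) (i : Fin 2 ⊕ Fin 2) (f : E2 → ℝ) :
    pd eT i (fun r => f r.1) = fun r => basePd i f r.1 := by
  rcases i with α | I
  · exact pd_base h α f
  · exact pd_fibre h' I f

/-- Nothing depends on the fibre coordinates, so changing the basis vectors by vertical vectors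
changes no derivative. Hence a new fibre frame can be recorded in the matrices `G` and `A` alone,
with the standard basis kept. -/
theorem ricci_bundleMetric_congr_basis {eT eT' : Fin 2 ⊕ Fin 2 → E2 × (Fin 2 → ℝ)}
    (h : ∀ α, (eT (inl α)).1 = baseBasis α) (h' : ∀ I, (eT (inr I)).1 = 0)
    (k : ∀ α, (eT' (inl α)).1 = baseBasis α) (k' : ∀ I, (eT' (inr I)).1 = 0)
    (i j : Fin 2 ⊕ Fin 2) (q : E2 × (Fin 2 → ℝ)) :
    ricci eT (bundleMetric g G A) i j q = ricci eT' (bundleMetric g G A) i j q := by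
  let f : E2 → Matrix (Fin 2 ⊕ Fin 2) (Fin 2 ⊕ Fin 2) ℝ := fun z => bundleMetric g G A (z, 0)
  let Γ : Fin 2 ⊕ Fin 2 → Fin 2 ⊕ Fin 2 → Fin 2 ⊕ Fin 2 → E2 → ℝ := fun l i j z =>
    (1 / 2) * ∑ m, (f z)⁻¹ l m * (basePd i (fun r => f r m j) z + basePd j (fun r => f r i m) z
      - basePd m (fun r => f r i j) z)
  have hΓ : ∀ {eT : Fin 2 ⊕ Fin 2 → E2 × (Fin 2 → ℝ)}, (∀ α, (eT (inl α)).1 = baseBasis α) →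
      (∀ I, (eT (inr I)).1 = 0) → ∀ l i j,
      christoffel eT (bundleMetric g G A) l i j = fun r => Γ l i j r.1 := by
    intro eT h h' l i j
    ext r
    have e : ∀ i m j, pd eT i (fun r => bundleMetric g G A r m j) r =
        basePd i (fun r => f r m j) r.1 := fun i m j =>
      congrFun (pd_comp_fst h h' i (fun r => f r m j)) r
    simp only [christoffel, e]
    rfl
  have hR : ∀ {eT : Fin 2 ⊕ Fin 2 → E2 × (Fin 2 → ℝ)}, (∀ α, (eT (inl α)).1 = baseBasis α) →
      (∀ I, (eT (inr I)).1 = 0) → ricci eT (bundleMetric g G A) i j q =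
      ∑ a, (basePd a (Γ a j i) q.1 - basePd j (Γ a a i) q.1 +
        ∑ m, (Γ a a m q.1 * Γ m j i q.1 - Γ a j m q.1 * Γ m a i q.1)) := by
    intro eT h h'
    have e : ∀ i f, pd eT i (fun r => f r.1) q = basePd i f q.1 := fun i f =>
      congrFun (pd_comp_fst h h' i f) q
    simp only [ricci, riemann, hΓ h h', e]
  rw [hR h h', hR k k']

theorem planeBasis_one : planeBasis 1 = baseBasis := by
  ext α i
  fin_cases α <;> fin_cases i <;> simp [planeBasis, baseBasis,
    Matrix.one_apply]

/-- `harmonic_conformal` in a constant frame of the fibres. -/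
theorem harmonic_conformal_frame (hg : ∀ i j, ContDiffAt ℝ ∞ (fun r => g r i j) y)
    (hG : ∀ i j, ContDiffAt ℝ ∞ (fun r => G r i j) y)
    (hA : ∀ i j, ContDiffAt ℝ ∞ (fun r => A r i j) y)
    (hgp : (g y).PosDef) (hGp : (G y).PosDef) (hgs : ∀ r i j, g r i j = g r j i)
    (hGs : ∀ᶠ r in 𝓝 y, ∀ i j, G r i j = G r j i) {x : Fin 2 → ℝ}
    (hR : ∀ i j, ricci totalBasis (bundleMetric g G A) i j (y, x) = 0)
    (hF : ∀ I, pd baseBasis 0 (fun z => A z I 1) y = pd baseBasis 1 (fun z => A z I 0) y)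
    {c : ℝ} (hdet : ∀ᶠ r in 𝓝 y, (G r).det = c) {h : Matrix (Fin 2) (Fin 2) ℝ}
    (hh : IsUnit h.det) :
    laplacian baseBasis g (fun r => (hᵀ * G r * h) 0 1 / (hᵀ * G r * h) 0 0) y = 0 ∧
    laplacian baseBasis g (fun r => √(hᵀ * G r * h).det / (hᵀ * G r * h) 0 0) y = 0 ∧
    ∃ σ : ℝ, (σ = 1 ∨ σ = -1) ∧ ∀ a, crDefect g
      (fun r => (hᵀ * G r * h) 0 1 / (hᵀ * G r * h) 0 0)
      (fun r => √(hᵀ * G r * h).det / (hᵀ * G r * h) 0 0) σ a y = 0 := by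
  have hA' : ∀ i j, ContDiffAt ℝ ∞ (fun r => (h⁻¹ * ((A r - 0) * (1 : Matrix (Fin 2) (Fin 2) ℝ))) i j) y := fun i j => by
    simp only [sub_zero, mul_one, Matrix.mul_apply]
    exact ContDiffAt.sum fun m _ => contDiffAt_const.mul (hA m j)
  have hF' : ∀ I, pd baseBasis 0 (fun z => (h⁻¹ * ((A z - 0) * (1 : Matrix (Fin 2) (Fin 2) ℝ))) I 1) y =
      pd baseBasis 1 (fun z => (h⁻¹ * ((A z - 0) * (1 : Matrix (Fin 2) (Fin 2) ℝ))) I 0) y := by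
    intro I
    have := curvature_change (p := 1) (r := h) (A0 := 0) hA I
    rw [planeBasis_one] at this
    rw [← sub_eq_zero, this]
    simp [hF]
  have hgp1 : (1 : Matrix (Fin 2) (Fin 2) ℝ)ᵀ * g y * 1 = g y := by simp
  refine harmonic_conformal (x := x) hg (fun i j => contDiffAt_congruence hG _ _ i j) hA' hgp ?_ hgs ?_ ?_ hF'
    (c := h.det ^ 2 * c) ?_
  · have := hGp.conjTranspose_mul_mul_same (B := h)
      (Matrix.mulVec_injective_of_isUnit ((Matrix.isUnit_iff_isUnit_det h).2 hh))
    simpa using this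
  · filter_upwards [hGs] with r hr
    exact symm_congruence hr
  · intro i j
    have := ricci_bundle_change (p := 1) (r := h) (A0 := 0) hg hG hA (by simp) hh hgp.det_pos.ne'
      hGp.det_pos.ne' hR i j
    rw [ricci_bundleMetric_congr_basis (eT' := totalBasis)
      (fun α => by rw [bundleBasis_inl, planeBasis_one]) bundleBasis_inr
      (fun α => rfl) (fun I => rfl)] at this
    simpa using this
  · filter_upwards [hdet] with r hr
    rw [Matrix.det_mul, Matrix.det_mul, Matrix.det_transpose, hr]; ring

end FlatFrame

/-! ### Integrability and closedness on the total space. -/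

section Semiflat

variable {Jb F A W M : E2 → Matrix (Fin 2) (Fin 2) ℝ} {q : E2 × (Fin 2 → ℝ)}

/-- The components of the complex structure on the total space determined by complex structures
`Jb` on the base and `F` on the fibres, and the connection `A`. -/
def bundleEndo (Jb F A : E2 → Matrix (Fin 2) (Fin 2) ℝ) (q : E2 × (Fin 2 → ℝ)) :
    Matrix (Fin 2 ⊕ Fin 2) (Fin 2 ⊕ Fin 2) ℝ :=
  Matrix.fromBlocks (Jb q.1) 0 (F q.1 * A q.1 - A q.1 * Jb q.1) (F q.1)

theorem pd_total (i : Fin 2 ⊕ Fin 2) (f : E2 → ℝ) :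
    pd totalBasis i (fun r => f r.1) q = basePd i f q.1 :=
  congrFun (pd_comp_fst (fun _ => rfl) (fun _ => rfl) i f) q

/-- The Nijenhuis tensor of an almost complex structure of the plane vanishes. -/
theorem nijenhuis_base {y : E2} (hJ : ∀ i j, ContDiffAt ℝ ∞ (fun r => Jb r i j) y)
    (hJJ : ∀ᶠ r in 𝓝 y, Jb r * Jb r = -1) (l i j : Fin 2) :
    nijenhuis baseBasis Jb l i j y = 0 := by
  have e : ∀ a b, (fun r => Jb r a 0 * Jb r 0 b + Jb r a 1 * Jb r 1 b) =ᶠ[𝓝 y]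
      fun _ => (-1 : Matrix (Fin 2) (Fin 2) ℝ) a b := by
    intro a b
    filter_upwards [hJJ] with r hr
    rw [← hr, Matrix.mul_apply, Fin.sum_univ_two]
  have d : ∀ k a b, pd baseBasis k (fun r => Jb r a 0) y * Jb y 0 b
      + Jb y a 0 * pd baseBasis k (fun r => Jb r 0 b) y
      + (pd baseBasis k (fun r => Jb r a 1) y * Jb y 1 b
      + Jb y a 1 * pd baseBasis k (fun r => Jb r 1 b) y) = 0 := by
    intro k a b
    have := pd_congr (e := baseBasis) k (e a b)
    rw [pd_const, pd_add _ ((hJ _ _).mul (hJ _ _)).dAt ((hJ _ _).mul (hJ _ _)).dAt,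
      pd_mul _ (hJ _ _).dAt (hJ _ _).dAt, pd_mul _ (hJ _ _).dAt (hJ _ _).dAt] at this
    exact this
  -- A square root of `-1` has trace zero: the entry `Jb 0 1` is nonzero since `(Jb 0 0)² = -1` is
  -- impossible over the reals, and the off-diagonal equation then gives the claim.
  have htr : (fun r => Jb r 1 1) =ᶠ[𝓝 y] fun r => -Jb r 0 0 := by
    filter_upwards [hJJ] with r hr
    have h00 := congrFun (congrFun hr 0) 0
    have h01 := congrFun (congrFun hr 0) 1
    simp [Matrix.mul_apply, Fin.sum_univ_two] at h00 h01
    have : Jb r 0 1 ≠ 0 := by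
      intro h; rw [h] at h00; nlinarith [mul_self_nonneg (Jb r 0 0)]
    have : Jb r 0 1 * (Jb r 0 0 + Jb r 1 1) = 0 := by linarith
    have := (mul_eq_zero.1 this).resolve_left ‹_›
    linarith
  have htr0 := htr.self_of_nhds
  have htr1 : ∀ k, pd baseBasis k (fun r => Jb r 1 1) y = -pd baseBasis k (fun r => Jb r 0 0) y :=
    fun k => by rw [pd_congr k htr, pd_neg]
  have d00 := d 0 0 0
  have d10 := d 1 0 0
  fin_cases l <;> fin_cases i <;> fin_cases j <;>
    simp only [nijenhuis, Fin.sum_univ_two, Fin.zero_eta, Fin.mk_one, htr0, htr1] <;>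
    first | ring1 | linear_combination d00 | linear_combination -d00 | linear_combination d10 |
      linear_combination -d10

/-- A closed connection admits local flat horizontal coordinates, in which the structure is `Jb` on
the base and `F` on the fibre. The purely horizontal part is the vanishing Nijenhuis tensor of a
surface, and the mixed part is `hol`, the holomorphic dependence of the fibre structure on the base
point. -/
theorem nijenhuis_bundleEndo (hJ : ∀ i j, ContDiffAt ℝ ∞ (fun r => Jb r i j) q.1)
    (hF : ∀ i j, ContDiffAt ℝ ∞ (fun r => F r i j) q.1)
    (hA : ∀ i j, ContDiffAt ℝ ∞ (fun r => A r i j) q.1)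
    (hJJ : ∀ᶠ r in 𝓝 q.1, Jb r * Jb r = -1)
    (hol : ∀ i L M, ∑ m, Jb q.1 m i * pd baseBasis m (fun r => F r L M) q.1 =
      ∑ K, F q.1 L K * pd baseBasis i (fun r => F r K M) q.1)
    (hdA : ∀ I α β, pd baseBasis α (fun r => A r I β) q.1 = pd baseBasis β (fun r => A r I α) q.1)
    (l i j : Fin 2 ⊕ Fin 2) : nijenhuis totalBasis (bundleEndo Jb F A) l i j q = 0 := by
  have hN := nijenhuis_base hJ hJJ
  have e11 : ∀ a b i, pd totalBasis i (fun r => bundleEndo Jb F A r (inl a) (inl b)) q =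
      basePd i (fun r => Jb r a b) q.1 :=
    fun a b i => pd_total i fun r => Jb r a b
  have e12 : ∀ a b i, pd totalBasis i (fun r => bundleEndo Jb F A r (inl a) (inr b)) q = 0 :=
    fun a b i => pd_const i _
  have e22 : ∀ a b i, pd totalBasis i (fun r => bundleEndo Jb F A r (inr a) (inr b)) q =
      basePd i (fun r => F r a b) q.1 :=
    fun a b i => pd_total i fun r => F r a b
  have e21 : ∀ a b i, pd totalBasis i (fun r => bundleEndo Jb F A r (inr a) (inl b)) q =
      basePd i (fun r => (F r * A r - A r * Jb r) a b) q.1 :=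
    fun a b i => pd_total i fun r => (F r * A r - A r * Jb r) a b
  have dK : ∀ a b i, pd baseBasis i (fun r => (F r * A r - A r * Jb r) a b) q.1 =
      (pd baseBasis i (fun r => F r a 0) q.1 * A q.1 0 b + F q.1 a 0 * pd baseBasis i (fun r => A r 0 b) q.1
      + (pd baseBasis i (fun r => F r a 1) q.1 * A q.1 1 b + F q.1 a 1 * pd baseBasis i (fun r => A r 1 b) q.1))
      - (pd baseBasis i (fun r => A r a 0) q.1 * Jb q.1 0 b + A q.1 a 0 * pd baseBasis i (fun r => Jb r 0 b) q.1
      + (pd baseBasis i (fun r => A r a 1) q.1 * Jb q.1 1 b + A q.1 a 1 * pd baseBasis i (fun r => Jb r 1 b) q.1)) := by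
    intro a b i
    simp only [Matrix.sub_apply, Matrix.mul_apply, Fin.sum_univ_two]
    have m : ∀ {u v : E2 → ℝ}, ContDiffAt ℝ ∞ u q.1 → ContDiffAt ℝ ∞ v q.1 →
        DifferentiableAt ℝ (fun r => u r * v r) q.1 := fun hu hv => (hu.mul hv).dAt
    rw [pd_sub _ ((m (hF _ _) (hA _ _)).fun_add (m (hF _ _) (hA _ _)))
      ((m (hA _ _) (hJ _ _)).fun_add (m (hA _ _) (hJ _ _))),
      pd_add _ (m (hF _ _) (hA _ _)) (m (hF _ _) (hA _ _)),
      pd_add _ (m (hA _ _) (hJ _ _)) (m (hA _ _) (hJ _ _)),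
      pd_mul _ (hF _ _).dAt (hA _ _).dAt, pd_mul _ (hF _ _).dAt (hA _ _).dAt,
      pd_mul _ (hA _ _).dAt (hJ _ _).dAt, pd_mul _ (hA _ _).dAt (hJ _ _).dAt]
  simp only [Fin.sum_univ_two] at hol
  rcases l with l | l <;> rcases i with i | i <;> rcases j with j | j <;>
    simp only [nijenhuis, Fintype.sum_sum_type, e11, e12, e21, e22, basePd, Sum.elim_inl,
      Sum.elim_inr, dK, Fin.sum_univ_two] <;>
    simp only [bundleEndo, Matrix.fromBlocks_apply₁₁, Matrix.fromBlocks_apply₁₂,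
      Matrix.fromBlocks_apply₂₁, Matrix.fromBlocks_apply₂₂, Matrix.zero_apply, Matrix.sub_apply,
      Matrix.mul_apply, Fin.sum_univ_two]
  · have := hN l i j
    simp only [nijenhuis, Fin.sum_univ_two] at this
    linarith
  · ring
  · ring
  · ring
  -- A vertical component with two base arguments: the only case that combines the base tensor, the
  -- holomorphy of `F` and the closedness of `A`.
  · have n0 := hN 0 i j
    have n1 := hN 1 i j
    simp only [nijenhuis, Fin.sum_univ_two] at n0 n1
    linear_combination -(A q.1 l 0 * n0 + A q.1 l 1 * n1)
      + (hol i l 0 * A q.1 0 j + hol i l 1 * A q.1 1 j)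
      - (hol j l 0 * A q.1 0 i + hol j l 1 * A q.1 1 i)
      - (Jb q.1 0 i * Jb q.1 1 j - Jb q.1 1 i * Jb q.1 0 j) * hdA l 0 1
      + F q.1 l 0 * (Jb q.1 0 i * hdA 0 0 j + Jb q.1 1 i * hdA 0 1 j
        + Jb q.1 0 j * hdA 0 i 0 + Jb q.1 1 j * hdA 0 i 1)
      + F q.1 l 1 * (Jb q.1 0 i * hdA 1 0 j + Jb q.1 1 i * hdA 1 1 j
        + Jb q.1 0 j * hdA 1 i 0 + Jb q.1 1 j * hdA 1 i 1)
      - (F q.1 l 0 * F q.1 0 0 + F q.1 l 1 * F q.1 1 0) * hdA 0 i j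
      - (F q.1 l 0 * F q.1 0 1 + F q.1 l 1 * F q.1 1 1) * hdA 1 i j
  · linear_combination hol i l j
  · linear_combination -hol j l i
  · ring

/-- The components of a two-form on the total space. -/
def bundleForm (M W A : E2 → Matrix (Fin 2) (Fin 2) ℝ) (q : E2 × (Fin 2 → ℝ)) :
    Matrix (Fin 2 ⊕ Fin 2) (Fin 2 ⊕ Fin 2) ℝ :=
  Matrix.fromBlocks (M q.1 + (A q.1)ᵀ * W q.1 * A q.1) ((A q.1)ᵀ * W q.1) (W q.1 * A q.1) (W q.1)

/-- The base part is a two-form pulled back from a surface, whose derivative vanishes by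
antisymmetry because a base index repeats. The fibre part has the constant coefficients `W₀` in the
coframe `dx + A`, which is closed. -/
theorem extDeriv2_bundleForm {W₀ : Matrix (Fin 2) (Fin 2) ℝ}
    (hA : ∀ i j, ContDiffAt ℝ ∞ (fun r => A r i j) q.1)
    (hM : ∀ᶠ r in 𝓝 q.1, ∀ i j, M r i j = -M r j i) (hW : ∀ᶠ r in 𝓝 q.1, W r = W₀)
    (hW₀ : ∀ i j, W₀ i j = -W₀ j i)
    (hdA : ∀ I α β, pd baseBasis α (fun r => A r I β) q.1 = pd baseBasis β (fun r => A r I α) q.1)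
    (i j l : Fin 2 ⊕ Fin 2) : extDeriv2 totalBasis (bundleForm M W A) i j l q = 0 := by
  have hβ : ∀ i j, (fun r => bundleForm M W A r i j) =ᶠ[𝓝 q]
      fun r => bundleForm M (fun _ => W₀) A r i j := by
    intro i j
    filter_upwards [continuous_fst.continuousAt.eventually hW] with r hr
    simp only [bundleForm, hr]
  have e11 : ∀ a b i, pd totalBasis i (fun r => bundleForm M (fun _ => W₀) A r (inl a) (inl b)) q =
      basePd i (fun r => (M r + (A r)ᵀ * W₀ * A r) a b) q.1 :=
    fun a b i => pd_total i fun r => (M r + (A r)ᵀ * W₀ * A r) a b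
  have e12 : ∀ a b i, pd totalBasis i (fun r => bundleForm M (fun _ => W₀) A r (inl a) (inr b)) q =
      basePd i (fun r => ((A r)ᵀ * W₀) a b) q.1 :=
    fun a b i => pd_total i fun r => ((A r)ᵀ * W₀) a b
  have e21 : ∀ a b i, pd totalBasis i (fun r => bundleForm M (fun _ => W₀) A r (inr a) (inl b)) q =
      basePd i (fun r => (W₀ * A r) a b) q.1 := fun a b i => pd_total i fun r => (W₀ * A r) a b
  have e22 : ∀ a b i, pd totalBasis i (fun r => bundleForm M (fun _ => W₀) A r (inr a) (inr b)) q = 0 :=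
    fun a b i => pd_const i _
  have hanti : ∀ a b i, pd baseBasis i (fun r => (M r + (A r)ᵀ * W₀ * A r) a b) q.1 =
      -pd baseBasis i (fun r => (M r + (A r)ᵀ * W₀ * A r) b a) q.1 := by
    intro a b i
    rw [← pd_neg]
    refine pd_congr i ?_
    filter_upwards [hM] with r hr
    simp only [Matrix.add_apply, Matrix.mul_apply, Matrix.transpose_apply, Fin.sum_univ_two]
    rw [hr a b]
    linear_combination (A r 0 a * A r 0 b) * hW₀ 0 0 + (A r 1 a * A r 1 b) * hW₀ 1 1
      + (A r 0 a * A r 1 b + A r 1 a * A r 0 b) * hW₀ 0 1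
  have d12 : ∀ a b i, pd baseBasis i (fun r => ((A r)ᵀ * W₀) a b) q.1 =
      pd baseBasis i (fun r => A r 0 a) q.1 * W₀ 0 b +
        pd baseBasis i (fun r => A r 1 a) q.1 * W₀ 1 b := by
    intro a b i
    simp only [Matrix.mul_apply, Matrix.transpose_apply, Fin.sum_univ_two, mul_comm _ (W₀ _ _)]
    rw [pd_add _ ((hA _ _).dAt.const_mul _) ((hA _ _).dAt.const_mul _), pd_const_mul _ _ (hA _ _).dAt,
      pd_const_mul _ _ (hA _ _).dAt]
  have d21 : ∀ a b i, pd baseBasis i (fun r => (W₀ * A r) a b) q.1 =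
      pd baseBasis i (fun r => A r 0 b) q.1 * W₀ a 0 +
        pd baseBasis i (fun r => A r 1 b) q.1 * W₀ a 1 := by
    intro a b i
    simp only [Matrix.mul_apply, Fin.sum_univ_two]
    rw [pd_add _ ((hA _ _).dAt.const_mul _) ((hA _ _).dAt.const_mul _), pd_const_mul _ _ (hA _ _).dAt,
      pd_const_mul _ _ (hA _ _).dAt, mul_comm, mul_comm (W₀ a 1)]
  have dA := fun I => hdA I 0 1
  simp only [extDeriv2, pd_congr _ (hβ _ _)]
  rcases i with i | i <;> rcases j with j | j <;> rcases l with l | l <;>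
    simp only [e11, e12, e21, e22, basePd, Sum.elim_inl, Sum.elim_inr, d12, d21]
  · have h00 := fun i => hanti 0 0 i
    have h11 := fun i => hanti 1 1 i
    have h01 := fun i => hanti 0 1 i
    fin_cases i <;> fin_cases j <;> fin_cases l <;> simp only [Fin.zero_eta, Fin.mk_one] <;>
      linarith [h00 0, h00 1, h11 0, h11 1, h01 0, h01 1]
  · linear_combination W₀ 0 l * hdA 0 i j + W₀ 1 l * hdA 1 i j
      + pd baseBasis j (fun r => A r 0 i) q.1 * hW₀ l 0 + pd baseBasis j (fun r => A r 1 i) q.1 * hW₀ l 1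
  · linear_combination W₀ 0 j * hdA 0 l i + W₀ 1 j * hdA 1 l i
      + pd baseBasis i (fun r => A r 0 l) q.1 * hW₀ j 0 + pd baseBasis i (fun r => A r 1 l) q.1 * hW₀ j 1
  · ring
  · linear_combination W₀ 0 i * hdA 0 j l + W₀ 1 i * hdA 1 j l
      + pd baseBasis l (fun r => A r 0 j) q.1 * hW₀ i 0 + pd baseBasis l (fun r => A r 1 j) q.1 * hW₀ i 1
  · ring
  · ring
  · ring

end Semiflat

end CoordGeom

namespace CoordGeom

/-! ### The complex structure of the fibres. -/

section FibreStructure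

variable {G h γ : Matrix (Fin 2) (Fin 2) ℝ}

/-- The complex structure on a fibre with metric `G`, oriented by the frame `h`. -/
noncomputable def fibreEndo (G h : Matrix (Fin 2) (Fin 2) ℝ) : Matrix (Fin 2) (Fin 2) ℝ :=
  h * rotation (hᵀ * G * h) * h⁻¹

theorem posDef_congruence (hG : G.PosDef) (hh : IsUnit h.det) : (hᵀ * G * h).PosDef := by
  have := hG.conjTranspose_mul_mul_same (B := h)
    (Matrix.mulVec_injective_of_isUnit ((Matrix.isUnit_iff_isUnit_det h).2 hh))
  simpa using this

theorem fibreEndo_mul_self (hG : G.PosDef) (hh : IsUnit h.det) :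
    fibreEndo G h * fibreEndo G h = -1 := by
  have h1 : h⁻¹ * h = 1 := Matrix.nonsing_inv_mul h hh
  have h2 : h * h⁻¹ = 1 := Matrix.mul_nonsing_inv h hh
  have h3 := rotation_mul_self (posDef_congruence hG hh)
  set R := rotation (hᵀ * G * h)
  calc fibreEndo G h * fibreEndo G h = h * R * (h⁻¹ * h) * R * h⁻¹ := by
        simp only [fibreEndo, R, Matrix.mul_assoc]
    _ = h * (R * R) * h⁻¹ := by rw [h1, mul_one]; simp only [Matrix.mul_assoc]
    _ = -1 := by rw [h3]; simp [h2]

/-- The fibre area form is a fixed form in the frame `h` times the fibre volume, so it is locally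
constant when `h` is locally constant and `det G` is constant. -/
theorem transpose_fibreEndo_mul (hG : G.PosDef) (hh : IsUnit h.det) :
    (fibreEndo G h)ᵀ * G = (|h.det| * √G.det) • ((h⁻¹)ᵀ * !![0, 1; -1, 0] * h⁻¹) := by
  have h2 : h * h⁻¹ = 1 := Matrix.mul_nonsing_inv h hh
  have h3 : (h⁻¹)ᵀ * hᵀ = 1 := by rw [← Matrix.transpose_mul, h2, Matrix.transpose_one]
  have h4 := transpose_rotation_mul (posDef_congruence hG hh)
  have h5 : √(hᵀ * G * h).det = |h.det| * √G.det := by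
    rw [Matrix.det_mul, Matrix.det_mul, Matrix.det_transpose,
      show h.det * G.det * h.det = h.det ^ 2 * G.det by ring, Real.sqrt_mul (sq_nonneg _),
      Real.sqrt_sq_eq_abs]
  calc (fibreEndo G h)ᵀ * G = (h⁻¹)ᵀ * ((rotation (hᵀ * G * h))ᵀ * (hᵀ * G * h)) * h⁻¹ := by
        simp only [fibreEndo, Matrix.transpose_mul, Matrix.mul_assoc, h2, mul_one]
    _ = _ := by rw [h4, h5]; simp only [Matrix.mul_smul, Matrix.smul_mul]

theorem transpose_fibreEndo_mul_mul (hG : G.PosDef) (hh : IsUnit h.det) :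
    (fibreEndo G h)ᵀ * G * fibreEndo G h = G := by
  have h2 : h * h⁻¹ = 1 := Matrix.mul_nonsing_inv h hh
  have h3 : (h⁻¹)ᵀ * hᵀ = 1 := by rw [← Matrix.transpose_mul, h2, Matrix.transpose_one]
  have h4 := transpose_rotation_mul_mul (posDef_congruence hG hh)
  calc (fibreEndo G h)ᵀ * G * fibreEndo G h =
      (h⁻¹)ᵀ * ((rotation (hᵀ * G * h))ᵀ * (hᵀ * G * h) * rotation (hᵀ * G * h)) * h⁻¹ := by
        simp only [fibreEndo, Matrix.transpose_mul, Matrix.mul_assoc]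
    _ = ((h⁻¹)ᵀ * hᵀ) * G * (h * h⁻¹) := by rw [h4]; simp only [Matrix.mul_assoc]
    _ = G := by rw [h2, h3, mul_one, one_mul]

/-- No orientation sign appears, even when `γ` has negative determinant, because the orienting frame
is transported by `γ` as well. -/
theorem fibreEndo_change (hγ : IsUnit γ.det) :
    fibreEndo G (γ * h) * γ = γ * fibreEndo (γᵀ * G * γ) h := by
  have h1 : γ⁻¹ * γ = 1 := Matrix.nonsing_inv_mul γ hγ
  have e : (γ * h)ᵀ * G * (γ * h) = hᵀ * (γᵀ * G * γ) * h := by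
    simp only [Matrix.transpose_mul, Matrix.mul_assoc]
  rw [fibreEndo, fibreEndo, e, Matrix.mul_inv_rev]
  simp only [Matrix.mul_assoc, h1, mul_one]

/-- The rotation matrix in terms of the point of the upper half-plane. -/
theorem rotation_eq (hG : G.PosDef) : rotation G =
    !![-(G 0 1 / G 0 0 * (√G.det / G 0 0)⁻¹),
      -(G 0 1 / G 0 0 * (G 0 1 / G 0 0 * (√G.det / G 0 0)⁻¹) + √G.det / G 0 0);
      (√G.det / G 0 0)⁻¹, G 0 1 / G 0 0 * (√G.det / G 0 0)⁻¹] := by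
  have hd := hG.det_pos
  have h0 : G 0 0 ≠ 0 := hG.diag_pos.ne'
  have hs : G 1 0 = G 0 1 := by simpa using (hG.1.apply 0 1)
  have hw0 : √G.det ≠ 0 := (Real.sqrt_pos.2 hd).ne'
  have hw : √G.det ^ 2 = G 0 0 * G 1 1 - G 0 1 * G 0 1 := by
    rw [Real.sq_sqrt hd.le, Matrix.det_fin_two, hs]
  ext i j
  fin_cases i <;> fin_cases j <;> simp [rotation, hs] <;> field_simp
  linarith

/-- Holomorphy of the fibre complex structure. -/
theorem fibreEndo_holomorphic {y : E2} {Jb : Matrix (Fin 2) (Fin 2) ℝ} {x s : E2 → ℝ}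
    {F : E2 → Matrix (Fin 2) (Fin 2) ℝ} {k k' : Matrix (Fin 2) (Fin 2) ℝ} (hk : k' * k = 1)
    (hx : ContDiffAt ℝ ∞ x y) (hs : ContDiffAt ℝ ∞ s y) (hs0 : s y ≠ 0)
    (c1 : ∀ i, ∑ m, Jb m i * pd baseBasis m x y = -pd baseBasis i s y)
    (c2 : ∀ i, ∑ m, Jb m i * pd baseBasis m s y = pd baseBasis i x y)
    (hF : F =ᶠ[𝓝 y] fun r => k * !![-(x r * (s r)⁻¹), -(x r * (x r * (s r)⁻¹) + s r);
      (s r)⁻¹, x r * (s r)⁻¹] * k') (i L M : Fin 2) :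
    ∑ m, Jb m i * pd baseBasis m (fun r => F r L M) y =
      ∑ K, F y L K * pd baseBasis i (fun r => F r K M) y := by
  let T : E2 → Matrix (Fin 2) (Fin 2) ℝ := fun r =>
    !![-(x r * (s r)⁻¹), -(x r * (x r * (s r)⁻¹) + s r); (s r)⁻¹, x r * (s r)⁻¹]
  have hsi : ContDiffAt ℝ ∞ (fun r => (s r)⁻¹) y := hs.inv hs0
  have hT : ∀ a b, ContDiffAt ℝ ∞ (fun r => T r a b) y := by
    intro a b
    fin_cases a <;> fin_cases b
    · exact (hx.mul hsi).neg
    · exact ((hx.mul (hx.mul hsi)).add hs).neg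
    · exact hsi
    · exact hx.mul hsi
  let DT : Fin 2 → Matrix (Fin 2) (Fin 2) ℝ := fun m =>
    Matrix.of fun a b => pd baseBasis m (fun r => T r a b) y
  have hDF : ∀ m a b, pd baseBasis m (fun r => F r a b) y = (k * DT m * k') a b := by
    intro m a b
    have e : (fun r => F r a b) =ᶠ[𝓝 y] fun r => ∑ c, ∑ d, k a d * k' c b * T r d c := by
      filter_upwards [hF] with r hr
      rw [hr]
      change (k * T r * k') a b = _
      simp only [Matrix.mul_apply, Finset.sum_mul]
      exact Finset.sum_congr rfl fun c _ => Finset.sum_congr rfl fun d _ => by ring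
    rw [pd_congr m e, pd_sum _ _ fun c _ => DifferentiableAt.fun_sum fun d _ => (hT d c).dAt.const_mul _]
    simp only [Matrix.mul_apply, Finset.sum_mul]
    refine Finset.sum_congr rfl fun c _ => ?_
    rw [pd_sum _ _ fun d _ => (hT d c).dAt.const_mul _]
    refine Finset.sum_congr rfl fun d _ => ?_
    rw [pd_const_mul _ _ (hT d c).dAt]
    simp only [DT, Matrix.of_apply]
    ring
  -- Conjugation by the constant frame commutes with differentiation, so only the matrix `T` of the
  -- rotation in the coordinates `x` and `s` matters. Entry by entry, the claim follows from the
  -- Cauchy–Riemann equations.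
  have key : ∀ i, ∑ m, Jb m i • DT m = T y * DT i := by
    intro i
    have w : ∀ m, pd baseBasis m (fun r => (s r)⁻¹) y = -pd baseBasis m s y / s y ^ 2 := fun m =>
      pd_inv m hs.dAt hs0
    have xw : ∀ m, pd baseBasis m (fun r => x r * (s r)⁻¹) y = pd baseBasis m x y * (s y)⁻¹
        + x y * pd baseBasis m (fun r => (s r)⁻¹) y := fun m => pd_mul m hx.dAt hsi.dAt
    have D00 : ∀ m, DT m 0 0 = -pd baseBasis m (fun r => x r * (s r)⁻¹) y := fun m => pd_neg m
    have D01 : ∀ m, DT m 0 1 = -(pd baseBasis m x y * (x y * (s y)⁻¹)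
        + x y * pd baseBasis m (fun r => x r * (s r)⁻¹) y + pd baseBasis m s y) := fun m => by
      change pd baseBasis m (fun r => -(x r * (x r * (s r)⁻¹) + s r)) y = _
      rw [pd_neg, pd_add m (hx.mul (hx.mul hsi)).dAt hs.dAt, pd_mul m hx.dAt (hx.mul hsi).dAt]
    have D10 : ∀ m, DT m 1 0 = pd baseBasis m (fun r => (s r)⁻¹) y := fun m => rfl
    have D11 : ∀ m, DT m 1 1 = pd baseBasis m (fun r => x r * (s r)⁻¹) y := fun m => rfl
    have a1 := c1 i
    have a2 := c2 i
    rw [Fin.sum_univ_two] at a1 a2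
    have hsw : s y * (s y)⁻¹ = 1 := mul_inv_cancel₀ hs0
    ext a b
    fin_cases a <;> fin_cases b <;>
      simp only [Fin.sum_univ_two, Matrix.add_apply, Matrix.smul_apply, smul_eq_mul,
        Matrix.mul_apply, D00, D01, D10, D11, Fin.zero_eta, Fin.mk_one, xw, w] <;>
      simp only [T, Matrix.of_apply, Matrix.cons_val', Matrix.cons_val_zero, Matrix.cons_val_one,
        Matrix.cons_val_fin_one]
    · linear_combination -(s y)⁻¹ * a1 + x y * (s y)⁻¹ ^ 2 * a2
        - pd baseBasis i s y * (s y)⁻¹ * hsw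
    · linear_combination -(2 * x y * (s y)⁻¹) * a1 + (x y ^ 2 * (s y)⁻¹ ^ 2 - 1) * a2
        + (pd baseBasis i x y - x y * (s y)⁻¹ * pd baseBasis i s y) * hsw
    · linear_combination -(s y)⁻¹ ^ 2 * a2
    · linear_combination (s y)⁻¹ * a1 - x y * (s y)⁻¹ ^ 2 * a2
  have hFy : F y = k * T y * k' := hF.self_of_nhds
  have l1 : ∑ m, Jb m i * pd baseBasis m (fun r => F r L M) y =
      (k * (∑ m, Jb m i • DT m) * k') L M := by
    simp only [hDF, Matrix.mul_sum, Matrix.sum_mul, Matrix.mul_smul, Matrix.smul_mul,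
      Matrix.sum_apply, Matrix.smul_apply, smul_eq_mul]
  have l2 : ∑ K, F y L K * pd baseBasis i (fun r => F r K M) y =
      (k * T y * (k' * k) * DT i * k') L M := by
    simp only [hDF, hFy]
    rw [← Matrix.mul_apply]
    simp only [Matrix.mul_assoc]
  rw [l1, l2, key, hk, mul_one]
  simp only [Matrix.mul_assoc]

end FibreStructure

end CoordGeom

namespace CoordGeom

open Sum

section Congr

variable {k : Type*} {V : Type*} [NormedAddCommGroup V]
  [NormedSpace ℝ V] {e : k → V} {q : V}

theorem nijenhuis_congr [Fintype k] {J J' : V → Matrix k k ℝ} (h : J =ᶠ[𝓝 q] J') (l i j : k) :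
    nijenhuis e J l i j q = nijenhuis e J' l i j q := by
  have hd : ∀ i a b, pd e i (fun r => J r a b) q = pd e i (fun r => J' r a b) q := fun i a b =>
    pd_congr i (h.mono fun r hr => by simp only [hr])
  simp only [nijenhuis, hd, h.self_of_nhds]

theorem extDeriv2_congr {β β' : V → Matrix k k ℝ} (h : β =ᶠ[𝓝 q] β') (i j l : k) :
    extDeriv2 e β i j l q = extDeriv2 e β' i j l q := by
  have hd : ∀ i a b, pd e i (fun r => β r a b) q = pd e i (fun r => β' r a b) q := fun i a b =>
    pd_congr i (h.mono fun r hr => by simp only [hr])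
  simp only [extDeriv2, hd]

theorem riemann_const [Fintype k] [DecidableEq k] (M : Matrix k k ℝ) (l s i j : k) :
    riemann e (fun _ => M) l s i j q = 0 := by
  have hΓ : ∀ l i j, christoffel e (fun _ : V => M) l i j = fun _ => 0 := by
    intro l i j; ext r; simp [christoffel, pd_const]
  simp [riemann, hΓ, pd_const]

end Congr

/-! ### The semiflat Kähler structure over a surface. -/

section SemiflatSurface

variable {S : Type*} [TopologicalSpace S] [ChartedSpace E2 S] {ι : Type*}

/-- The connection form at a point, as a map from the plane. -/
noncomputable def connAt (X : TorusGroupoid ι S) (a : ι) (b : S) : E2 →L[ℝ] (Fin 2 → ℝ) := X.A a b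

/-- The almost complex structure on the total space determined by one on the base and a frame. -/
noncomputable def semiflatEndoAt (X : TorusGroupoid ι S) (a : ι) (h : S → GL (Fin 2) ℝ)
    (j : TangentEndo S) (b : S) : E2 × (Fin 2 → ℝ) →L[ℝ] E2 × (Fin 2 → ℝ) :=
  ((endoAt j b).comp (ContinuousLinearMap.fst ℝ _ _)).prod
    ((LinearMap.toContinuousLinearMap (Matrix.toLin' (fibreEndo (X.G a b) (h b).1))).comp
      (ContinuousLinearMap.snd ℝ _ _ + (connAt X a b).comp (ContinuousLinearMap.fst ℝ _ _))
    - ((connAt X a b).comp (endoAt j b)).comp (ContinuousLinearMap.fst ℝ _ _))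

/-- The field of endomorphisms `semiflatEndoAt`. -/
noncomputable def semiflatEndo (X : TorusGroupoid ι S) (a : ι) (h : S → GL (Fin 2) ℝ)
    (j : TangentEndo S) : TorusGroupoid.TotalEndo S := fun b => semiflatEndoAt X a h j b

theorem semiflatEndoAt_apply (X : TorusGroupoid ι S) (a : ι) (h : S → GL (Fin 2) ℝ)
    (j : TangentEndo S) (b : S) (u : E2 × (Fin 2 → ℝ)) : semiflatEndoAt X a h j b u =
      (endoAt j b u.1, fibreEndo (X.G a b) (h b).1 *ᵥ (u.2 + connAt X a b u.1)
        - connAt X a b (endoAt j b u.1)) := rfl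

/-- The total metric, on vectors of `ℝ² × ℝ²`. -/
theorem totalForm_eq (X : TorusGroupoid ι S) (a : ι) (b : S) (u u' : E2 × (Fin 2 → ℝ)) :
    X.totalForm a b u u' = formAt X.g b u.1 u'.1 +
      (u.2 + connAt X a b u.1) ⬝ᵥ (X.G a b *ᵥ (u'.2 + connAt X a b u'.1)) := rfl

/-- The matrix of the connection form in a coordinate system. -/
noncomputable def connMatrix (X : TorusGroupoid ι S) (a : ι) (φ : OpenPartialHomeomorph S E2)
    (y : E2) : Matrix (Fin 2) (Fin 2) ℝ := Matrix.of fun I α => X.AComp a φ I α y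

theorem isUnit_det_gl (h : GL (Fin 2) ℝ) : IsUnit h.1.det :=
  (Matrix.isUnit_iff_isUnit_det _).1 h.isUnit

variable {X : TorusGroupoid ι S} {a : ι} {h : S → GL (Fin 2) ℝ} {j : TangentEndo S}
  {φ : OpenPartialHomeomorph S E2} {y : E2}

/-- The coordinate vectors of the total space, as vectors of `ℝ² × ℝ²`. -/
noncomputable def totalFrame (φ : OpenPartialHomeomorph S E2) (y : E2) (k : Fin 2 ⊕ Fin 2) :
    E2 × (Fin 2 → ℝ) := TorusGroupoid.totalVec φ y k

theorem totalFrame_inl (φ : OpenPartialHomeomorph S E2) (y : E2) (α : Fin 2) :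
    totalFrame φ y (inl α) = (paramDeriv φ.symm y (baseBasis α), 0) := rfl

theorem totalFrame_inr (φ : OpenPartialHomeomorph S E2) (y : E2) (I : Fin 2) :
    totalFrame φ y (inr I) = (0, Pi.single I 1) := rfl

theorem connAt_paramDeriv (α : Fin 2) :
    connAt X a (φ.symm y) (paramDeriv φ.symm y (baseBasis α)) =
      fun I => connMatrix X a φ y I α := rfl

theorem totalMetric_eq : X.totalMetric a φ =
    bundleMetric (metricComp X.g φ) (fun z => X.G a (φ.symm z)) (connMatrix X a φ) := by
  ext q k l
  refine (totalForm_eq X a _ (totalFrame φ q.1 k) (totalFrame φ q.1 l)).trans ?_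
  rcases k with k | k <;> rcases l with l | l <;>
    simp only [totalFrame_inl, totalFrame_inr, connAt_paramDeriv, map_zero, add_zero, zero_add,
      zero_apply, bundleMetric, Matrix.fromBlocks_apply₁₁,
      Matrix.fromBlocks_apply₁₂, Matrix.fromBlocks_apply₂₁, Matrix.fromBlocks_apply₂₂]
  · change metricComp X.g φ q.1 k l + _ = metricComp X.g φ q.1 k l + _
    simp only [Matrix.mul_apply, dotProduct, Matrix.mulVec, Fin.sum_univ_two,
      Matrix.transpose_apply]
    ring
  · simp [dotProduct, Matrix.mul_apply, Fin.sum_univ_two]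
  · fin_cases k <;> simp [Matrix.mulVec, dotProduct, Matrix.mul_apply, Fin.sum_univ_two]
  · simp

theorem endoAt_paramDeriv (hφ : IsSmoothChart φ) (hy : y ∈ φ.target) (β : Fin 2) :
    endoAt j (φ.symm y) (paramDeriv φ.symm y (baseBasis β)) =
      ∑ α, endoComp j φ y α β • paramDeriv φ.symm y (baseBasis α) := by
  have hv := hφ.paramDeriv_coordDeriv (φ.map_target hy)
    (endoAt j (φ.symm y) (paramDeriv φ.symm y (baseBasis β)))
  rw [φ.right_inv hy] at hv
  rw [← hv, euclidean_eq_sum (coordDeriv φ (φ.symm y) _), map_sum]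
  simp only [map_smul]
  rfl

theorem totalEndoComp_eq (hφ : IsSmoothChart φ) {q : E2 × (Fin 2 → ℝ)} (hq : q.1 ∈ φ.target) :
    TorusGroupoid.totalEndoComp (semiflatEndo X a h j) φ q =
      bundleEndo (endoComp j φ) (fun z => fibreEndo (X.G a (φ.symm z)) (h (φ.symm z)).1)
        (connMatrix X a φ) q := by
  have hP : ∀ α, connAt X a (φ.symm q.1) (paramDeriv φ.symm q.1 (baseBasis α)) =
      fun I => connMatrix X a φ q.1 I α := fun α => rfl
  ext k l
  rcases k with k | k <;> rcases l with l | l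
  · rfl
  · change coordDeriv φ (φ.symm q.1) (endoAt j (φ.symm q.1) 0) k = 0
    simp
  · change (fibreEndo _ _ *ᵥ ((0 : Fin 2 → ℝ) + connAt X a (φ.symm q.1)
      (paramDeriv φ.symm q.1 (baseBasis l))) - connAt X a (φ.symm q.1) (endoAt j (φ.symm q.1)
      (paramDeriv φ.symm q.1 (baseBasis l)))) k = _
    rw [endoAt_paramDeriv hφ hq, map_sum]
    simp only [map_smul, hP, zero_add]
    fin_cases k <;> simp [bundleEndo, Matrix.mul_apply, Fin.sum_univ_two, mul_comm]
  · change (fibreEndo _ _ *ᵥ ((Pi.single l 1 : Fin 2 → ℝ) + connAt X a (φ.symm q.1) 0)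
      - connAt X a (φ.symm q.1) (endoAt j (φ.symm q.1) 0)) k = fibreEndo _ _ k l
    simp

/-- The vertical part `u.2 + A u.1` of the image under `semiflatEndo` is the fibre rotation of the
vertical part of the argument. Relative to horizontal and vertical vectors the form is therefore a
direct sum. -/
theorem kahlerForm_eq (q : E2 × (Fin 2 → ℝ)) :
    X.kahlerForm a (semiflatEndo X a h j) φ q =
      bundleForm (fun z => Matrix.of fun α β => formAt X.g (φ.symm z)
        (endoAt j (φ.symm z) (paramDeriv φ.symm z (baseBasis α))) (paramDeriv φ.symm z (baseBasis β)))
        (fun z => (fibreEndo (X.G a (φ.symm z)) (h (φ.symm z)).1)ᵀ * X.G a (φ.symm z))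
        (connMatrix X a φ) q := by
  ext k l
  refine (totalForm_eq X a _ (semiflatEndoAt X a h j (φ.symm q.1)
    (totalFrame φ q.1 k)) (totalFrame φ q.1 l)).trans ?_
  rw [semiflatEndoAt_apply]
  rcases k with k | k <;> rcases l with l | l <;>
    simp only [sub_add_cancel, sub_zero, totalFrame_inl, totalFrame_inr, connAt_paramDeriv, map_zero, add_zero,
      zero_add, zero_apply, bundleForm, Matrix.fromBlocks_apply₁₁,
      Matrix.fromBlocks_apply₁₂, Matrix.fromBlocks_apply₂₁, Matrix.fromBlocks_apply₂₂,
      Matrix.add_apply, Matrix.of_apply, Matrix.mulVec_single_one]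
  · congr 1
    simp only [Matrix.mul_apply, dotProduct, Matrix.mulVec, Fin.sum_univ_two,
      Matrix.transpose_apply]
    ring
  all_goals
    simp only [Matrix.mul_apply, dotProduct, Matrix.mulVec, Fin.sum_univ_two,
      Matrix.transpose_apply, Matrix.col_apply]
    try ring

end SemiflatSurface

end CoordGeom

namespace CoordGeom

open Sum

section SemiflatTheorem

variable {S : Type*} [TopologicalSpace S] [ChartedSpace E2 S] {ι : Type*}

theorem contMDiffAt_iff_contDiffAt {φ : OpenPartialHomeomorph S E2} (hφ : IsSmoothChart φ) {y : E2}
    (hy : y ∈ φ.target) {f : S → ℝ} : ContMDiffAt 𝓘(ℝ, E2) 𝓘(ℝ, ℝ) ∞ f (φ.symm y) ↔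
      ContDiffAt ℝ ∞ (fun z => f (φ.symm z)) y := by
  refine ⟨fun h => (ContMDiffAt.comp y h (hφ.contMDiffAt_symm hy)).contDiffAt, fun h => ?_⟩
  have hs := φ.map_target hy
  have h' : ContMDiffAt 𝓘(ℝ, E2) 𝓘(ℝ, ℝ) ∞ (fun z => f (φ.symm z)) (φ (φ.symm y)) := by
    rw [φ.right_inv hy]; exact h.contMDiffAt
  refine (ContMDiffAt.comp (φ.symm y) h' (hφ.contMDiffAt hs)).congr_of_eventuallyEq ?_
  filter_upwards [φ.open_source.mem_nhds hs] with b hb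
  simp [φ.left_inv hb]

omit [ChartedSpace E2 S] in
theorem eventually_symm {φ : OpenPartialHomeomorph S E2} {y : E2} (hy : y ∈ φ.target) {P : S → Prop}
    (h : ∀ᶠ b in 𝓝 (φ.symm y), P b) : ∀ᶠ z in 𝓝 y, P (φ.symm z) :=
  (φ.symm.continuousAt hy).eventually h

theorem matEndo_endoComp (j : TangentEndo S) (φ : OpenPartialHomeomorph S E2) (y : E2) (v : E2) :
    matEndo (endoComp j φ y) v =
      coordDeriv φ (φ.symm y) (endoAt j (φ.symm y) (paramDeriv φ.symm y v)) := by
  have h : ∀ L : E2 →L[ℝ] E2, matEndo (Matrix.of fun i j => L (baseBasis j) i) v = L v := by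
    intro L
    conv_rhs => rw [euclidean_eq_sum v, map_sum]
    ext i
    simp only [matEndo_apply, map_smul, Fin.sum_univ_two, PiLp.add_apply, PiLp.smul_apply,
      Matrix.of_apply, smul_eq_mul, mul_comm]
  exact h ((coordDeriv φ (φ.symm y)).comp ((endoAt j (φ.symm y)).comp (paramDeriv φ.symm y)))

/-- The data of a groupoid for which `det G` is constant and the connection is flat. -/
structure IsFlatData (Y : TorusGroupoid ι S) : Prop where
  isOpen : ∀ a, IsOpen (Y.U a)
  metric : IsSmoothMetric Y.g
  G_smooth : ∀ a, ∀ b ∈ Y.U a, ∀ I J, ContMDiffAt 𝓘(ℝ, E2) 𝓘(ℝ, ℝ) ∞ (fun b => Y.G a b I J) b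
  A_smooth : ∀ a, ∀ φ ∈ atlas E2 S, ∀ y ∈ Y.baseDom a φ, ∀ I α,
    ContDiffAt ℝ ∞ (Y.AComp a φ I α) y
  flat : ∀ a, ∀ φ ∈ atlas E2 S, ∀ y ∈ Y.baseDom a φ, ∀ I α β, Y.FComp a φ I α β y = 0
  det_const : ∃ c : ℝ, ∀ a, ∀ b ∈ Y.U a, (Y.G a b).det = c

theorem isOpen_baseDom {Y : TorusGroupoid ι S} {a : ι} (hU : IsOpen (Y.U a))
    (φ : OpenPartialHomeomorph S E2) : IsOpen (Y.baseDom a φ) :=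
  φ.symm.isOpen_inter_preimage hU

/-- The fibre metric in a frame. -/
def framed (Y : TorusGroupoid ι S) (a : ι) (h : S → GL (Fin 2) ℝ) (b : S) :
    Matrix (Fin 2) (Fin 2) ℝ := (h b).1ᵀ * Y.G a b * (h b).1

theorem framed_posDef {Y : TorusGroupoid ι S} {a : ι} {b : S} (hb : b ∈ Y.U a)
    (h : S → GL (Fin 2) ℝ) : (framed Y a h b).PosDef :=
  posDef_congruence (Y.posDef a b hb) (isUnit_det_gl _)

theorem rotationField_sq {Y : TorusGroupoid ι S} {a : ι} {j : TangentEndo S}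
    (hj : IsRotationField Y.g (Y.U a) j) {b : S} (hb : b ∈ Y.U a) (v : E2) :
    endoAt j b (endoAt j b v) = -v := hj.sq b hb v

theorem rotationField_orth {Y : TorusGroupoid ι S} {a : ι} {j : TangentEndo S}
    (hj : IsRotationField Y.g (Y.U a) j) {b : S} (hb : b ∈ Y.U a) (v w : E2) :
    formAt Y.g b (endoAt j b v) (endoAt j b w) = formAt Y.g b v w := hj.orth b hb v w

/-- Orthogonality and `J² = -1` hold separately on horizontal and vertical vectors. Integrability
uses the flat connection and the Cauchy–Riemann equations for `τ`; closedness uses the constant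
fibre volume. The fibre metric is constant along each fibre, hence flat. -/
theorem IsFlatData.isSemiflatKahler [IsManifold 𝓘(ℝ, E2) ∞ S] {Y : TorusGroupoid ι S}
    (hY : IsFlatData Y) {a : ι} {h : S → GL (Fin 2) ℝ}
    (hh : ∀ b ∈ Y.U a, ∀ᶠ b' in 𝓝 b, h b' = h b) {j : TangentEndo S}
    (hj : IsRotationField Y.g (Y.U a) j) {x s : S → ℝ}
    (hx : ∀ b ∈ Y.U a, ContMDiffAt 𝓘(ℝ, E2) 𝓘(ℝ, ℝ) ∞ x b)
    (hs : ∀ b ∈ Y.U a, ContMDiffAt 𝓘(ℝ, E2) 𝓘(ℝ, ℝ) ∞ s b)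
    (hxG : ∀ b ∈ Y.U a, x b = framed Y a h b 0 1 / framed Y a h b 0 0)
    (hsG : ∀ b ∈ Y.U a, s b = √(framed Y a h b).det / framed Y a h b 0 0)
    (hCR : ∀ b ∈ Y.U a, IsCauchyRiemannAt j x s 1 b) :
    Y.IsSemiflatKahler a j (semiflatEndo Y a h j) := by
  have hdom : ∀ φ : OpenPartialHomeomorph S E2, ∀ y ∈ Y.baseDom a φ, ∀ᶠ z in 𝓝 y,
      z ∈ φ.target ∧ φ.symm z ∈ Y.U a ∧ h (φ.symm z) = h (φ.symm y) := fun φ y hy =>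
    ((isOpen_baseDom (hY.isOpen a) φ).mem_nhds hy |> Filter.Eventually.and <|
      eventually_symm hy.1 (hh _ hy.2)).mono fun z hz => ⟨hz.1.1, hz.1.2, hz.2⟩
  have hJs : ∀ φ ∈ atlas E2 S, ∀ y ∈ Y.baseDom a φ, ∀ k l,
      ContDiffAt ℝ ∞ (fun z => endoComp j φ z k l) y := fun φ hφ y hy k l =>
    (hj.smooth φ hφ k l).contDiffAt ((isOpen_baseDom (hY.isOpen a) φ).mem_nhds hy)
  have hGs : ∀ φ ∈ atlas E2 S, ∀ y ∈ Y.baseDom a φ, ∀ k l,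
      ContDiffAt ℝ ∞ (fun z => Y.G a (φ.symm z) k l) y := fun φ hφ y hy k l =>
    (contMDiffAt_iff_contDiffAt (isSmoothChart_of_mem_atlas hφ) hy.1).1
      (hY.G_smooth a _ hy.2 k l)
  have hFs : ∀ φ ∈ atlas E2 S, ∀ y ∈ Y.baseDom a φ, ∀ k l, ContDiffAt ℝ ∞
      (fun z => fibreEndo (Y.G a (φ.symm z)) (h (φ.symm z)).1 k l) y := by
    intro φ hφ y hy k l
    have h1 : ContDiffAt ℝ ∞ (fun z => ((h (φ.symm y)).1 * rotation ((h (φ.symm y)).1ᵀ *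
        Y.G a (φ.symm z) * (h (φ.symm y)).1) * ((h (φ.symm y)).1)⁻¹) k l) y :=
      contDiffAt_congruence (contDiffAt_rotation (contDiffAt_congruence (hGs φ hφ y hy) _ _)
        (framed_posDef hy.2 h)) _ _ k l
    refine h1.congr_of_eventuallyEq ((hdom φ y hy).mono fun z hz => ?_)
    simp only [fibreEndo, hz.2.2]
  have hAs : ∀ φ ∈ atlas E2 S, ∀ y ∈ Y.baseDom a φ, ∀ k l,
      ContDiffAt ℝ ∞ (fun z => connMatrix Y a φ z k l) y := fun φ hφ y hy k l =>
    hY.A_smooth a φ hφ y hy k l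
  have hdA : ∀ φ ∈ atlas E2 S, ∀ y ∈ Y.baseDom a φ, ∀ I α β,
      pd baseBasis α (fun r => connMatrix Y a φ r I β) y =
        pd baseBasis β (fun r => connMatrix Y a φ r I α) y := fun φ hφ y hy I α β =>
    sub_eq_zero.1 (hY.flat a φ hφ y hy I α β)
  have hEq : ∀ φ ∈ atlas E2 S, ∀ q ∈ Y.totalDom a φ,
      TorusGroupoid.totalEndoComp (semiflatEndo Y a h j) φ =ᶠ[𝓝 q] bundleEndo (endoComp j φ)
        (fun z => fibreEndo (Y.G a (φ.symm z)) (h (φ.symm z)).1) (connMatrix Y a φ) := by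
    intro φ hφ q hq
    filter_upwards [continuous_fst.continuousAt.eventually (hdom φ q.1 hq)] with r hr
    exact totalEndoComp_eq (isSmoothChart_of_mem_atlas hφ) hr.1
  have hJJ : ∀ φ ∈ atlas E2 S, ∀ y ∈ Y.baseDom a φ, endoComp j φ y * endoComp j φ y = -1 := by
    intro φ hφ y hy
    have hφ' := isSmoothChart_of_mem_atlas hφ
    ext k l
    rw [← matEndo_baseBasis (endoComp j φ y * endoComp j φ y) k l,
      ← matEndo_baseBasis (-1) k l, matEndo_mul_apply, matEndo_endoComp,
      matEndo_endoComp]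
    have h1 := hφ'.paramDeriv_coordDeriv (φ.map_target hy.1)
    rw [φ.right_inv hy.1] at h1
    rw [h1, rotationField_sq hj hy.2, map_neg, hφ'.coordDeriv_paramDeriv hy.1,
      matEndo_neg_one_apply]
  have hFmul : ∀ b ∈ Y.U a, ∀ w : Fin 2 → ℝ, fibreEndo (Y.G a b) (h b).1 *ᵥ
      (fibreEndo (Y.G a b) (h b).1 *ᵥ w) = -w := fun b hb w => by
    rw [Matrix.mulVec_mulVec, fibreEndo_mul_self (Y.posDef a b hb) (isUnit_det_gl _),
      Matrix.neg_mulVec, Matrix.one_mulVec]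
  refine ⟨hj, fun φ hφ k l q hq => ?_, fun b hb => ?_, fun b hb => ?_, fun φ hφ q hq l k m => ?_,
    fun φ hφ q hq k l m => ?_, fun b hb u => rfl, fun b hb x k l m n => riemann_const _ _ _ _ _⟩
  · have hq' : q.1 ∈ Y.baseDom a φ := hq
    refine ContDiffAt.contDiffWithinAt ?_
    refine ContDiffAt.congr_of_eventuallyEq ?_
      ((hEq φ hφ q hq).mono fun r hr => congrFun (congrFun hr k) l)
    have J := hJs φ hφ q.1 hq'
    have F := hFs φ hφ q.1 hq'
    have A := hAs φ hφ q.1 hq'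
    rcases k with k | k <;> rcases l with l | l
    · exact contDiffAt_comp_fst (J k l)
    · exact contDiffAt_const
    · refine contDiffAt_comp_fst (f := fun r => ((fibreEndo (Y.G a (φ.symm r)) (h (φ.symm r)).1) *
        connMatrix Y a φ r - connMatrix Y a φ r * endoComp j φ r) k l) ?_
      simp only [Matrix.sub_apply, Matrix.mul_apply, Fin.sum_univ_two]
      exact (((F k 0).mul (A 0 l)).add ((F k 1).mul (A 1 l))).sub
        (((A k 0).mul (J 0 l)).add ((A k 1).mul (J 1 l)))
    · exact contDiffAt_comp_fst (f := fun r => fibreEndo (Y.G a (φ.symm r)) (h (φ.symm r)).1 k l)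
        (F k l)
  · suffices H : ∀ u : E2 × (Fin 2 → ℝ), semiflatEndoAt Y a h j b (semiflatEndoAt Y a h j b u) = -u
      from H
    intro u
    rw [semiflatEndoAt_apply, semiflatEndoAt_apply]
    simp only [sub_add_cancel, hFmul b hb, rotationField_sq hj hb, map_neg]
    ext i
    · simp
    · simp
  · suffices H : ∀ u u' : E2 × (Fin 2 → ℝ), Y.totalForm a b (semiflatEndoAt Y a h j b u)
        (semiflatEndoAt Y a h j b u') = Y.totalForm a b u u' from H
    intro u u'
    rw [totalForm_eq, totalForm_eq, semiflatEndoAt_apply, semiflatEndoAt_apply]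
    simp only [sub_add_cancel, rotationField_orth hj hb]
    rw [Matrix.mulVec_mulVec, ← Matrix.vecMul_transpose, ← Matrix.dotProduct_mulVec,
      Matrix.mulVec_mulVec, ← Matrix.mul_assoc,
      transpose_fibreEndo_mul_mul (Y.posDef a b hb) (isUnit_det_gl _)]
  · have hq' : q.1 ∈ Y.baseDom a φ := hq
    have hφ' := isSmoothChart_of_mem_atlas hφ
    rw [nijenhuis_congr (hEq φ hφ q hq)]
    refine nijenhuis_bundleEndo (hJs φ hφ _ hq') (hFs φ hφ _ hq') (hAs φ hφ _ hq')
      ((isOpen_baseDom (hY.isOpen a) φ).mem_nhds hq' |> Filter.Eventually.mono <| hJJ φ hφ) ?_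
      (hdA φ hφ _ hq') l k m
    have hjx : ∀ (f : S → ℝ), ContMDiffAt 𝓘(ℝ, E2) 𝓘(ℝ, ℝ) ∞ f (φ.symm q.1) → ∀ i,
        ∑ m, endoComp j φ q.1 m i * pd baseBasis m (fun z => f (φ.symm z)) q.1 =
          funDeriv f (φ.symm q.1) (endoAt j (φ.symm q.1) (paramDeriv φ.symm q.1 (baseBasis i))) := by
      intro f hf i
      rw [endoAt_paramDeriv hφ' hq'.1, map_sum]
      simp only [map_smul, smul_eq_mul, pd_comp_param hf (hφ'.contMDiffAt_symm hq'.1)]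
    have hX := hx _ hq'.2
    have hS := hs _ hq'.2
    intro i L M
    refine fibreEndo_holomorphic (x := fun z => x (φ.symm z)) (s := fun z => s (φ.symm z))
      (k := (h (φ.symm q.1)).1) (k' := ((h (φ.symm q.1)).1)⁻¹)
      (Matrix.nonsing_inv_mul _ (isUnit_det_gl _)) ((contMDiffAt_iff_contDiffAt hφ' hq'.1).1 hX)
      ((contMDiffAt_iff_contDiffAt hφ' hq'.1).1 hS) ?_ ?_ ?_ ?_ i L M
    · have hp := framed_posDef hq'.2 h
      change s (φ.symm q.1) ≠ 0
      rw [hsG _ hq'.2]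
      exact (div_pos (Real.sqrt_pos.2 hp.det_pos) hp.diag_pos).ne'
    · intro i
      rw [hjx x hX, pd_comp_param hS (hφ'.contMDiffAt_symm hq'.1)]
      have := hCR _ hq'.2 (paramDeriv φ.symm q.1 (baseBasis i))
      linarith
    -- The second Cauchy–Riemann equation is the first one evaluated on `j v`, where `j² = -1`.
    · intro i
      rw [hjx s hS, pd_comp_param hX (hφ'.contMDiffAt_symm hq'.1)]
      have := hCR _ hq'.2 (endoAt j (φ.symm q.1) (paramDeriv φ.symm q.1 (baseBasis i)))
      rw [rotationField_sq hj hq'.2, map_neg] at this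
      linarith
    · filter_upwards [hdom φ q.1 hq'] with z hz
      have hp := framed_posDef hz.2.1 h
      rw [hxG _ hz.2.1, hsG _ hz.2.1, ← rotation_eq hp, ← hz.2.2]
      rfl
  · have hq' : q.1 ∈ Y.baseDom a φ := hq
    obtain ⟨c, hc⟩ := hY.det_const
    rw [extDeriv2_congr (Filter.Eventually.of_forall fun r => kahlerForm_eq r)]
    -- `W₀` is the fibre area form with the frame frozen at the given point and `det G` replaced by
    -- its constant value `c`.
    refine extDeriv2_bundleForm (W₀ := (|(h (φ.symm q.1)).1.det| * √c) •
      ((((h (φ.symm q.1)).1)⁻¹)ᵀ * !![0, 1; -1, 0] * ((h (φ.symm q.1)).1)⁻¹)) (hAs φ hφ _ hq')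
      ?_ ?_ ?_ (hdA φ hφ _ hq') k l m
    · filter_upwards [hdom φ q.1 hq'] with z hz α β
      have h1 := rotationField_orth hj hz.2.1 (endoAt j (φ.symm z) (paramDeriv φ.symm z (baseBasis α)))
        (paramDeriv φ.symm z (baseBasis β))
      rw [rotationField_sq hj hz.2.1, map_neg, neg_apply,
        hY.metric.symm] at h1
      exact h1.symm
    · filter_upwards [hdom φ q.1 hq'] with z hz
      rw [transpose_fibreEndo_mul (Y.posDef a _ hz.2.1) (isUnit_det_gl _), hz.2.2, hc a _ hz.2.1]
    · intro k l
      simp [Matrix.mul_apply, Fin.sum_univ_two]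
      ring

end SemiflatTheorem

end CoordGeom

namespace CoordGeom

open Sum

/-! ### Constancy of the fibre volume, flatness and conformality on the base. -/

section Base

variable {B : Type*} [TopologicalSpace B] [ChartedSpace E2 B] [IsManifold 𝓘(ℝ, E2) ∞ B] {ι : Type*}
  {X : TorusGroupoid ι B} {a : ι} {φ : OpenPartialHomeomorph B E2} {y : E2}

theorem contMDiffAt_fibreMetric (hX : X.IsRiemannian) {b : B} (hb : b ∈ X.U a) (I J : Fin 2) :
    ContMDiffAt 𝓘(ℝ, E2) 𝓘(ℝ, ℝ) ∞ (fun b => X.G a b I J) b :=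
  (hX.G_smooth a I J).contMDiffAt ((hX.isOpen a).mem_nhds hb)

theorem contDiffAt_fibreMetric (hX : X.IsRiemannian) (hφ : φ ∈ atlas E2 B) (hy : y ∈ X.baseDom a φ)
    (I J : Fin 2) : ContDiffAt ℝ ∞ (fun z => X.G a (φ.symm z) I J) y :=
  (contMDiffAt_iff_contDiffAt (isSmoothChart_of_mem_atlas hφ) hy.1).1
    (contMDiffAt_fibreMetric hX hy.2 I J)

theorem contDiffAt_connMatrix (hX : X.IsRiemannian) (hφ : φ ∈ atlas E2 B) (hy : y ∈ X.baseDom a φ)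
    (I α : Fin 2) : ContDiffAt ℝ ∞ (fun z => connMatrix X a φ z I α) y :=
  (hX.A_smooth a φ hφ I α).contDiffAt ((isOpen_baseDom (hX.isOpen a) φ).mem_nhds hy)

theorem eventually_mem_baseDom (hX : X.IsRiemannian) (hy : y ∈ X.baseDom a φ) :
    ∀ᶠ z in 𝓝 y, z ∈ X.baseDom a φ := (isOpen_baseDom (hX.isOpen a) φ).mem_nhds hy

omit [IsManifold 𝓘(ℝ, E2) ∞ B] in
theorem fibreMetric_symm {b : B} (hb : b ∈ X.U a) (i j : Fin 2) : X.G a b i j = X.G a b j i := by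
  simpa using ((X.posDef a b hb).1.apply j i)

theorem det_fibreMetric_eq (hX : X.IsRiemannian) {c : ι} {b : B} (hb : b ∈ X.U a ∩ X.U c) :
    (X.G a b).det = (X.G c b).det := by
  have h1 : (X.γ a c b).1.det ^ 2 = 1 := by rw [← sq_abs, hX.γ_det a c b hb, one_pow]
  rw [hX.G_compat a c b hb, Matrix.det_mul, Matrix.det_mul, Matrix.det_transpose]
  linear_combination (X.G c b).det * h1

theorem laplacian_sqrt_det_fibreMetric (hX : X.IsRiemannian) (hRic : X.IsRicciFlat)
    (hφ : φ ∈ atlas E2 B) (hy : y ∈ X.baseDom a φ) :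
    0 ≤ laplacian baseBasis (metricComp X.g φ) (fun z => √(X.G a (φ.symm z)).det) y ∧
    (laplacian baseBasis (metricComp X.g φ) (fun z => √(X.G a (φ.symm z)).det) y = 0 → ∀ I,
      pd baseBasis 0 (fun z => connMatrix X a φ z I 1) y =
        pd baseBasis 1 (fun z => connMatrix X a φ z I 0) y) := by
  have hg := hX.g_riemannian.isSmoothMetric
  refine laplacian_sqrt_det (x := (0 : Fin 2 → ℝ))
    (hg.smooth φ (isSmoothChart_of_mem_atlas hφ) y hy.1)
    (contDiffAt_fibreMetric hX hφ hy) (contDiffAt_connMatrix hX hφ hy)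
    (hg.metricComp_posDef (isSmoothChart_of_mem_atlas hφ) hy.1) (X.posDef a _ hy.2)
    (fun z => hg.metricComp_symm φ z)
    ((eventually_mem_baseDom hX hy).mono fun z hz => fibreMetric_symm hz.2) fun i j => ?_
  rw [← totalMetric_eq]
  exact hRic a φ hφ (y, 0) hy i j

/-- The fibre volume is constant. -/
theorem exists_det_eq (hX : X.IsRiemannian) (hRic : X.IsRicciFlat)
    (hbdd : ∃ C : ℝ, ∀ a, ∀ b ∈ X.U a, (X.G a b).det ≤ C) (hpar : IsParabolic X.g) :
    ∃ c : ℝ, ∀ a, ∀ b ∈ X.U a, (X.G a b).det = c := by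
  -- Any member of the cover may be chosen at each point, since `det G` is unchanged by transition
  -- matrices of determinant `±1`. Near a point `u` agrees with a smooth local expression.
  let u : B → ℝ := fun b => √(X.G (X.cover b).choose b).det
  have hu : ∀ a, ∀ b ∈ X.U a, u b = √(X.G a b).det := fun a b hb => by
    simp only [u, det_fibreMetric_eq hX ⟨(X.cover b).choose_spec, hb⟩]
  have hue : ∀ a, ∀ φ ∈ atlas E2 B, ∀ y ∈ X.baseDom a φ,
      (fun z => u (φ.symm z)) =ᶠ[𝓝 y] fun z => √(X.G a (φ.symm z)).det := fun a φ hφ y hy =>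
    (eventually_mem_baseDom hX hy).mono fun z hz => hu a _ hz.2
  obtain ⟨C, hC⟩ := hbdd
  suffices H : ContMDiff 𝓘(ℝ, E2) 𝓘(ℝ, ℝ) 2 u ∧ √C ∈ upperBounds (range u) ∧
      IsSubharmonic X.g u by
    obtain ⟨c, hc⟩ := hpar u H.1 (fun b => Real.sqrt_nonneg _) ⟨√C, H.2.1⟩ H.2.2
    refine ⟨c ^ 2, fun a b hb => ?_⟩
    rw [← hc b, hu a b hb, Real.sq_sqrt (X.posDef a b hb).det_pos.le]
  refine ⟨?_, ?_, ?_⟩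
  · intro b
    obtain ⟨a, ha⟩ := X.cover b
    have hφ := chart_mem_atlas E2 b
    have hb := mem_chart_source E2 b
    have hl := (chartAt E2 b).left_inv hb
    have hy : chartAt E2 b b ∈ X.baseDom a (chartAt E2 b) :=
      ⟨(chartAt E2 b).map_source hb, by rw [mem_preimage, hl]; exact ha⟩
    have h1 := (contDiffAt_det (contDiffAt_fibreMetric hX hφ hy)).sqrt
      (X.posDef a _ hy.2).det_pos.ne'
    have h2 := (contMDiffAt_iff_contDiffAt (isSmoothChart_of_mem_atlas hφ) hy.1).2
      (h1.congr_of_eventuallyEq (hue a _ hφ _ hy))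
    rw [hl] at h2
    exact h2.of_le ENat.LEInfty.out
  · rintro _ ⟨b, rfl⟩
    exact Real.sqrt_le_sqrt (hC _ b (X.cover b).choose_spec)
  · intro φ hφ y hy
    obtain ⟨a, ha⟩ := X.cover (φ.symm y)
    rw [laplacian_congr (hue a φ hφ y ⟨hy, ha⟩)]
    exact (laplacian_sqrt_det_fibreMetric hX hRic hφ ⟨hy, ha⟩).1

/-- The connection is flat if the fibre volume is constant. -/
theorem curvature_eq_zero (hX : X.IsRiemannian) (hRic : X.IsRicciFlat)
    {c : ℝ} (hc : ∀ a, ∀ b ∈ X.U a, (X.G a b).det = c) (hφ : φ ∈ atlas E2 B)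
    (hy : y ∈ X.baseDom a φ) (I α β : Fin 2) : X.FComp a φ I α β y = 0 := by
  have h0 : laplacian baseBasis (metricComp X.g φ) (fun z => √(X.G a (φ.symm z)).det) y = 0 := by
    rw [laplacian_congr (f' := fun _ => √c)
      ((eventually_mem_baseDom hX hy).mono fun z hz => by rw [hc a _ hz.2])]
    have hpd : ∀ j, pd baseBasis j (fun _ : E2 => √c) = fun _ => 0 := fun j => by
      ext r; exact pd_const j _
    simp [laplacian, hpd]
  have h1 := (laplacian_sqrt_det_fibreMetric hX hRic hφ hy).2 h0 I
  have h2 : X.FComp a φ I 0 1 y = 0 := sub_eq_zero.2 h1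
  have h3 : ∀ α β, X.FComp a φ I α β y = -X.FComp a φ I β α y := fun α β => (neg_sub _ _).symm
  fin_cases α <;> fin_cases β
  · exact sub_self _
  · exact h2
  · exact (h3 1 0).trans (by rw [h2, neg_zero])
  · exact sub_self _

theorem isFlatData (hX : X.IsRiemannian) (hRic : X.IsRicciFlat)
    (hc : ∃ c : ℝ, ∀ a, ∀ b ∈ X.U a, (X.G a b).det = c) : IsFlatData X where
  isOpen := hX.isOpen
  metric := hX.g_riemannian.isSmoothMetric
  G_smooth _ _ hb := contMDiffAt_fibreMetric hX hb
  A_smooth _ _ hφ _ hy := contDiffAt_connMatrix hX hφ hy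
  flat _ _ hφ _ hy := curvature_eq_zero hX hRic hc.choose_spec hφ hy
  det_const := hc

/-- The equations satisfied by the point of the upper half-plane given by the fibre metric. -/
theorem frame_equations (hX : X.IsRiemannian) (hRic : X.IsRicciFlat)
    (hc : ∃ c : ℝ, ∀ a, ∀ b ∈ X.U a, (X.G a b).det = c) (hφ : φ ∈ atlas E2 B)
    (hy : y ∈ X.baseDom a φ) (h : GL (Fin 2) ℝ) :
    laplacian baseBasis (metricComp X.g φ)
      (fun z => (h.1ᵀ * X.G a (φ.symm z) * h.1) 0 1 / (h.1ᵀ * X.G a (φ.symm z) * h.1) 0 0) y = 0 ∧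
    laplacian baseBasis (metricComp X.g φ)
      (fun z => √(h.1ᵀ * X.G a (φ.symm z) * h.1).det / (h.1ᵀ * X.G a (φ.symm z) * h.1) 0 0) y = 0 ∧
    ∃ σ : ℝ, (σ = 1 ∨ σ = -1) ∧ ∀ a', crDefect (metricComp X.g φ)
      (fun z => (h.1ᵀ * X.G a (φ.symm z) * h.1) 0 1 / (h.1ᵀ * X.G a (φ.symm z) * h.1) 0 0)
      (fun z => √(h.1ᵀ * X.G a (φ.symm z) * h.1).det / (h.1ᵀ * X.G a (φ.symm z) * h.1) 0 0)
      σ a' y = 0 := by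
  have hg := hX.g_riemannian.isSmoothMetric
  obtain ⟨c, hc⟩ := hc
  refine harmonic_conformal_frame (x := (0 : Fin 2 → ℝ)) (c := c)
    (hg.smooth φ (isSmoothChart_of_mem_atlas hφ) y hy.1)
    (contDiffAt_fibreMetric hX hφ hy) (contDiffAt_connMatrix hX hφ hy)
    (hg.metricComp_posDef (isSmoothChart_of_mem_atlas hφ) hy.1) (X.posDef a _ hy.2)
    (fun z => hg.metricComp_symm φ z)
    ((eventually_mem_baseDom hX hy).mono fun z hz => fibreMetric_symm hz.2) (fun i j => ?_)
    (fun I => sub_eq_zero.1 (curvature_eq_zero hX hRic hc hφ hy I 0 1))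
    ((eventually_mem_baseDom hX hy).mono fun z hz => hc a _ hz.2) (isUnit_det_gl h)
  rw [← totalMetric_eq]
  exact hRic a φ hφ (y, 0) hy i j

end Base

end CoordGeom

namespace CoordGeom

open Sum

/-! ### Pullback of the data by a local diffeomorphism. -/

section ChangeOfVariables

variable {T : E2 → E2} {y : E2}

theorem pd_comp_map {f : E2 → ℝ} (hf : DifferentiableAt ℝ f (T y)) (hT : DifferentiableAt ℝ T y)
    (a : Fin 2) : pd baseBasis a (fun z => f (T z)) y =
      ∑ k, pd baseBasis k f (T y) * jacobian T y k a := by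
  have h := fderiv_comp y hf hT
  rw [show f ∘ T = fun z => f (T z) from rfl] at h
  rw [pd, h, ContinuousLinearMap.comp_apply, fderiv_eq_sum_jacobian, map_sum]
  simp only [map_smul, smul_eq_mul, pd, mul_comm]

theorem pd_jacobian_comm (hT : ContDiffAt ℝ ∞ T y) (i a b : Fin 2) :
    pd baseBasis a (fun z => jacobian T z i b) y = pd baseBasis b (fun z => jacobian T z i a) y := by
  have hTi : ContDiffAt ℝ ∞ (fun z => T z i) y :=
    ((contDiff_coord i).contDiffAt (x := T y)).comp y hT
  have e : ∀ b, (fun z => jacobian T z i b) =ᶠ[𝓝 y] pd baseBasis b (fun z => T z i) := by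
    intro b
    filter_upwards [(hT.of_le (m := 1) (mod_cast le_top)).eventually (by simp)] with z hz
    have h := fderiv_comp z ((contDiff_coord i).contDiffAt (x := T z)).dAt
      (hz.differentiableAt (by simp))
    rw [show (fun r : E2 => r i) ∘ T = fun z => T z i from rfl] at h
    rw [pd, h, ContinuousLinearMap.comp_apply]
    have h2 : HasFDerivAt (fun r : E2 => r i) (EuclideanSpace.proj i : E2 →L[ℝ] ℝ) (T z) :=
      (EuclideanSpace.proj i : E2 →L[ℝ] ℝ).hasFDerivAt
    rw [h2.fderiv]
    rfl
  rw [pd_congr a (e b), pd_congr b (e a), pd_comm a b hTi]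

/-- The pullback of a closed one-form is closed. -/
theorem pd_pullback_form {M : E2 → Fin 2 → ℝ} (hT : ContDiffAt ℝ ∞ T y)
    (hM : ∀ i, ContDiffAt ℝ ∞ (fun r => M r i) (T y))
    (hd : ∀ a b, pd baseBasis a (fun r => M r b) (T y) = pd baseBasis b (fun r => M r a) (T y))
    (a b : Fin 2) :
    pd baseBasis a (fun z => ∑ i, M (T z) i * jacobian T z i b) y =
      pd baseBasis b (fun z => ∑ i, M (T z) i * jacobian T z i a) y := by
  have hMT : ∀ i, ContDiffAt ℝ ∞ (fun z => M (T z) i) y := fun i => (hM i).comp y hT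
  have e : ∀ a b, pd baseBasis a (fun z => ∑ i, M (T z) i * jacobian T z i b) y =
      ∑ i, ((∑ k, pd baseBasis k (fun r => M r i) (T y) * jacobian T y k a) * jacobian T y i b
        + M (T y) i * pd baseBasis a (fun z => jacobian T z i b) y) := by
    intro a b
    rw [pd_sum _ _ fun i _ => ((hMT i).mul (contDiffAt_jacobian hT i b)).dAt]
    refine Finset.sum_congr rfl fun i _ => ?_
    rw [pd_mul _ (hMT i).dAt (contDiffAt_jacobian hT i b).dAt,
      pd_comp_map (f := fun r => M r i) (hM i).dAt (hT.differentiableAt (by simp))]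
  rw [e, e]
  simp only [Fin.sum_univ_two, pd_jacobian_comm hT _ a b]
  linear_combination (jacobian T y 1 a * jacobian T y 0 b - jacobian T y 0 a * jacobian T y 1 b) * hd 1 0

theorem laplacian_congr_metric {k : Type*} [Fintype k] [DecidableEq k] {V : Type*}
    [NormedAddCommGroup V] [NormedSpace ℝ V] {e : k → V} {g g' : V → Matrix k k ℝ} {f f' : V → ℝ}
    {q : V} (hg : g =ᶠ[𝓝 q] g') (hf : f =ᶠ[𝓝 q] f') : laplacian e g f q = laplacian e g' f' q := by
  have hd : ∀ i a b, pd e i (fun r => g r a b) q = pd e i (fun r => g' r a b) q := fun i a b =>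
    pd_congr i (hg.mono fun r hr => by simp only [hr])
  rw [laplacian_congr hf]
  simp only [laplacian, christoffel, hd, hg.self_of_nhds]

theorem crDefect_congr {g g' : E2 → Matrix (Fin 2) (Fin 2) ℝ} {x x' s s' : E2 → ℝ}
    (hg : g =ᶠ[𝓝 y] g') (hx : x =ᶠ[𝓝 y] x') (hs : s =ᶠ[𝓝 y] s') (σ : ℝ) (a : Fin 2) :
    crDefect g x s σ a y = crDefect g' x' s' σ a y := by
  simp only [crDefect, pd_congr _ hx, pd_congr _ hs, hg.self_of_nhds]

end ChangeOfVariables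

section Pullback

variable {B : Type*} [TopologicalSpace B] [ChartedSpace E2 B] {ι : Type*} {X : TorusGroupoid ι B}
  {C : Type*} [TopologicalSpace C] [ChartedSpace E2 C] {p : C → B} {a : ι}

/-- The matrix of the connection form along a parametrization. -/
noncomputable def connAlong (X : TorusGroupoid ι B) (a : ι) (q : E2 → B) (y : E2) :
    Matrix (Fin 2) (Fin 2) ℝ :=
  Matrix.of fun I α => connAt X a (q y) (paramDeriv q y (baseBasis α)) I

theorem connAlong_eq {φ : OpenPartialHomeomorph B E2} (hφ : IsSmoothChart φ) {q : E2 → B} {y : E2}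
    (hq : ContMDiffAt 𝓘(ℝ, E2) 𝓘(ℝ, E2) ∞ q y) (hy : q y ∈ φ.source) (I α : Fin 2) :
    connAlong X a q y I α =
      ∑ i, connMatrix X a φ (φ (q y)) I i * jacobian (fun z => φ (q z)) y i α := by
  have h : ∀ i, connMatrix X a φ (φ (q y)) I i =
      connAt X a (q y) (paramDeriv φ.symm (φ (q y)) (baseBasis i)) I := by
    intro i
    change connAt X a (φ.symm (φ (q y))) _ I = _
    rw [φ.left_inv hy]
    rfl
  rw [connAlong, Matrix.of_apply, hφ.paramDeriv_eq hq hy, fderiv_eq_sum_jacobian, map_sum, map_sum,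
    Finset.sum_apply]
  refine Finset.sum_congr rfl fun i _ => ?_
  rw [map_smul, map_smul, h, Pi.smul_apply, smul_eq_mul, mul_comm]

/-- The differential of a map of surfaces, as a map between planes. -/
noncomputable def surfaceDeriv (p : C → B) (x : C) : E2 →L[ℝ] E2 :=
  mfderiv 𝓘(ℝ, E2) 𝓘(ℝ, E2) p x

theorem paramDeriv_comp {q : E2 → C} {y : E2} (hp : ContMDiffAt 𝓘(ℝ, E2) 𝓘(ℝ, E2) ∞ p (q y))
    (hq : ContMDiffAt 𝓘(ℝ, E2) 𝓘(ℝ, E2) ∞ q y) (v : E2) :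
    paramDeriv (fun z => p (q z)) y v = surfaceDeriv p (q y) (paramDeriv q y v) :=
  congrArg (fun L : E2 →L[ℝ] E2 => L v)
    (mfderiv_comp y (hp.mdifferentiableAt (by simp)) (hq.mdifferentiableAt (by simp)))

variable {ψ : OpenPartialHomeomorph C E2} {y : E2}

theorem metricComp_pullback (hp : ContMDiff 𝓘(ℝ, E2) 𝓘(ℝ, E2) ∞ p) (hψ : IsSmoothChart ψ)
    (hy : y ∈ ψ.target) : metricComp (X.pullback p).g ψ y =
      metricAlong X.g (fun z => p (ψ.symm z)) y := by
  ext α β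
  rw [metricAlong, Matrix.of_apply, paramDeriv_comp (hp _) (hψ.contMDiffAt_symm hy),
    paramDeriv_comp (hp _) (hψ.contMDiffAt_symm hy)]
  rfl

theorem connMatrix_pullback (hp : ContMDiff 𝓘(ℝ, E2) 𝓘(ℝ, E2) ∞ p) (hψ : IsSmoothChart ψ)
    (hy : y ∈ ψ.target) : connMatrix (X.pullback p) a ψ y =
      connAlong X a (fun z => p (ψ.symm z)) y := by
  ext I α
  rw [connAlong, Matrix.of_apply, paramDeriv_comp (hp _) (hψ.contMDiffAt_symm hy)]
  rfl

theorem surfaceDeriv_injective (hp : IsLocalDiffeomorph 𝓘(ℝ, E2) 𝓘(ℝ, E2) ∞ p) (x : C) (v : E2)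
    (hv : surfaceDeriv p x v = 0) : v = 0 := by
  have h : ∀ v : E2, (hp x).mfderivToContinuousLinearEquiv (by simp) v = surfaceDeriv p x v :=
    fun v => rfl
  exact (map_eq_zero_iff _ ((hp x).mfderivToContinuousLinearEquiv (by simp)).injective).1
    ((h v).trans hv)

theorem isSmoothMetric_pullback [IsManifold 𝓘(ℝ, E2) ∞ B] (hg : IsRiemannianMetric X.g)
    (hp : IsLocalDiffeomorph 𝓘(ℝ, E2) 𝓘(ℝ, E2) ∞ p) : IsSmoothMetric (X.pullback p).g := by
  have hg' := hg.isSmoothMetric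
  refine ⟨fun x v w => hg'.symm _ _ _, fun x v hv => hg'.pos _ _ fun h0 =>
    hv (surfaceDeriv_injective hp x v h0), fun ψ hψ y hy i j => ?_⟩
  have hq : ContMDiffOn 𝓘(ℝ, E2) 𝓘(ℝ, E2) ∞ (fun z => p (ψ.symm z)) ψ.target :=
    hp.contMDiff.comp_contMDiffOn hψ.smooth_symm
  refine ((contDiffOn_metricAlong hg ψ.open_target hq i j).contDiffAt
    (ψ.open_target.mem_nhds hy)).congr_of_eventuallyEq ?_
  filter_upwards [ψ.open_target.mem_nhds hy] with z hz
  rw [metricComp_pullback hp.contMDiff hψ hz]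

/-- The connection form of the pullback in coordinates. -/
theorem connMatrix_pullback_eventuallyEq (hp : ContMDiff 𝓘(ℝ, E2) 𝓘(ℝ, E2) ∞ p)
    (hψ : IsSmoothChart ψ) (hy : y ∈ ψ.target) {φ : OpenPartialHomeomorph B E2}
    (hφ : IsSmoothChart φ) (hyφ : p (ψ.symm y) ∈ φ.source) (I α : Fin 2) :
    (fun z => connMatrix (X.pullback p) a ψ z I α) =ᶠ[𝓝 y] fun z =>
      ∑ i, connMatrix X a φ (φ (p (ψ.symm z))) I i *
        jacobian (fun z => φ (p (ψ.symm z))) z i α := by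
  have hc : ContinuousAt (fun z => p (ψ.symm z)) y :=
    (hp.continuous.continuousAt).comp (ψ.symm.continuousAt hy)
  filter_upwards [ψ.open_target.mem_nhds hy, hc.eventually (φ.open_source.mem_nhds hyφ)] with z hz hzφ
  have hq : ContMDiffAt 𝓘(ℝ, E2) 𝓘(ℝ, E2) ∞ (fun z => p (ψ.symm z)) z :=
    ContMDiffAt.comp z (hp _) (hψ.contMDiffAt_symm hz)
  rw [connMatrix_pullback hp hψ hz, connAlong_eq hφ hq hzφ]

/-- The curvature of the pullback is computed in coordinates as the pullback of a closed one-form,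
so it vanishes; the fibre volume is unchanged. -/
theorem IsFlatData.pullback [IsManifold 𝓘(ℝ, E2) ∞ B] [IsManifold 𝓘(ℝ, E2) ∞ C]
    (hX : IsFlatData X) (hg : IsRiemannianMetric X.g)
    (hp : IsLocalDiffeomorph 𝓘(ℝ, E2) 𝓘(ℝ, E2) ∞ p) : IsFlatData (X.pullback p) := by
  have hpc := hp.contMDiff
  have chart : ∀ a, ∀ ψ ∈ atlas E2 C, ∀ y ∈ (X.pullback p).baseDom a ψ,
      ∃ φ ∈ atlas E2 B, p (ψ.symm y) ∈ φ.source ∧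
        φ (p (ψ.symm y)) ∈ X.baseDom a φ ∧ ContDiffAt ℝ ∞ (fun z => φ (p (ψ.symm z))) y := by
    intro a ψ hψ y hy
    have hφ := chart_mem_atlas E2 (p (ψ.symm y))
    have hs := mem_chart_source E2 (p (ψ.symm y))
    refine ⟨_, hφ, hs, ⟨(chartAt E2 _).map_source hs, ?_⟩, ?_⟩
    · rw [mem_preimage, (chartAt E2 _).left_inv hs]
      exact hy.2
    · exact (isSmoothChart_of_mem_atlas hφ).contDiffAt_comp (q := fun z => p (ψ.symm z))
        (ContMDiffAt.comp y (hpc _) ((isSmoothChart_of_mem_atlas hψ).contMDiffAt_symm hy.1)) hs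
  refine ⟨fun a => (hX.isOpen a).preimage hpc.continuous, isSmoothMetric_pullback hg hp,
    fun a x hx I J => ContMDiffAt.comp x (hX.G_smooth a (p x) hx I J) (hpc x),
    fun a ψ hψ y hy I α => ?_, fun a ψ hψ y hy I α β => ?_, ?_⟩
  · obtain ⟨φ, hφ, hs, hd, hT⟩ := chart a ψ hψ y hy
    have h := connMatrix_pullback_eventuallyEq (X := X) (a := a) hpc (isSmoothChart_of_mem_atlas hψ)
      hy.1 (isSmoothChart_of_mem_atlas hφ) hs I α
    refine ContDiffAt.congr_of_eventuallyEq ?_ h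
    refine ContDiffAt.sum fun i _ => ContDiffAt.mul ?_ (contDiffAt_jacobian hT i α)
    exact (hX.A_smooth a φ hφ _ hd I i).comp y hT
  · obtain ⟨φ, hφ, hs, hd, hT⟩ := chart a ψ hψ y hy
    have h := fun α => connMatrix_pullback_eventuallyEq (X := X) (a := a) hpc
      (isSmoothChart_of_mem_atlas hψ) hy.1 (isSmoothChart_of_mem_atlas hφ) hs I α
    change pd baseBasis α (fun z => connMatrix (X.pullback p) a ψ z I β) y -
      pd baseBasis β (fun z => connMatrix (X.pullback p) a ψ z I α) y = 0
    rw [pd_congr _ (h α), pd_congr _ (h β), sub_eq_zero]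
    exact pd_pullback_form (M := fun r i => connMatrix X a φ r I i) hT
      (fun i => hX.A_smooth a φ hφ _ hd I i)
      (fun α β => sub_eq_zero.1 (hX.flat a φ hφ _ hd I α β)) α β
  · obtain ⟨c, hc⟩ := hX.det_const
    exact ⟨c, fun a x hx => hc a (p x) hx⟩

/-- Around each point of the covering surface there is a coordinate system lifted from the base. -/
theorem exists_lifted_chart [IsManifold 𝓘(ℝ, E2) ∞ B]
    (hp : IsLocalDiffeomorph 𝓘(ℝ, E2) 𝓘(ℝ, E2) ∞ p) (x : C) :
    ∃ ψ : OpenPartialHomeomorph C E2, IsSmoothChart ψ ∧ x ∈ ψ.source ∧ ∃ φ ∈ atlas E2 B,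
      ∀ z ∈ ψ.target, z ∈ φ.target ∧ p (ψ.symm z) = φ.symm z := by
  obtain ⟨Φ, hx, hΦ⟩ := hp x
  let φ := chartAt E2 (p x)
  have hφ := isSmoothChart_of_mem_atlas (chart_mem_atlas E2 (p x))
  refine ⟨Φ.toOpenPartialHomeomorph.trans φ, ⟨?_, ?_⟩, ?_, φ, chart_mem_atlas E2 (p x), ?_⟩
  · rw [OpenPartialHomeomorph.trans_source]
    exact hφ.smooth.comp (Φ.contMDiffOn_toFun.mono inter_subset_left) fun z hz => hz.2
  · rw [OpenPartialHomeomorph.trans_target]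
    exact Φ.contMDiffOn_invFun.comp (hφ.smooth_symm.mono inter_subset_left) fun z hz => hz.2
  · rw [OpenPartialHomeomorph.trans_source]
    refine ⟨hx, ?_⟩
    change Φ x ∈ φ.source
    rw [← hΦ hx]
    exact mem_chart_source E2 (p x)
  · intro z hz
    rw [OpenPartialHomeomorph.trans_target] at hz
    have h2 : φ.symm z ∈ Φ.target := hz.2
    refine ⟨hz.1, ?_⟩
    refine (hΦ (Φ.toOpenPartialHomeomorph.map_target h2)).trans ?_
    exact Φ.toOpenPartialHomeomorph.right_inv h2

end Pullback

end CoordGeom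

namespace CoordGeom

open Sum

/-! ### Fibre metrics and complex structures in flat frames. -/

section Frames

variable {S : Type*} [TopologicalSpace S] [ChartedSpace E2 S] {ι : Type*} {Y : TorusGroupoid ι S}

theorem IsFlatData.contMDiffAt_framed [IsManifold 𝓘(ℝ, E2) ∞ S] (hY : IsFlatData Y) {a : ι}
    {h : S → GL (Fin 2) ℝ} {b : S} (hb : b ∈ Y.U a) (hh : ∀ᶠ b' in 𝓝 b, h b' = h b) :
    ContMDiffAt 𝓘(ℝ, E2) 𝓘(ℝ, ℝ) ∞ (fun b => framed Y a h b 0 1 / framed Y a h b 0 0) b ∧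
    ContMDiffAt 𝓘(ℝ, E2) 𝓘(ℝ, ℝ) ∞ (fun b => √(framed Y a h b).det / framed Y a h b 0 0) b := by
  have hφ := isSmoothChart_of_mem_atlas (chart_mem_atlas E2 b)
  set φ := chartAt E2 b
  have hs : b ∈ φ.source := mem_chart_source E2 b
  have hy := φ.map_source hs
  have hl := φ.left_inv hs
  have hp : (framed Y a h b).PosDef := framed_posDef hb h
  have hM : ∀ i j, ContDiffAt ℝ ∞
      (fun z => ((h b).1ᵀ * Y.G a (φ.symm z) * (h b).1) i j) (φ b) :=
    contDiffAt_congruence (fun i j => (contMDiffAt_iff_contDiffAt hφ hy).1 (by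
      rw [hl]; exact hY.G_smooth a b hb i j)) _ _
  have hM0 : ((h b).1ᵀ * Y.G a (φ.symm (φ b)) * (h b).1) 0 0 ≠ 0 := by
    rw [hl]; exact hp.diag_pos.ne'
  have hMd : ((h b).1ᵀ * Y.G a (φ.symm (φ b)) * (h b).1).det ≠ 0 := by
    rw [hl]; exact hp.det_pos.ne'
  have he : ∀ᶠ z in 𝓝 (φ b), framed Y a h (φ.symm z) =
      (h b).1ᵀ * Y.G a (φ.symm z) * (h b).1 := by
    refine eventually_symm (P := fun b' => framed Y a h b' = (h b).1ᵀ * Y.G a b' * (h b).1) hy ?_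
    rw [hl]
    filter_upwards [hh] with b' hb'
    rw [framed, hb']
  have h1 := (contMDiffAt_iff_contDiffAt hφ hy
    (f := fun b => framed Y a h b 0 1 / framed Y a h b 0 0)).2
    (((hM 0 1).div (hM 0 0) hM0).congr_of_eventuallyEq (he.mono fun z hz => by simp only [hz, Pi.div_apply]))
  have h2 := (contMDiffAt_iff_contDiffAt hφ hy
    (f := fun b => √(framed Y a h b).det / framed Y a h b 0 0)).2
    ((((contDiffAt_det hM).sqrt hMd).div (hM 0 0) hM0).congr_of_eventuallyEq
      (he.mono fun z hz => by simp only [hz, Pi.div_apply]))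
  rw [hl] at h1 h2
  exact ⟨h1, h2⟩

theorem _root_.IsRotationField.mono {g : TangentForm S} {U V : Set S} {j : TangentEndo S}
    (hj : IsRotationField g U j) (hVU : V ⊆ U) : IsRotationField g V j :=
  ⟨fun b hb => hj.sq b (hVU hb), fun b hb => hj.orth b (hVU hb), fun φ hφ α β =>
    (hj.smooth φ hφ α β).mono (inter_subset_inter_right _ (preimage_mono hVU))⟩

/-- Frame and fibre metric transform by inverse rules under `γ`, so the arbitrary choice in
`frameMetric` is immaterial. -/
theorem frameMetric_eq_framed {h : ι → S → GL (Fin 2) ℝ} (hh : Y.IsFlatFrame h)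
    (hG : ∀ a c, ∀ b ∈ Y.U a ∩ Y.U c, Y.G a b = (Y.γ a c b).1ᵀ * Y.G c b * (Y.γ a c b).1)
    {a : ι} {b : S} (hb : b ∈ Y.U a) : Y.frameMetric h b = framed Y a (h a) b := by
  have hc := (Y.cover b).choose_spec
  rw [TorusGroupoid.frameMetric, framed, hh.compat _ a b ⟨hc, hb⟩, hG _ a b ⟨hc, hb⟩]
  simp only [Units.val_mul, Matrix.transpose_mul, Matrix.mul_assoc]

/-- The vertical part `u.2 + A u.1` is transformed by `γ` alone, since the differential of `f`
cancels between the transition map and the connection. The fibre rotation intertwines with `γ`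
because `h` is a global frame. -/
theorem isInvariant_semiflatEndo {h : ι → S → GL (Fin 2) ℝ} (hh : Y.IsFlatFrame h)
    (hG : ∀ a c, ∀ b ∈ Y.U a ∩ Y.U c, Y.G a b = (Y.γ a c b).1ᵀ * Y.G c b * (Y.γ a c b).1)
    (hA : ∀ a c, ∀ b ∈ Y.U a ∩ Y.U c, ∀ v, Y.A c b v = (Y.γ a c b).1 *ᵥ (Y.A a b v + Y.df a c b v))
    (j : TangentEndo S) : Y.IsInvariant fun a => semiflatEndo Y a (h a) j := by
  intro a c b hb
  let D : E2 → Fin 2 → ℝ := fun v => Y.df a c b v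
  have hA' : ∀ v : E2, connAt Y c b v = (Y.γ a c b).1 *ᵥ (connAt Y a b v + D v) := hA a c b hb
  suffices H : ∀ u : E2 × (Fin 2 → ℝ),
      semiflatEndoAt Y c (h c) j b (u.1, (Y.γ a c b).1 *ᵥ (u.2 - D u.1)) =
        ((semiflatEndoAt Y a (h a) j b u).1, (Y.γ a c b).1 *ᵥ
          ((semiflatEndoAt Y a (h a) j b u).2 - D (semiflatEndoAt Y a (h a) j b u).1)) from H
  intro u
  have hF := fibreEndo_change (G := Y.G c b) (h := (h a b).1) (isUnit_det_gl (Y.γ a c b))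
  rw [← hG a c b hb, ← Units.val_mul, ← hh.compat a c b hb] at hF
  rw [semiflatEndoAt_apply, semiflatEndoAt_apply]
  refine Prod.ext rfl ?_
  simp only [hA']
  rw [← Matrix.mulVec_add, Matrix.mulVec_mulVec, hF, ← Matrix.mulVec_mulVec, ← Matrix.mulVec_sub]
  congr 1
  rw [show u.2 - D u.1 + (connAt Y a b u.1 + D u.1) = u.2 + connAt Y a b u.1 by abel]
  abel

/-- The Cauchy-Riemann equations. -/
theorem isHolomorphicToH_of_isCauchyRiemannAt {g : TangentForm S} {j : TangentEndo S}
    (hj : IsRotationField g univ j) {τ : S → ℍ} {x s : S → ℝ}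
    (hx : ∀ b, ContMDiffAt 𝓘(ℝ, E2) 𝓘(ℝ, ℝ) ∞ x b)
    (hs : ∀ b, ContMDiffAt 𝓘(ℝ, E2) 𝓘(ℝ, ℝ) ∞ s b) (hτ : ∀ b, (τ b : ℂ) = ⟨x b, s b⟩)
    (hCR : ∀ b, IsCauchyRiemannAt j x s 1 b) : IsHolomorphicToH j τ := by
  let L : ℝ × ℝ →L[ℝ] ℂ := Complex.ofRealCLM.comp (ContinuousLinearMap.fst ℝ ℝ ℝ) +
    (ContinuousLinearMap.snd ℝ ℝ ℝ).smulRight Complex.I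
  have hL : ∀ a b, L (a, b) = a + b * Complex.I := fun a b => by simp [L]
  have hτL : (fun b => (τ b : ℂ)) = fun b => L (x b, s b) := by
    ext b
    rw [hτ, hL, Complex.mk_eq_add_mul_I]
  have hd : ∀ b, HasMFDerivAt 𝓘(ℝ, E2) 𝓘(ℝ, ℂ) (fun b => (τ b : ℂ)) b
      (L.comp ((funDeriv x b).prod (funDeriv s b))) := by
    intro b
    rw [hτL]
    have h1 := ((L.comp (ContinuousLinearMap.inl ℝ ℝ ℝ)).hasMFDerivAt (x := x b)).comp b
      ((hx b).mdifferentiableAt (by simp)).hasMFDerivAt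
    have h2 := ((L.comp (ContinuousLinearMap.inr ℝ ℝ ℝ)).hasMFDerivAt (x := s b)).comp b
      ((hs b).mdifferentiableAt (by simp)).hasMFDerivAt
    have e1 : (fun b => L (x b, s b)) = (L.comp (ContinuousLinearMap.inl ℝ ℝ ℝ)) ∘ x +
        (L.comp (ContinuousLinearMap.inr ℝ ℝ ℝ)) ∘ s := by
      ext b
      simp [hL]
    have e2 : L.comp ((funDeriv x b).prod (funDeriv s b)) =
        (L.comp (ContinuousLinearMap.inl ℝ ℝ ℝ)).comp (funDeriv x b) +
        (L.comp (ContinuousLinearMap.inr ℝ ℝ ℝ)).comp (funDeriv s b) := by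
      ext v : 1
      simp [hL]
    rw [e1]
    exact (h1.add h2).congr_mfderiv e2.symm
  refine ⟨fun b => (hd b).mdifferentiableAt, fun b => ?_⟩
  rw [(hd b).mfderiv]
  suffices H : ∀ v : E2, L (funDeriv x b (endoAt j b v), funDeriv s b (endoAt j b v)) =
      Complex.I * L (funDeriv x b v, funDeriv s b v) from H
  intro v
  have h1 := hCR b v
  have h2 := hCR b (endoAt j b v)
  have h3 : endoAt j b (endoAt j b v) = -v := hj.sq b (mem_univ b) v
  rw [h3, map_neg] at h2
  have e1 : funDeriv x b (endoAt j b v) = -funDeriv s b v := by linarith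
  have e2 : funDeriv s b (endoAt j b v) = funDeriv x b v := by linarith
  rw [hL, hL, e1, e2]
  push_cast
  linear_combination -(funDeriv s b v : ℂ) * Complex.I_mul_I

end Frames

section BaseStructure

variable {B : Type*} [TopologicalSpace B] [ChartedSpace E2 B] [IsManifold 𝓘(ℝ, E2) ∞ B] {ι : Type*}
  {X : TorusGroupoid ι B}

/-- A contractible `U a` is simply connected, so it has its own orientation field, and the
coordinate frame of `ℝ²` serves as flat frame. Different pieces need not have compatible structures.
-/
theorem exists_isSemiflatKahler (hX : X.IsRiemannian) (hRic : X.IsRicciFlat)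
    (hc : ∃ c : ℝ, ∀ a, ∀ b ∈ X.U a, (X.G a b).det = c) (a : ι) :
    ∃ (j : TangentEndo B) (J : TorusGroupoid.TotalEndo B), X.IsSemiflatKahler a j J := by
  have hY := isFlatData hX hRic hc
  have := hX.contractible a
  have : SimplyConnectedSpace (X.U a) := inferInstance
  have hsm : ∀ b ∈ X.U a, _ := fun b hb => hY.contMDiffAt_framed (h := fun _ => 1) hb
    (Filter.Eventually.of_forall fun _ => rfl)
  obtain ⟨j, hj, hCR⟩ := exists_holomorphic_orientation hY.metric (hX.isOpen a)
    (fun b hb => (hsm b hb).1) (fun b hb => (hsm b hb).2) fun b hb =>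
      ⟨chartAt E2 b, isSmoothChart_of_mem_atlas (chart_mem_atlas E2 b), mem_chart_source E2 b,
        fun y hy hyU => frame_equations hX hRic hc (chart_mem_atlas E2 b) ⟨hy, hyU⟩ 1⟩
  exact ⟨j, _, hY.isSemiflatKahler (fun b _ => Filter.Eventually.of_forall fun _ => rfl)
    (hj.isRotationField hY.metric) (fun b hb => (hsm b hb).1) (fun b hb => (hsm b hb).2)
    (fun _ _ => rfl) (fun _ _ => rfl) hCR⟩

end BaseStructure

/-! ### The universal cover: flat frames, holomorphy and monodromy. -/

section UniversalCover

variable {B : Type*} [TopologicalSpace B] [ChartedSpace E2 B] [IsManifold 𝓘(ℝ, E2) ∞ B] {ι : Type*}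
  {X : TorusGroupoid ι B} {C : Type*} [TopologicalSpace C] [ChartedSpace E2 C] {p : C → B}

theorem exists_isFlatFrame [SimplyConnectedSpace C] (hX : X.IsRiemannian) (hp : Continuous p) :
    ∃ h, (X.pullback p).IsFlatFrame h := by
  have : LocallyPathConnectedSpace C := ChartedSpace.locallyPathConnectedSpace E2 C
  obtain ⟨h, h1, h2⟩ := exists_locally_constant_trivialization (fun a => p ⁻¹' X.U a)
    (fun a => (hX.isOpen a).preimage hp) (fun x => X.cover (p x)) (fun a c x => X.γ a c (p x))
    (fun a c x hx => hp.continuousAt.eventually (hX.γ_locConst a c (p x) hx))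
    (fun a c d x hx => hX.γ_cocycle a c d (p x) hx)
  exact ⟨h, h1, h2⟩

theorem pullback_A_compat (hX : X.IsRiemannian) (hp : ContMDiff 𝓘(ℝ, E2) 𝓘(ℝ, E2) ∞ p) (a c : ι)
    (x : C) (hx : x ∈ (X.pullback p).U a ∩ (X.pullback p).U c) (v : TangentSpace 𝓘(ℝ, E2) x) :
    (X.pullback p).A c x v =
      ((X.pullback p).γ a c x).1 *ᵥ ((X.pullback p).A a x v + (X.pullback p).df a c x v) := by
  have hx' : p x ∈ X.U a ∩ X.U c := hx
  have hf : MDifferentiableAt 𝓘(ℝ, E2) 𝓘(ℝ, Fin 2 → ℝ) (X.f a c) (p x) :=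
    ((hX.f_smooth a c).contMDiffAt
      (((hX.isOpen a).inter (hX.isOpen c)).mem_nhds hx')).mdifferentiableAt (by simp)
  have hd : (X.pullback p).df a c x v = X.df a c (p x) (surfaceDeriv p x v) :=
    congrArg (fun L : E2 →L[ℝ] (Fin 2 → ℝ) => L v)
      (mfderiv_comp x hf ((hp x).mdifferentiableAt (by simp)))
  rw [hd]
  exact hX.A_compat a c (p x) hx' (surfaceDeriv p x v)

/-- On the simply connected cover one frame and one orientation serve all pieces simultaneously,
which makes the complex structures compatible with the transition maps. -/
theorem exists_holomorphic_frameMap [IsManifold 𝓘(ℝ, E2) ∞ C] [SimplyConnectedSpace C] (hX : X.IsRiemannian)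
    (hRic : X.IsRicciFlat) (hc : ∃ c : ℝ, ∀ a, ∀ b ∈ X.U a, (X.G a b).det = c)
    (hp : IsLocalDiffeomorph 𝓘(ℝ, E2) 𝓘(ℝ, E2) ∞ p) {h : ι → C → GL (Fin 2) ℝ}
    (hh : (X.pullback p).IsFlatFrame h) :
    ∃ j : TangentEndo C, IsRotationField (X.pullback p).g univ j ∧
      IsHolomorphicToH j ((X.pullback p).frameMap h) ∧
      ∃ J : ι → TorusGroupoid.TotalEndo C, (X.pullback p).IsInvariant J ∧
        ∀ a, (X.pullback p).IsSemiflatKahler a j (J a) := by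
  have hY := (isFlatData hX hRic hc).pullback hX.g_riemannian hp
  have hG : ∀ a c, ∀ x ∈ (X.pullback p).U a ∩ (X.pullback p).U c, (X.pullback p).G a x =
      ((X.pullback p).γ a c x).1ᵀ * (X.pullback p).G c x * ((X.pullback p).γ a c x).1 :=
    fun a c x hx => hX.G_compat a c (p x) hx
  set Y := X.pullback p with hYdef
  have hF : ∀ a, ∀ b ∈ Y.U a, Y.frameMetric h b = framed Y a (h a) b := fun a b hb =>
    frameMetric_eq_framed hh hG hb
  let x : C → ℝ := fun b => Y.frameMetric h b 0 1 / Y.frameMetric h b 0 0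
  let s : C → ℝ := fun b => √(Y.frameMetric h b).det / Y.frameMetric h b 0 0
  have hsm : ∀ b, ContMDiffAt 𝓘(ℝ, E2) 𝓘(ℝ, ℝ) ∞ x b ∧ ContMDiffAt 𝓘(ℝ, E2) 𝓘(ℝ, ℝ) ∞ s b := by
    intro b
    obtain ⟨a, ha⟩ := Y.cover b
    obtain ⟨h1, h2⟩ := hY.contMDiffAt_framed ha (hh.locConst a b ha)
    have hU := (hY.isOpen a).mem_nhds ha
    exact ⟨h1.congr_of_eventuallyEq (Filter.mem_of_superset hU fun b hb => by
      simp only [mem_ofPred_eq, x, hF a b hb]),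
      h2.congr_of_eventuallyEq (Filter.mem_of_superset hU fun b hb => by
      simp only [mem_ofPred_eq, s, hF a b hb])⟩
  have : SimplyConnectedSpace (univ : Set C) :=
    (Homeomorph.Set.univ C).toHomotopyEquiv.simplyConnectedSpace
  obtain ⟨j, hj, hCR⟩ := exists_holomorphic_orientation (x := x) (s := s) hY.metric isOpen_univ
    (fun b _ => (hsm b).1) (fun b _ => (hsm b).2) fun b _ => by
      -- In a coordinate system lifted from the base, the metric and the two functions have the same
      -- expressions as downstairs with the frame frozen at one point. The equations on `B`
      -- therefore transfer directly.
      obtain ⟨ψ, hψ, hb, φ, hφ, hψφ⟩ := exists_lifted_chart hp b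
      refine ⟨ψ, hψ, hb, fun y hy _ => ?_⟩
      obtain ⟨a, ha⟩ := Y.cover (ψ.symm y)
      have hyd : y ∈ X.baseDom a φ := ⟨(hψφ y hy).1, by
        rw [mem_preimage, ← (hψφ y hy).2]; exact ha⟩
      have hev : ∀ᶠ z in 𝓝 y, z ∈ ψ.target ∧ Y.frameMetric h (ψ.symm z) =
          (h a (ψ.symm y)).1ᵀ * X.G a (φ.symm z) * (h a (ψ.symm y)).1 := by
        filter_upwards [ψ.open_target.mem_nhds hy,
          eventually_symm hy ((hY.isOpen a).mem_nhds ha),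
          eventually_symm hy (hh.locConst a _ ha)] with z hz hza hzh
        refine ⟨hz, ?_⟩
        rw [hF a _ hza, framed, hzh, ← (hψφ z hz).2]
        rfl
      have hmet : metricComp Y.g ψ =ᶠ[𝓝 y] metricComp X.g φ := by
        filter_upwards [ψ.open_target.mem_nhds hy] with z hz
        rw [hYdef, metricComp_pullback hp.contMDiff hψ hz]
        have he : (fun z => p (ψ.symm z)) =ᶠ[𝓝 z] φ.symm := by
          filter_upwards [ψ.open_target.mem_nhds hz] with w hw
          exact (hψφ w hw).2
        ext α β
        have hd : paramDeriv (fun z => p (ψ.symm z)) z = paramDeriv φ.symm z := he.mfderiv_eq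
        rw [metricAlong, Matrix.of_apply, hd, (hψφ z hz).2]
        rfl
      have hx : (fun z => x (ψ.symm z)) =ᶠ[𝓝 y] fun z =>
          ((h a (ψ.symm y)).1ᵀ * X.G a (φ.symm z) * (h a (ψ.symm y)).1) 0 1 /
            ((h a (ψ.symm y)).1ᵀ * X.G a (φ.symm z) * (h a (ψ.symm y)).1) 0 0 :=
        hev.mono fun z hz => by simp only [x, hz.2]
      have hs : (fun z => s (ψ.symm z)) =ᶠ[𝓝 y] fun z =>
          √((h a (ψ.symm y)).1ᵀ * X.G a (φ.symm z) * (h a (ψ.symm y)).1).det /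
            ((h a (ψ.symm y)).1ᵀ * X.G a (φ.symm z) * (h a (ψ.symm y)).1) 0 0 :=
        hev.mono fun z hz => by simp only [s, hz.2]
      obtain ⟨e1, e2, σ, hσ, e3⟩ := frame_equations hX hRic hc hφ hyd (h a (ψ.symm y))
      refine ⟨(laplacian_congr_metric hmet hx).trans e1, (laplacian_congr_metric hmet hs).trans e2,
        σ, hσ, fun a => (crDefect_congr hmet hx hs σ a).trans (e3 a)⟩
  have hrot := hj.isRotationField hY.metric
  refine ⟨j, hrot, isHolomorphicToH_of_isCauchyRiemannAt hrot (fun b => (hsm b).1)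
    (fun b => (hsm b).2) (fun b => rfl) (fun b => hCR b (mem_univ b)),
    fun a => semiflatEndo Y a (h a) j,
    isInvariant_semiflatEndo hh hG (pullback_A_compat hX hp.contMDiff) j, fun a => ?_⟩
  exact hY.isSemiflatKahler (hh.locConst a) (hrot.mono (subset_univ _)) (fun b _ => (hsm b).1)
    (fun b _ => (hsm b).2) (fun b hb => by simp only [x, hF a b hb])
    (fun b hb => by simp only [s, hF a b hb]) fun b _ => hCR b (mem_univ b)

/-- A function that is given on the sets of an open cover by locally constant functions is
constant. -/
theorem constant_of_locally_constant {T Z : Type*} [TopologicalSpace T] [PreconnectedSpace T]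
    {U : ι → Set T} (hU : ∀ a, IsOpen (U a)) (hcov : ∀ x, ∃ a, x ∈ U a) (D : ι → T → Z)
    (hD : ∀ a c, ∀ x ∈ U a ∩ U c, D a x = D c x)
    (hloc : ∀ a, ∀ x ∈ U a, ∀ᶠ x' in 𝓝 x, D a x' = D a x) {a c : ι} {x y : T} (hx : x ∈ U a)
    (hy : y ∈ U c) : D a x = D c y := by
  choose k hk using hcov
  have h : IsLocallyConstant fun x => D (k x) x := by
    rw [IsLocallyConstant.iff_eventually_eq]
    intro x
    filter_upwards [hloc _ x (hk x), (hU _).mem_nhds (hk x)] with x' h1 h2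
    rw [hD _ (k x) x' ⟨hk x', h2⟩, h1]
  rw [hD a (k x) x ⟨hx, hk x⟩, hD c (k y) y ⟨hy, hk y⟩]
  exact h.apply_eq_of_preconnectedSpace x y

/-- The element `h a (σ x)⁻¹ * h a x` does not depend on `a`, because the transition matrices at `σ
x` and `x` coincide, and it is locally constant in `x`. By connectedness it is a single matrix `ρ
σ`. -/
theorem exists_monodromy [SimplyConnectedSpace C] (hX : X.IsRiemannian) (hp : Continuous p)
    {h : ι → C → GL (Fin 2) ℝ} (hh : (X.pullback p).IsFlatFrame h) :
    ∃ ρ : deckGroup p →* GL (Fin 2) ℝ,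
      (∀ σ, |(ρ σ : Matrix (Fin 2) (Fin 2) ℝ).det| = 1) ∧
      (∀ σ a x, p x ∈ X.U a → h a (σ.1 x) * ρ σ = h a x) ∧
      (∀ σ x, (X.pullback p).frameMetric h (σ.1 x) =
        (ρ σ)⁻¹.1ᵀ * (X.pullback p).frameMetric h x * (ρ σ)⁻¹.1) := by
  have hU : ∀ a, IsOpen (p ⁻¹' X.U a) := fun a => (hX.isOpen a).preimage hp
  have hcov : ∀ x, ∃ a, x ∈ p ⁻¹' X.U a := fun x => X.cover (p x)
  have hloc : ∀ a x, p x ∈ X.U a → ∀ᶠ x' in 𝓝 x, h a x' = h a x := fun a x hx => hh.locConst a x hx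
  have hcomp : ∀ a c x, p x ∈ X.U a → p x ∈ X.U c → h c x = X.γ a c (p x) * h a x :=
    fun a c x ha hc => hh.compat a c x ⟨ha, hc⟩
  have hσU : ∀ (σ : deckGroup p) a x, p x ∈ X.U a → p (σ.1 x) ∈ X.U a := fun σ a x hx => by
    rw [σ.2 x]; exact hx
  obtain ⟨x₀⟩ : Nonempty C := inferInstance
  obtain ⟨a₀, ha₀⟩ := hcov x₀
  have hconst : ∀ (σ : deckGroup p) a x, p x ∈ X.U a →
      (h a (σ.1 x))⁻¹ * h a x = (h a₀ (σ.1 x₀))⁻¹ * h a₀ x₀ := by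
    intro σ a x hx
    refine constant_of_locally_constant hU hcov (fun a x => (h a (σ.1 x))⁻¹ * h a x) ?_ ?_ hx ha₀
    · intro a c x hx
      rw [hcomp a c x hx.1 hx.2, hcomp a c (σ.1 x) (hσU σ a x hx.1) (hσU σ c x hx.2), σ.2 x]
      group
    · intro a x hx
      filter_upwards [hloc a x hx, σ.1.continuous.continuousAt.eventually
        (hloc a (σ.1 x) (hσU σ a x hx))] with x' h1 h2
      rw [h1, h2]
  have hρ : ∀ (σ : deckGroup p) a x, p x ∈ X.U a →
      h a (σ.1 x) * ((h a₀ (σ.1 x₀))⁻¹ * h a₀ x₀) = h a x := fun σ a x hx => by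
    rw [← hconst σ a x hx, mul_inv_cancel_left]
  -- The absolute determinant of the frame is unchanged by transition matrices and locally constant,
  -- hence globally constant. Comparing its values at `σ x₀` and `x₀` gives `|det (ρ σ)| = 1`.
  have hdet : ∀ a c x y, p x ∈ X.U a → p y ∈ X.U c → |(h a x).1.det| = |(h c y).1.det| := by
    intro a c x y hx hy
    refine constant_of_locally_constant hU hcov (fun a x => |(h a x).1.det|) ?_ ?_ hx hy
    · intro a c x hx
      rw [hcomp a c x hx.1 hx.2, Units.val_mul, Matrix.det_mul, abs_mul,
        hX.γ_det a c (p x) hx, one_mul]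
    · intro a x hx
      filter_upwards [hloc a x hx] with x' h1
      rw [h1]
  refine ⟨MonoidHom.mk' (fun σ => (h a₀ (σ.1 x₀))⁻¹ * h a₀ x₀) fun σ τ => ?_, fun σ => ?_, hρ,
    fun σ x => ?_⟩
  -- Moving the frame from `σ τ x₀` to `τ x₀` and then to `x₀` multiplies it on the right by `ρ σ`
  -- and then by `ρ τ`, so the order of composition agrees with that of a homomorphism.
  · refine mul_left_cancel (a := h a₀ (σ.1 (τ.1 x₀))) ?_
    refine (hρ (σ * τ) a₀ x₀ ha₀).trans ?_
    rw [← mul_assoc, hρ σ a₀ (τ.1 x₀) (hσU τ a₀ x₀ ha₀), hρ τ a₀ x₀ ha₀]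
  · have h1 := congrArg (fun M : GL (Fin 2) ℝ => |M.1.det|) (hρ σ a₀ x₀ ha₀)
    simp only [Units.val_mul, Matrix.det_mul, abs_mul] at h1
    rw [hdet a₀ a₀ (σ.1 x₀) x₀ (hσU σ a₀ x₀ ha₀) ha₀] at h1
    have h0 : |(h a₀ x₀).1.det| ≠ 0 := abs_ne_zero.2 (isUnit_det_gl _).ne_zero
    change |((h a₀ (σ.1 x₀))⁻¹ * h a₀ x₀).1.det| = 1
    rw [Units.val_mul, Matrix.det_mul, abs_mul]
    exact mul_left_cancel₀ h0 (h1.trans (mul_one _).symm)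
  · obtain ⟨a, ha⟩ := hcov x
    have hG : ∀ a c, ∀ x ∈ (X.pullback p).U a ∩ (X.pullback p).U c, (X.pullback p).G a x =
        ((X.pullback p).γ a c x).1ᵀ * (X.pullback p).G c x * ((X.pullback p).γ a c x).1 :=
      fun a c x hx => hX.G_compat a c (p x) hx
    have hσ : h a (σ.1 x) = h a x * ((h a₀ (σ.1 x₀))⁻¹ * h a₀ x₀)⁻¹ :=
      eq_mul_inv_of_mul_eq (hρ σ a x ha)
    have hGσ : (X.pullback p).G a (σ.1 x) = (X.pullback p).G a x := congrArg (X.G a) (σ.2 x)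
    rw [frameMetric_eq_framed hh hG (hσU σ a x ha), frameMetric_eq_framed hh hG ha, framed, framed,
      hGσ, hσ]
    simp only [MonoidHom.mk'_apply, Units.val_mul, Matrix.transpose_mul, Matrix.mul_assoc]

end UniversalCover

end CoordGeom

theorem proposition3p6 {B : Type u} [TopologicalSpace B] [T2Space B] [SecondCountableTopology B]
    [ConnectedSpace B] [ChartedSpace E2 B] [IsManifold 𝓘(ℝ, E2) ∞ B] {ι : Type w}
    (X : TorusGroupoid ι B) (hX : X.IsRiemannian) (hRic : X.IsRicciFlat)
    (hbdd : ∃ C : ℝ, ∀ a, ∀ b ∈ X.U a, (X.G a b).det ≤ C) (hpar : IsParabolic X.g) :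
    -- `det G` is constant
    (∃ c : ℝ, ∀ a, ∀ b ∈ X.U a, (X.G a b).det = c) ∧
    -- `F = 0`
    (∀ a, ∀ φ ∈ atlas E2 B, ∀ y ∈ X.baseDom a φ, ∀ I α β, X.FComp a φ I α β y = 0) ∧
    -- for every universal cover `p : Bt → B`
    (∀ (Bt : Type v) [TopologicalSpace Bt] [SimplyConnectedSpace Bt] [ChartedSpace E2 Bt]
      [IsManifold 𝓘(ℝ, E2) ∞ Bt] (p : Bt → B), IsCoveringMap p →
      IsLocalDiffeomorph 𝓘(ℝ, E2) 𝓘(ℝ, E2) ∞ p →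
      -- the pulled back flat bundle is trivial
      (∃ h, (X.pullback p).IsFlatFrame h) ∧
      ∀ h, (X.pullback p).IsFlatFrame h →
        -- the map is equivariant for the monodromy representation `ρ`
        (∃ ρ : deckGroup p →* GL (Fin 2) ℝ,
          (∀ σ, |(ρ σ : Matrix (Fin 2) (Fin 2) ℝ).det| = 1) ∧
          (∀ σ a x, p x ∈ X.U a → h a (σ.1 x) * ρ σ = h a x) ∧
          (∀ σ x, (X.pullback p).frameMetric h (σ.1 x) =
            (ρ σ)⁻¹.1ᵀ * (X.pullback p).frameMetric h x * (ρ σ)⁻¹.1)) ∧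
        -- there is an orientation for which the map is holomorphic
        ∃ j : TangentEndo Bt, IsRotationField (X.pullback p).g univ j ∧
          IsHolomorphicToH j ((X.pullback p).frameMap h) ∧
          -- the groupoid over the universal cover is semiflat Kähler
          ∃ J : ι → TorusGroupoid.TotalEndo Bt, (X.pullback p).IsInvariant J ∧
            ∀ a, (X.pullback p).IsSemiflatKahler a j (J a)) ∧
    -- the metric on the unit space, the disjoint union of the `U a × ℝ²`, is semiflat Kähler
    (∀ a, ∃ (j : TangentEndo B) (J : TorusGroupoid.TotalEndo B), X.IsSemiflatKahler a j J) := by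
  have hc := CoordGeom.exists_det_eq hX hRic hbdd hpar
  refine ⟨hc, fun a φ hφ y hy I α β => CoordGeom.curvature_eq_zero hX hRic hc.choose_spec hφ hy I α β, ?_,
    CoordGeom.exists_isSemiflatKahler hX hRic hc⟩
  intro Bt _ _ _ _ p _ hp
  have hpc := hp.contMDiff.continuous
  exact ⟨CoordGeom.exists_isFlatFrame hX hpc, fun h hh =>
    ⟨CoordGeom.exists_monodromy hX hpc hh, CoordGeom.exists_holomorphic_frameMap hX hRic hc hp hh⟩⟩
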